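/- **Definitions.** Let $(\mathcal S,\oplus,\otimes,\preceq)$ be a fixed max-type semiring: $\preceq$ is a total order with least element $\mathbf 0$, $a\oplus b=\max_{\preceq}\{a,b\}$, and $\otimes$ is associative, distributes over $\oplus$, and is monotone in each argument. Fix an injective encoding (with decoder) of $\mathcal S$ by words over a finite alphabet such that $\otimes$ and the comparison $\preceq$ are computable on encoded elements in time and space polynomial in the length of the codes. A DP DAG consists of states $V=\{1,\dots,T\}$ in a fixed topological order (every edge $(u,v)\in E$ has $u<v$), the non-empty set $S_{\mathrm{src}}$ of the states of in-degree $0$, a non-empty set $T_{\mathrm{sink}}\subseteq V$ of sinks, initial values $a_v\in\mathcal S$ at the sources, weights $w_{u,v}\in\mathcal S$ on the edges, and a total order $\prec$ on $E$. Its DP values are $x_v=a_v$ for $v\in S_{\mathrm{src}}$ and $x_v=\bigoplus_{(u,v)\in E}(x_u\otimes w_{u,v})$ otherwise. For $v\notin S_{\mathrm{src}}$ let $\mathsf{pred}(v)$ be the $u$ for which $(u,v)$ is the $\prec$-least edge into $v$ with $x_u\otimes w_{u,v}=x_v$. The canonical witness path to $t\in T_{\mathrm{sink}}$ is the sequence $(v_0,\dots,v_k)$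 with $v_k=t$, $v_0\in S_{\mathrm{src}}$ and $v_{i-1}=\mathsf{pred}(v_i)$ for $1\le i\le k$. The frontier width is $$\omega=\max_{0\le \ell\le T}\bigl|\{v\le \ell:\ \exists w>\ell,\ (v,w)\in E\}\bigr|.$$ The machine model is the deterministic multitape Turing machine with a read-only input tape, a write-only output tape, and finitely many work tapes over a finite alphabet. The input consists of a header with $T$ and $t$, followed by one block for each vertex; the block of $v$ holds $a_v$ if $v$ is a source, and the tails and weights of the edges into $v$, in the order $\prec$. In one step the input head may move by one cell, or jump to the beginning of the block whose number is written in binary on an address tape. Space is the number of work-tape cells that are scanned, the address tape included. **Theorem (space complexity of traceback).** There is a deterministic machine $M$ of this kind, depending only on $\mathcal S$ and its encoding, such that for all constants $\Delta_{\max}$ and $c$ there are constants $C$ and $d$ with the following property. For every DP DAG in which all in-degrees are at most $\Delta_{\max}$ and all edge weights and DP values have codes of length at most $c\,(\lfloor\log_2T\rfloor+1)$, and for every sink $t\in T_{\mathrm{sink}}$, the canonical witness path to $t$ exists, is unique, and is optimal: its value, the product of the initial value of its source and of its edge weights in order, is $x_t$, and every path from a source to $t$ has value $\preceq x_t$. On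 the encoding of the DAG and of $t$, $M$ halts after writing this path, from source to $t$, on the output tape. It takes at most $C\,T^d$ steps and uses at most $$C\bigl(\omega\,(\lfloor\log_2T\rfloor+1)+(\lfloor\log_2T\rfloor+1)^d\bigr)=O(\omega\log T+\operatorname{polylog}T)$$ work-tape cells. -/

import Mathlib

/-!
# Traceback on dynamic-programming DAGs in the random-access multitape Turing machine model
-/

/-! ## Max-type semirings -/

/-- A max-type semiring: a total order with a least element `⊥` (the zero), whose addition is the
maximum `⊔`, and whose multiplication is associative, distributes over `⊔` and is monotone in each
argument.  Neither a multiplicative unit nor absorption by `⊥` is required. -/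
class MaxSemiring (S : Type) extends LinearOrder S, OrderBot S, Semigroup S where
  mul_sup_distrib : ∀ a b c : S, a * (b ⊔ c) = a * b ⊔ a * c
  sup_mul_distrib : ∀ a b c : S, (a ⊔ b) * c = a * c ⊔ b * c
  mul_right_mono : ∀ a b c : S, a ≤ b → a * c ≤ b * c
  mul_left_mono : ∀ a b c : S, a ≤ b → c * a ≤ c * b

/-! ## DP DAGs -/

/-- A DP DAG with values in `S`.  The states are `Fin T`; the vertex `v : Fin T` is the `(v + 1)`-st
vertex in the fixed topological order `1, …, T`. -/
structure DPDag (S : Type) where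
  /-- the number of states -/
  T : ℕ
  edges : Finset (Fin T × Fin T)
  edge_lt : ∀ e ∈ edges, e.1 < e.2
  sources : Finset (Fin T)
  /-- the sources are exactly the states of in-degree zero -/
  mem_sources_iff : ∀ v, v ∈ sources ↔ ∀ u, (u, v) ∉ edges
  sources_nonempty : sources.Nonempty
  sinks : Finset (Fin T)
  sinks_nonempty : sinks.Nonempty
  /-- initial values; only the ones at the sources matter -/
  init : Fin T → S
  weight : edges → S
  /-- the total order on the edges that breaks ties -/
  edgeOrder : LinearOrder edges

namespace DPDag

variable {S : Type} (G : DPDag S)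

/-- The tail `u` of an edge `(u, v)`. -/
def src (e : G.edges) : Fin G.T := e.1.1

/-- The head `v` of an edge `(u, v)`. -/
def tgt (e : G.edges) : Fin G.T := e.1.2

theorem src_lt_tgt (e : G.edges) : G.src e < G.tgt e := G.edge_lt e.1 e.2

/-- The edges that enter `v`. -/
def inEdges (v : Fin G.T) : Finset G.edges := Finset.univ.filter fun e => G.tgt e = v

theorem mem_inEdges {v : Fin G.T} {e : G.edges} : e ∈ G.inEdges v ↔ G.tgt e = v := by
  simp [inEdges]

/-- The in-degree of `v`. -/
def inDegree (v : Fin G.T) : ℕ := (G.inEdges v).card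

/-- The edges that enter `v`, listed in the tie-breaking order. -/
def inList (v : Fin G.T) : List G.edges :=
  letI : DecidableRel G.edgeOrder.le := G.edgeOrder.toDecidableLE
  haveI : IsTrans G.edges G.edgeOrder.le := ⟨fun a b c => G.edgeOrder.le_trans a b c⟩
  haveI : Std.Antisymm G.edgeOrder.le := ⟨fun a b => G.edgeOrder.le_antisymm a b⟩
  haveI : Std.Total G.edgeOrder.le := ⟨fun a b => G.edgeOrder.le_total a b⟩
  (G.inEdges v).sort G.edgeOrder.le

/-- The frontier at time `ℓ`: the vertices with index at most `ℓ` (in `1, …, T`) that have an edge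
to a vertex with index greater than `ℓ`. -/
def front (ℓ : ℕ) : Finset (Fin G.T) :=
  Finset.univ.filter fun v =>
    (v : ℕ) + 1 ≤ ℓ ∧ ∃ e : G.edges, G.src e = v ∧ ℓ < (G.tgt e : ℕ) + 1

/-- The frontier width `ω`: the largest size of a frontier at a time `0 ≤ ℓ ≤ T`. -/
def width : ℕ := (Finset.range (G.T + 1)).sup fun ℓ => (G.front ℓ).card

/-- The number `⌊log₂ T⌋ + 1` of binary digits of `T`. -/
def logT : ℕ := Nat.log 2 G.T + 1

variable [MaxSemiring S]

/-- The DP values: `x_v = a_v` at a source, and otherwise `x_v` is the maximum of `x_u ⊗ w_{u,v}`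
over the edges `(u, v)` that enter `v`. -/
def value (v : Fin G.T) : S :=
  if v ∈ G.sources then G.init v
  else (G.inEdges v).attach.sup fun e => value (G.src e.1) * G.weight e.1
termination_by v
decreasing_by
  have h := G.src_lt_tgt e.1
  rw [G.mem_inEdges.1 e.2] at h
  exact h

/-- The edge `e = (u, v)` attains the value of `v`: `x_u ⊗ w_{u,v} = x_v`. -/
def IsTight (e : G.edges) : Prop := G.value (G.src e) * G.weight e = G.value (G.tgt e)

/-- `u` is the witness predecessor of `v`: `(u, v)` is the first edge, in the tie-breaking order,
among the tight edges that enter `v`. -/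
def IsWitnessPred (u v : Fin G.T) : Prop :=
  ∃ e : G.edges, G.src e = u ∧ G.tgt e = v ∧ G.IsTight e ∧
    ∀ e' : G.edges, G.tgt e' = v → G.IsTight e' → G.edgeOrder.le e e'

/-- `P = (v_0, …, v_k)` is the canonical witness path to `t`: `v_k = t`, `v_0` is a source, and
`v_{i-1}` is the witness predecessor of `v_i` for `1 ≤ i ≤ k`. -/
def IsCanonicalPath (t : Fin G.T) (P : List (Fin G.T)) : Prop :=
  P.getLast? = some t ∧ (∃ v ∈ G.sources, P.head? = some v) ∧ P.IsChain G.IsWitnessPred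

/-- `G.IsSourcePath P v s`: the list `P` is a directed path from a source to `v`, and `s` is its
value, the product of the initial value of the source and of the weights of the edges. -/
inductive IsSourcePath : List (Fin G.T) → Fin G.T → S → Prop
  | source (v : Fin G.T) (hv : v ∈ G.sources) : IsSourcePath [v] v (G.init v)
  | snoc (P : List (Fin G.T)) (s : S) (e : G.edges) (hP : IsSourcePath P (G.src e) s) :
      IsSourcePath (P ++ [G.tgt e]) (G.tgt e) (s * G.weight e)

end DPDag

/-! ## Random-access multitape Turing machines -/

/-- Moves of a work-tape head. -/
inductive HeadMove
  | left
  | stay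
  | right

/-- Moves of the input head: one cell to the left or to the right, no move, or a jump to the
beginning of the block whose number is written on the address tape. -/
inductive InputMove
  | left
  | stay
  | right
  | jump

/-- What a machine does in one step: the next state, the symbols written on the work tapes, the
moves of the work heads, the move of the input head, and possibly a symbol that is appended to the
output. -/
structure MachineAction (State Sym Tp B : Type) where
  next : State
  write : Tp → Sym
  move : Tp → HeadMove
  inputMove : InputMove
  emit : Option B

/-- A deterministic multitape Turing machine with input alphabet `A` and output alphabet `B`.
It has a finite set of states, a finite set `Tp` of work tapes, infinite to the right, over a
finite alphabet `Sym`, a read-only input tape and a write-only output tape.  One of the work tapes,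
`addr`, also serves as the address tape for the jumps of the input head. -/
structure Machine (A B : Type) where
  State : Type
  Sym : Type
  Tp : Type
  finite_state : Finite State
  finite_sym : Finite Sym
  finite_tp : Finite Tp
  start : State
  blank : Sym
  addr : Tp
  /-- the symbols that are read as the binary digit `1` on the address tape; all others are read
  as the digit `0` -/
  isOne : Sym → Bool
  /-- the transition function; its arguments are the state, the symbol under the input head and
  the symbols under the work heads, and the machine halts where it is `none` -/
  δ : State → Option A → (Tp → Sym) → Option (MachineAction State Sym Tp B)

/-- The input tape that presents a list of blocks: the blocks one after the other, each followed by
an end marker `none`. -/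
def inputTape {A : Type} (bs : List (List A)) : List (Option A) :=
  bs.flatMap fun b => b.map some ++ [none]

/-- The position of the first cell of block number `n` (counted from `0`). -/
def blockStart {A : Type} (bs : List (List A)) (n : ℕ) : ℕ := (inputTape (bs.take n)).length

namespace Machine

variable {A B : Type} (M : Machine A B)

/-- A configuration. -/
structure Conf where
  state : M.State
  inputPos : ℕ
  head : M.Tp → ℕ
  tape : M.Tp → ℕ → M.Sym
  out : List B

/-- The initial configuration: all heads on cell `0`, blank work tapes, empty output. -/
def init : M.Conf where
  state := M.start
  inputPos := 0
  head := fun _ => 0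
  tape := fun _ _ => M.blank
  out := []

/-- The action prescribed in a configuration; `none` if the machine halts there.  To the right of
its last cell the input tape shows the end marker `none`. -/
def action (bs : List (List A)) (c : M.Conf) : Option (MachineAction M.State M.Sym M.Tp B) :=
  M.δ c.state ((inputTape bs).getD c.inputPos none) fun i => c.tape i (c.head i)

/-- The address in a configuration: the number whose binary digits, least significant digit first,
are the symbols strictly to the left of the head on the address tape. -/
def address (c : M.Conf) : ℕ :=
  ∑ p ∈ Finset.range (c.head M.addr), (M.isOne (c.tape M.addr p)).toNat * 2 ^ p

/-- The next position of a work head; at cell `0` a move to the left has no effect. -/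
def moveHead (p : ℕ) : HeadMove → ℕ
  | .left => p - 1
  | .stay => p
  | .right => p + 1

/-- The next position of the input head; it never leaves the input tape and the cell just after
it. -/
def moveInput (bs : List (List A)) (c : M.Conf) : InputMove → ℕ
  | .left => c.inputPos - 1
  | .stay => c.inputPos
  | .right => min (c.inputPos + 1) (inputTape bs).length
  | .jump => blockStart bs (M.address c)

/-- The configuration after an action. -/
def perform (bs : List (List A)) (c : M.Conf) (a : MachineAction M.State M.Sym M.Tp B) : M.Conf where
  state := a.next
  inputPos := M.moveInput bs c a.inputMove
  head := fun i => moveHead (c.head i) (a.move i)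
  tape := fun i => Function.update (c.tape i) (c.head i) (a.write i)
  out := c.out ++ a.emit.toList

/-- One step of the machine; halting configurations are fixed. -/
def step (bs : List (List A)) (c : M.Conf) : M.Conf :=
  match M.action bs c with
  | none => c
  | some a => M.perform bs c a

/-- The configuration after `n` steps on the input `bs`. -/
def conf (bs : List (List A)) (n : ℕ) : M.Conf := (M.step bs)^[n] M.init

/-- The work-tape cells that are scanned during the first `n` steps. -/
def scanned (bs : List (List A)) (n : ℕ) : Set (M.Tp × ℕ) :=
  {p | ∃ m ≤ n, (M.conf bs m).head p.1 = p.2}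

/-- On the input `bs` the machine halts with output `out` after at most `time` steps, and it uses
at most `space` cells of its work tapes, the address tape included. -/
def HaltsWithin (bs : List (List A)) (out : List B) (time space : ℕ) : Prop :=
  ∃ n ≤ time, M.action bs (M.conf bs n) = none ∧ (M.conf bs n).out = out ∧
    (M.scanned bs n).encard ≤ space

end Machine

/-- A binary function on `S`, whose results are written as strings over `B`, is computed by a
machine in time and space polynomial in the length of the encoded arguments. -/
def PolyComputable {S A B : Type} (enc : S → List A) (f : S → S → List B) : Prop :=
  ∃ (M : Machine A B) (C d : ℕ), ∀ a b : S,
    M.HaltsWithin [enc a, enc b] (f a b)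
      (C * ((enc a).length + (enc b).length + 1) ^ d)
      (C * ((enc a).length + (enc b).length + 1) ^ d)

/-! ## Encoding of instances and of paths -/

/-- Symbols of the encoding of an instance: binary digits for indices, the symbols of the encoding
of semiring elements, and a separator. -/
inductive InSym (Γ : Type)
  | bit (b : Bool)
  | val (g : Γ)
  | sep

namespace DPDag

variable {S Γ : Type} (G : DPDag S) (enc : S → List Γ)

/-- The index of `v` in `1, …, T`, in binary, least significant digit first. -/
def indexBits (v : Fin G.T) : List Bool := ((v : ℕ) + 1).bits

/-- The description of an edge that enters a given vertex: its tail and its weight. -/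
def edgeCode (e : G.edges) : List (InSym Γ) :=
  (G.indexBits (G.src e)).map .bit ++ [.sep] ++ (enc (G.weight e)).map .val ++ [.sep]

/-- The description of a vertex: its initial value if it is a source, followed by the list of the
edges that enter it, in the tie-breaking order. -/
def vertexCode (v : Fin G.T) : List (InSym Γ) :=
  (if v ∈ G.sources then (enc (G.init v)).map .val else []) ++ [.sep] ++
    (G.inList v).flatMap (G.edgeCode enc)

/-- The input for the DAG `G` and the target `t`: block `0` holds `T` and `t`, and block `v` holds
the description of the vertex with index `v ∈ {1, …, T}`. -/
def instanceCode (t : Fin G.T) : List (List (InSym Γ)) :=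
  (G.T.bits.map .bit ++ [.sep] ++ (G.indexBits t).map .bit) ::
    (List.finRange G.T).map (G.vertexCode enc)

/-- The output for a path: the indices of its vertices in binary, in the order of the path, each
followed by a separator `none`. -/
def pathCode (P : List (Fin G.T)) : List (Option Bool) :=
  P.flatMap fun v => (G.indexBits v).map some ++ [none]

/-- All edge weights and all DP values have codes of length at most `c` times the number of binary
digits of `T`. -/
def FitsInWords [MaxSemiring S] (c : ℕ) : Prop :=
  (∀ e : G.edges, (enc (G.weight e)).length ≤ c * G.logT) ∧
    ∀ v : Fin G.T, (enc (G.value v)).length ≤ c * G.logT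

end DPDag

/-!
The value of the DAG at a vertex is the maximum over the edges that enter it, so the first edge, in
the tie-breaking order, among those of maximal value defines the witness predecessor. Following
witness predecessors leads down to a source, since edges increase the index; this gives existence
and uniqueness of the canonical path (`DPDag.exists_canonicalPath`). No path has a larger value
because multiplication is monotone (`DPDag.IsSourcePath.le_value`).

The machine recomputes instead of storing. A *sweep* evaluates the vertices `1, …, x` in their
order and keeps a table with the values of those vertices that still have an edge to a vertex not
yet evaluated. After `ℓ` vertices these form the frontier at time `ℓ` (`DPDag.frontList`), so the
table never has more than `ω + 1` entries, each of length `O(log T)`. Whether a value is still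
needed is decided by a search through the later blocks of the input, and at the end of the sweep the
witness predecessor of `x` is known (`Traceback.exec_sweep`). The canonical path ends at the target
but has to be written from its source on. It would take too much space to store it, so for each of
its vertices the machine descends again from the target, one sweep per vertex, until the predecessor
of the present vertex is the vertex written last (`Traceback.exec_descend`,
`Traceback.exec_outputNext`). Space beyond the table is needed only for a bounded number of indices
and values and for one product or comparison at a time, whose time, and hence space, is
polylogarithmic in `T`.

The machine is obtained from a structured program that works on finitely many stacks. `Prog.Run` is
the semantics of such programs; it carries a bound on the heights of the stacks and on the number of
rounds of each loop. The first bound gives the space. The second one gives the time, since the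
running time of a fixed program is polynomial in it (`Prog.exists_cost_le`). A program becomes a
flow chart and then a Turing machine in which each stack is a tape (`Prog.Run.haltsWithin`).
Conversely, the given machines for products and comparisons are simulated by programs
(`SimCode.exec_simulate`), so that they can be called as subroutines (`Traceback.isArith_call`).
-/

/-! ### Optimality and uniqueness of the canonical witness path -/

namespace DPDag

section Path

variable {S : Type} (G : DPDag S)

theorem tgt_notMem_sources (e : G.edges) : G.tgt e ∉ G.sources :=
  fun h => (G.mem_sources_iff _).1 h (G.src e) e.2

theorem mem_inList {v : Fin G.T} {e : G.edges} : e ∈ G.inList v ↔ G.tgt e = v := by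
  rw [← G.mem_inEdges]
  exact Finset.mem_sort _

theorem pairwise_inList (v : Fin G.T) : (G.inList v).Pairwise G.edgeOrder.le :=
  letI : DecidableRel G.edgeOrder.le := G.edgeOrder.toDecidableLE
  haveI : IsTrans G.edges G.edgeOrder.le := ⟨fun a b c => G.edgeOrder.le_trans a b c⟩
  haveI : Std.Antisymm G.edgeOrder.le := ⟨fun a b => G.edgeOrder.le_antisymm a b⟩
  haveI : Std.Total G.edgeOrder.le := ⟨fun a b => G.edgeOrder.le_total a b⟩
  Finset.pairwise_sort _ _

theorem inList_eq_nil_iff {v : Fin G.T} : G.inList v = [] ↔ v ∈ G.sources := by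
  rw [G.mem_sources_iff, List.eq_nil_iff_forall_not_mem]
  constructor
  · intro h u hu
    exact h ⟨(u, v), hu⟩ (G.mem_inList.2 rfl)
  · intro h e he
    rw [mem_inList] at he
    exact h (G.src e) (he ▸ e.2)

variable [MaxSemiring S]

/-- The contribution `x_u ⊗ w_{u,v}` of an edge to the value of its head. -/
def edgeValue (e : G.edges) : S := G.value (G.src e) * G.weight e

theorem value_of_mem_sources {v : Fin G.T} (hv : v ∈ G.sources) : G.value v = G.init v := by
  rw [value, if_pos hv]

theorem value_of_notMem_sources {v : Fin G.T} (hv : v ∉ G.sources) :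
    G.value v = (G.inEdges v).sup G.edgeValue := by
  rw [value, if_neg hv]
  exact Finset.sup_attach (G.inEdges v) G.edgeValue

theorem edgeValue_le (e : G.edges) : G.edgeValue e ≤ G.value (G.tgt e) := by
  rw [value_of_notMem_sources _ (G.tgt_notMem_sources e)]
  exact Finset.le_sup (G.mem_inEdges.2 rfl)

/-- No path has a larger value than its end, as multiplication is monotone. -/
theorem IsSourcePath.le_value {Q : List (Fin G.T)} {t : Fin G.T} {s : S}
    (h : G.IsSourcePath Q t s) : s ≤ G.value t := by
  induction h with
  | source v hv => exact (G.value_of_mem_sources hv).ge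
  | snoc P s e _ ih => exact (MaxSemiring.mul_right_mono _ _ _ ih).trans (G.edgeValue_le e)

/-- `e` is the first among the edges in `l` of maximal value. -/
def IsFirstMax (l : List G.edges) (e : G.edges) : Prop :=
  e ∈ l ∧ ∀ e' ∈ l, G.edgeValue e' ≤ G.edgeValue e ∧
    (G.edgeValue e' = G.edgeValue e → G.edgeOrder.le e e')

variable {G}

theorem isFirstMax_singleton (e : G.edges) : G.IsFirstMax [e] e := by
  refine ⟨by simp, fun e' he' => ?_⟩
  obtain rfl : e' = e := by simpa using he'
  exact ⟨le_rfl, fun _ => G.edgeOrder.le_refl _⟩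

theorem IsFirstMax.append_of_le {l : List G.edges} {e e' : G.edges} (h : G.IsFirstMax l e)
    (hs : (l ++ [e']).Pairwise G.edgeOrder.le) (hle : G.edgeValue e' ≤ G.edgeValue e) :
    G.IsFirstMax (l ++ [e']) e := by
  refine ⟨by simp [h.1], fun f hf => ?_⟩
  rcases List.mem_append.1 hf with hf | hf
  · exact h.2 f hf
  · rw [List.mem_singleton] at hf
    subst hf
    exact ⟨hle, fun _ => (List.pairwise_append.1 hs).2.2 e h.1 f (by simp)⟩

theorem IsFirstMax.append_of_lt {l : List G.edges} {e e' : G.edges} (h : G.IsFirstMax l e)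
    (hlt : G.edgeValue e < G.edgeValue e') : G.IsFirstMax (l ++ [e']) e' := by
  refine ⟨by simp, fun f hf => ?_⟩
  rcases List.mem_append.1 hf with hf | hf
  · have := (h.2 f hf).1.trans_lt hlt
    exact ⟨this.le, fun h => absurd h this.ne⟩
  · rw [List.mem_singleton] at hf
    subst hf
    exact ⟨le_rfl, fun _ => G.edgeOrder.le_refl _⟩

theorem exists_isFirstMax {l : List G.edges} (hs : l.Pairwise G.edgeOrder.le) (hl : l ≠ []) :
    ∃ e, G.IsFirstMax l e := by
  induction l using List.reverseRecOn with
  | nil => exact absurd rfl hl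
  | append_singleton l e ih =>
    by_cases h : l = []
    · subst h
      exact ⟨e, isFirstMax_singleton e⟩
    · obtain ⟨f, hf⟩ := ih (List.pairwise_append.1 hs).1 h
      rcases le_or_gt (G.edgeValue e) (G.edgeValue f) with hle | hlt
      · exact ⟨f, hf.append_of_le hs hle⟩
      · exact ⟨e, hf.append_of_lt hlt⟩

theorem IsFirstMax.value_eq {v : Fin G.T} {e : G.edges} (h : G.IsFirstMax (G.inList v) e) :
    G.value v = G.edgeValue e := by
  have he := G.mem_inList.1 h.1
  have hv : v ∉ G.sources := he ▸ G.tgt_notMem_sources e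
  refine le_antisymm ?_ (he ▸ G.edgeValue_le e)
  rw [G.value_of_notMem_sources hv]
  exact Finset.sup_le fun e' he' => (h.2 e' (G.mem_inList.2 (G.mem_inEdges.1 he'))).1

theorem IsFirstMax.isTight {v : Fin G.T} {e : G.edges} (h : G.IsFirstMax (G.inList v) e) :
    G.IsTight e := by
  have he := G.mem_inList.1 h.1
  rw [IsTight, he, h.value_eq]
  rfl

/-- The first edge of maximal value into `v` is the one that defines the witness predecessor. -/
theorem IsFirstMax.isWitnessPred {v : Fin G.T} {e : G.edges} (h : G.IsFirstMax (G.inList v) e) :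
    G.IsWitnessPred (G.src e) v := by
  refine ⟨e, rfl, G.mem_inList.1 h.1, h.isTight, fun e' he' ht => ?_⟩
  refine (h.2 e' (G.mem_inList.2 he')).2 ?_
  rw [← h.value_eq, ← he']
  exact ht

theorem IsWitnessPred.unique {u u' v : Fin G.T} (h : G.IsWitnessPred u v)
    (h' : G.IsWitnessPred u' v) : u = u' := by
  obtain ⟨e, rfl, he, ht, hm⟩ := h
  obtain ⟨e', rfl, he', ht', hm'⟩ := h'
  rw [G.edgeOrder.le_antisymm e e' (hm e' he' ht') (hm' e he ht)]

theorem IsWitnessPred.notMem_sources {u v : Fin G.T} (h : G.IsWitnessPred u v) :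
    v ∉ G.sources := by
  obtain ⟨e, -, rfl, -⟩ := h
  exact G.tgt_notMem_sources e

theorem IsWitnessPred.lt {u v : Fin G.T} (h : G.IsWitnessPred u v) : u < v := by
  obtain ⟨e, rfl, rfl, -⟩ := h
  exact G.src_lt_tgt e

theorem IsCanonicalPath.pairwise {t : Fin G.T} {P : List (Fin G.T)} (h : G.IsCanonicalPath t P) :
    P.Pairwise (· < ·) :=
  List.isChain_iff_pairwise.1 (h.2.2.imp fun _ _ h => h.lt)

/-- The canonical witness path exists, is unique and has the value of its end. -/
theorem exists_canonicalPath (v : Fin G.T) : ∃ P, G.IsCanonicalPath v P ∧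
    (∀ P', G.IsCanonicalPath v P' → P' = P) ∧ G.IsSourcePath P v (G.value v) := by
  induction v using WellFoundedLT.induction with
  | ind v ih =>
  by_cases hv : v ∈ G.sources
  · refine ⟨[v], ⟨rfl, ⟨v, hv, rfl⟩, by simp⟩, ?_, ?_⟩
    · rintro P ⟨hl, -, hc⟩
      obtain ⟨Q, rfl⟩ := List.getLast?_eq_some_iff.1 hl
      rcases Q.eq_nil_or_concat with rfl | ⟨Q, u, rfl⟩
      · rfl
      · have := (List.isChain_append.1 hc).2.2 u (by simp) v (by simp)
        exact absurd hv this.notMem_sources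
    · rw [G.value_of_mem_sources hv]
      exact .source v hv
  · obtain ⟨e, he⟩ := exists_isFirstMax (G.pairwise_inList v) (mt G.inList_eq_nil_iff.1 hv)
    have hw := he.isWitnessPred
    obtain ⟨Q, ⟨hl, ⟨s, hs, hh⟩, hc⟩, huniq, hp⟩ := ih _ hw.lt
    obtain ⟨Q, rfl⟩ := List.getLast?_eq_some_iff.1 hl
    refine ⟨(Q ++ [G.src e]) ++ [v], ⟨by simp, ⟨s, hs, ?_⟩, ?_⟩, ?_, ?_⟩
    · rw [List.head?_append, hh]; rfl
    · refine List.isChain_append.2 ⟨hc, by simp, fun x hx y hy => ?_⟩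
      obtain rfl : G.src e = x := by simpa using hx
      obtain rfl : v = y := by simpa using hy
      exact hw
    · rintro P ⟨hl', ⟨s', hs', hh'⟩, hc'⟩
      obtain ⟨R, rfl⟩ := List.getLast?_eq_some_iff.1 hl'
      rcases R.eq_nil_or_concat with rfl | ⟨R, u, rfl⟩
      · obtain rfl : v = s' := by simpa using hh'
        exact absurd hs' hv
      · have hu := (List.isChain_append.1 hc').2.2 u (by simp) v (by simp)
        obtain rfl := hu.unique hw
        rw [List.concat_eq_append] at *
        rw [huniq (R ++ [G.src e]) ⟨by simp, ⟨s', hs', ?_⟩, (List.isChain_append.1 hc').1⟩]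
        rw [← hh']
        simp [List.head?_append]
    · have := IsSourcePath.snoc _ _ e hp
      rw [G.mem_inList.1 he.1] at this
      rwa [he.value_eq]

end Path

end DPDag

section Machines

/-! ### Programs over stacks -/

variable {A B K Γ : Type}

/-- What a program sees: the symbol under the input head and the top of each stack. -/
structure View (A K Γ : Type) where
  sym : Option A
  top : K → Option Γ

/-- Moves of the input head that programs use. -/
inductive Scan
  | stay
  | right
  | jump

/-- A basic action: the top of the stack `k` is replaced by the first two symbols of `put k`
(topmost symbol first), then the input head moves, and possibly a symbol is emitted. -/
structure Act (B K Γ : Type) where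
  put : K → List Γ
  scan : Scan
  emit : Option B

/-- The data on which a program works: the stacks (topmost symbol first), the part of the input tape
to the right of the input head, and the output written so far. -/
@[ext] structure Store (A B K Γ : Type) where
  reg : K → List Γ
  inp : List (Option A)
  out : List B

/-- Structured programs over a family `K` of stacks with symbols in `Γ`. -/
inductive Prog (A B K Γ : Type) : Type
  | act (f : View A K Γ → Act B K Γ)
  | seq (p q : Prog A B K Γ)
  | ite (c : View A K Γ → Bool) (p q : Prog A B K Γ)
  | loop (c : View A K Γ → Bool) (p : Prog A B K Γ)

/-- The fixed data of an execution: the input blocks, the stack that holds jump addresses and the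
symbols that count as the digit `1` there, a bound `N` on the number of rounds of each single loop,
and a bound `H` on the heights of the stacks.  Loops run through a stack or through the input, hence
the two conditions on `N`. -/
structure Env (A K Γ : Type) where
  bs : List (List A)
  addr : K
  one : Γ → Bool
  N : ℕ
  H : ℕ
  height_le : H ≤ N
  tape_le : (inputTape bs).length ≤ N

/-- The number whose most significant binary digit is on top of the stack `l`. -/
def addrVal (one : Γ → Bool) : List Γ → ℕ
  | [] => 0
  | x :: l => addrVal one l + (one x).toNat * 2 ^ l.length

namespace Store

/-- What a program sees of its data. -/
def view (s : Store A B K Γ) : View A K Γ := ⟨s.inp.head?.join, fun k => (s.reg k).head?⟩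

/-- The effect of a basic action.  A jump uses the address left by the stack operations of the same
action. -/
def apply (E : Env A K Γ) (s : Store A B K Γ) (a : Act B K Γ) : Store A B K Γ where
  reg := fun k => (a.put k).take 2 ++ (s.reg k).tail
  inp := match a.scan with
    | .stay => s.inp
    | .right => s.inp.tail
    | .jump => inputTape (E.bs.drop (addrVal E.one ((a.put E.addr).take 2 ++ (s.reg E.addr).tail)))
  out := s.out ++ a.emit.toList

/-- All stacks have height at most `H`. -/
def Le (s : Store A B K Γ) (H : ℕ) : Prop := ∀ k, (s.reg k).length ≤ H

end Store

/-- `Iter c R k s s'`: a loop with condition `c` and body `R` leads from `s` to `s'` in exactly `k`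
rounds. -/
def Iter {σ : Type} (c : σ → Prop) (R : σ → σ → Prop) : ℕ → σ → σ → Prop
  | 0, s, s' => ¬ c s ∧ s = s'
  | k + 1, s, s' => c s ∧ ∃ m, R s m ∧ Iter c R k m s'

namespace Prog

/-- Big-step semantics: `p` leads from `s` to `s'`, each execution of a loop takes at most `E.N`
rounds, and no stack ever gets higher than `E.H`.  Running time is not part of it, as it is
controlled by the bound on the rounds of the loops, see `Prog.cost`. -/
def Run (E : Env A K Γ) : Prog A B K Γ → Store A B K Γ → Store A B K Γ → Prop
  | act f, s, s' => s' = s.apply E (f s.view) ∧ s'.Le E.H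
  | seq p q, s, s' => ∃ m, Run E p s m ∧ Run E q m s'
  | ite c p q, s, s' => if c s.view then Run E p s s' else Run E q s s'
  | loop c p, s, s' => ∃ k ≤ E.N, Iter (fun s => c s.view) (Run E p) k s s'

/-- A bound on the number of basic actions and tests in a run in which each execution of a loop
takes at most `N` rounds. -/
def cost (N : ℕ) : Prog A B K Γ → ℕ
  | act _ => 1
  | seq p q => cost N p + cost N q
  | ite _ p q => 1 + (cost N p + cost N q)
  | loop _ p => N * (1 + cost N p) + 1

/-- For a fixed program the running time is polynomial in the bound on the rounds of its loops. -/
theorem exists_cost_le (p : Prog A B K Γ) : ∃ C d : ℕ, ∀ N, p.cost N ≤ C * (N + 1) ^ d := by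
  induction p with
  | act f => exact ⟨1, 0, fun N => by simp [cost]⟩
  | seq p q hp hq =>
    obtain ⟨C, d, h⟩ := hp
    obtain ⟨C', d', h'⟩ := hq
    refine ⟨C + C', d + d', fun N => ?_⟩
    have h1 : (N + 1) ^ d ≤ (N + 1) ^ (d + d') := Nat.pow_le_pow_right (by omega) (by omega)
    have h2 : (N + 1) ^ d' ≤ (N + 1) ^ (d + d') := Nat.pow_le_pow_right (by omega) (by omega)
    calc cost N p + cost N q ≤ C * (N + 1) ^ d + C' * (N + 1) ^ d' := add_le_add (h N) (h' N)
      _ ≤ C * (N + 1) ^ (d + d') + C' * (N + 1) ^ (d + d') := by gcongr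
      _ = _ := by ring
  | ite c p q hp hq =>
    obtain ⟨C, d, h⟩ := hp
    obtain ⟨C', d', h'⟩ := hq
    refine ⟨1 + C + C', d + d', fun N => ?_⟩
    have h0 : 1 ≤ (N + 1) ^ (d + d') := Nat.one_le_pow _ _ (by omega)
    have h1 : (N + 1) ^ d ≤ (N + 1) ^ (d + d') := Nat.pow_le_pow_right (by omega) (by omega)
    have h2 : (N + 1) ^ d' ≤ (N + 1) ^ (d + d') := Nat.pow_le_pow_right (by omega) (by omega)
    calc 1 + (cost N p + cost N q)
        ≤ (N + 1) ^ (d + d') + (C * (N + 1) ^ d + C' * (N + 1) ^ d') :=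
          add_le_add h0 (add_le_add (h N) (h' N))
      _ ≤ (N + 1) ^ (d + d') + (C * (N + 1) ^ (d + d') + C' * (N + 1) ^ (d + d')) := by gcongr
      _ = _ := by ring
  | loop c p hp =>
    obtain ⟨C, d, h⟩ := hp
    refine ⟨1 + C, d + 1, fun N => ?_⟩
    have h0 : 1 ≤ (N + 1) ^ d := Nat.one_le_pow _ _ (by omega)
    calc N * (1 + cost N p) + 1 ≤ (N + 1) * (1 + cost N p) := by ring_nf; omega
      _ ≤ (N + 1) * ((N + 1) ^ d + C * (N + 1) ^ d) := by gcongr; exact h N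
      _ = _ := by ring

end Prog

/-! ### Flow charts -/

/-- A flow chart with one entry and one exit: in the node `q` it performs an action, chosen
according to what it sees, and goes to another node or to the exit `none`. -/
structure Frag (A B K Γ : Type) where
  Q : Type
  fin : Finite Q
  start : Q
  δ : Q → View A K Γ → Option Q × Act B K Γ

/-- The action that changes nothing. -/
def Act.keep (v : View A K Γ) : Act B K Γ := ⟨fun k => (v.top k).toList, .stay, none⟩

theorem Store.apply_keep (E : Env A K Γ) (s : Store A B K Γ) :
    s.apply E (Act.keep s.view) = s := by
  ext1
  · funext k
    simp only [apply, Act.keep, view]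
    cases s.reg k <;> simp
  · rfl
  · simp [apply, Act.keep]

namespace Frag

/-- `F.Reach E n q s q' s'`: in `n` actions the flow chart gets from the node `q` with data `s` to
the node `q'` with data `s'`, with stacks of height at most `E.H` after each action. -/
inductive Reach (E : Env A K Γ) (F : Frag A B K Γ) :
    ℕ → Option F.Q → Store A B K Γ → Option F.Q → Store A B K Γ → Prop
  | refl (q s) : Reach E F 0 q s q s
  | step (n : ℕ) (q : F.Q) (s : Store A B K Γ) (q' s') (hH : (s.apply E (F.δ q s.view).2).Le E.H)
      (h : Reach E F n (F.δ q s.view).1 (s.apply E (F.δ q s.view).2) q' s') :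
      Reach E F (n + 1) (some q) s q' s'

theorem Reach.trans {E : Env A K Γ} {F : Frag A B K Γ} {n m q q' q'' s s' s''}
    (h : F.Reach E n q s q' s') (h' : F.Reach E m q' s' q'' s'') :
    F.Reach E (n + m) q s q'' s'' := by
  induction h with
  | refl => simpa using h'
  | step n q s q' s' hH h ih =>
    rw [Nat.add_right_comm]
    exact .step _ _ _ _ _ hH (ih h')

/-- A run of a flow chart `F₁` from a node to its exit is a run of a flow chart `F` that contains
`F₁` and continues at the node `e` where `F₁` exits. -/
theorem Reach.embed {E : Env A K Γ} {F₁ F : Frag A B K Γ} (f : F₁.Q → F.Q) (e : Option F.Q)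
    (hf : ∀ q v, F.δ (f q) v = ((F₁.δ q v).1.elim e (fun q' => some (f q')), (F₁.δ q v).2))
    {n q s s'} (h : F₁.Reach E n q s none s') :
    F.Reach E n (q.elim e (fun q' => some (f q'))) s e s' := by
  generalize hq' : (none : Option F₁.Q) = q' at h
  induction h with
  | refl => subst hq'; exact .refl _ _
  | step n q s q' s' hH h ih =>
    refine .step _ _ _ _ _ ?_ ?_
    · rw [hf]; exact hH
    · rw [hf]; exact ih hq'

/-- A single action. -/
def act (f : View A K Γ → Act B K Γ) : Frag A B K Γ where
  Q := Unit
  fin := inferInstance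
  start := ()
  δ := fun _ v => (none, f v)

/-- The exit of `F` is redirected to the entry of `G`. -/
def seq (F G : Frag A B K Γ) : Frag A B K Γ where
  Q := F.Q ⊕ G.Q
  fin := by have := F.fin; have := G.fin; infer_instance
  start := .inl F.start
  δ := fun q v => match q with
    | .inl q => ((F.δ q v).1.elim (some (.inr G.start)) (fun q => some (.inl q)), (F.δ q v).2)
    | .inr q => ((G.δ q v).1.elim none (fun q => some (.inr q)), (G.δ q v).2)

/-- The node `none` tests the condition. -/
def ite (c : View A K Γ → Bool) (F G : Frag A B K Γ) : Frag A B K Γ where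
  Q := Option (F.Q ⊕ G.Q)
  fin := by have := F.fin; have := G.fin; infer_instance
  start := none
  δ := fun q v => match q with
    | none => (some (some (if c v then .inl F.start else .inr G.start)), Act.keep v)
    | some (.inl q) => ((F.δ q v).1.elim none (fun q => some (some (.inl q))), (F.δ q v).2)
    | some (.inr q) => ((G.δ q v).1.elim none (fun q => some (some (.inr q))), (G.δ q v).2)

/-- The node `none` tests the condition before each round. -/
def loop (c : View A K Γ → Bool) (F : Frag A B K Γ) : Frag A B K Γ where
  Q := Option F.Q
  fin := by have := F.fin; infer_instance
  start := none
  δ := fun q v => match q with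
    | none => (if c v then some (some F.start) else none, Act.keep v)
    | some q => ((F.δ q v).1.elim (some none) (fun q => some (some q)), (F.δ q v).2)

end Frag

namespace Prog

/-- The flow chart of a program. -/
def frag : Prog A B K Γ → Frag A B K Γ
  | act f => .act f
  | seq p q => .seq p.frag q.frag
  | ite c p q => .ite c p.frag q.frag
  | loop c p => .loop c p.frag

theorem Run.le {E : Env A K Γ} {p : Prog A B K Γ} {s s' : Store A B K Γ} (h : p.Run E s s')
    (hs : s.Le E.H) : s'.Le E.H := by
  induction p generalizing s s' with
  | act f => exact h.2
  | seq p q hp hq => obtain ⟨m, h1, h2⟩ := h; exact hq h2 (hp h1 hs)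
  | ite c p q hp hq =>
    simp only [Run] at h
    split_ifs at h
    · exact hp h hs
    · exact hq h hs
  | loop c p hp =>
    obtain ⟨k, -, h⟩ := h
    induction k generalizing s with
    | zero => obtain ⟨-, rfl⟩ := h; exact hs
    | succ k ih => obtain ⟨-, m, h1, h2⟩ := h; exact ih (hp h1 hs) h2

/-- A run of a program is a run of its flow chart, whose length is bounded by `Prog.cost`. -/
theorem Run.reach {E : Env A K Γ} {p : Prog A B K Γ} {s s' : Store A B K Γ} (h : p.Run E s s')
    (hs : s.Le E.H) :
    ∃ n ≤ p.cost E.N, p.frag.Reach E n (some p.frag.start) s none s' := by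
  induction p generalizing s s' with
  | act f =>
    obtain ⟨rfl, h2⟩ := h
    exact ⟨1, le_rfl, .step _ _ _ _ _ h2 (.refl _ _)⟩
  | seq p q hp hq =>
    obtain ⟨m, h1, h2⟩ := h
    obtain ⟨a, ha, r1⟩ := hp h1 hs
    obtain ⟨b, hb, r2⟩ := hq h2 (h1.le hs)
    exact ⟨a + b, add_le_add ha hb,
      (r1.embed (F := .seq p.frag q.frag) .inl (some (.inr q.frag.start)) fun _ _ => rfl).trans
        (r2.embed (F := .seq p.frag q.frag) .inr none fun _ _ => rfl)⟩
  | ite c p q hp hq =>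
    simp only [Run] at h
    have key : ∀ (n : ℕ), n ≤ cost E.N p + cost E.N q →
        (Frag.ite c p.frag q.frag).Reach E n
          (some (some (if c s.view then .inl p.frag.start else .inr q.frag.start))) s none s' →
        ∃ n ≤ (ite c p q).cost E.N, (Frag.ite c p.frag q.frag).Reach E n (some none) s none s' := by
      intro n hn hr
      refine ⟨n + 1, by simp only [cost]; omega, .step _ _ _ _ _ ?_ ?_⟩
      · simpa only [Frag.ite, Store.apply_keep] using hs
      · simpa only [Frag.ite, Store.apply_keep] using hr
    split_ifs at h with hc
    · obtain ⟨n, hn, r⟩ := hp h hs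
      refine key n (by omega) ?_
      rw [if_pos hc]
      exact r.embed (F := .ite c p.frag q.frag) (fun q => some (.inl q)) none fun _ _ => rfl
    · obtain ⟨n, hn, r⟩ := hq h hs
      refine key n (by omega) ?_
      rw [if_neg hc]
      exact r.embed (F := .ite c p.frag q.frag) (fun q => some (.inr q)) none fun _ _ => rfl
  | loop c p hp =>
    obtain ⟨k, hk, h⟩ := h
    have : ∃ n ≤ k * (1 + cost E.N p) + 1,
        (Frag.loop c p.frag).Reach E n (some none) s none s' := by
      clear hk
      induction k generalizing s with
      | zero =>
        obtain ⟨hc, rfl⟩ := h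
        refine ⟨1, by omega, .step _ _ _ _ _ ?_ ?_⟩
        · simpa only [Frag.loop, Store.apply_keep] using hs
        · simp only [Frag.loop, Store.apply_keep, hc]
          exact .refl _ _
      | succ k ih =>
        obtain ⟨hc, m, h1, h2⟩ := h
        obtain ⟨a, ha, r1⟩ := hp h1 hs
        obtain ⟨b, hb, r2⟩ := ih (h1.le hs) h2
        refine ⟨a + b + 1, by rw [add_mul]; omega, .step _ _ _ _ _ ?_ ?_⟩
        · simpa only [Frag.loop, Store.apply_keep] using hs
        · have := (r1.embed (F := .loop c p.frag) some (some none) fun _ _ => rfl).trans r2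
          simpa only [Frag.loop, Store.apply_keep, hc, if_true, Option.elim] using this
    obtain ⟨n, hn, r⟩ := this
    refine ⟨n, hn.trans ?_, r⟩
    simp only [cost]
    gcongr

end Prog

/-! ### From flow charts to Turing machines -/

/-- The control states of the Turing machine of a flow chart.  After the initial step, which marks
the first cell of each tape, each action takes four steps: `look` moves the heads to the topmost
symbols, `pick` reads them and writes the first new symbol, `put` writes the second new symbol,
and `scan` moves the input head and emits. -/
inductive Phase (B K Γ Q : Type)
  | init
  | look (q : Option Q)
  | pick (q : Q) (e : K → Bool)
  | put (q : Option Q) (g : K → Option Γ) (m : Scan) (b : Option B)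
  | scan (q : Option Q) (m : Scan) (b : Option B)

instance : Finite Scan :=
  Finite.of_injective (β := Bool × Bool)
    (fun m => match m with
      | .stay => (false, false)
      | .right => (false, true)
      | .jump => (true, false))
    (by rintro (_ | _ | _) (_ | _ | _) <;> simp)

instance {Q : Type} [Finite B] [Finite K] [Finite Γ] [Finite Q] : Finite (Phase B K Γ Q) :=
  Finite.of_injective
    (β := Unit ⊕ Option Q ⊕ (Q × (K → Bool)) ⊕ (Option Q × (K → Option Γ) × Scan × Option B) ⊕
      (Option Q × Scan × Option B))
    (fun x => match x with
      | .init => .inl ()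
      | .look q => .inr (.inl q)
      | .pick q e => .inr (.inr (.inl (q, e)))
      | .put q g m b => .inr (.inr (.inr (.inl (q, g, m, b))))
      | .scan q m b => .inr (.inr (.inr (.inr (q, m, b)))))
    (by rintro (_ | _ | _ | _ | _) (_ | _ | _ | _ | _) <;> simp)

/-- Among at most two symbols that replace a stack top, the lower one. -/
def lower : List Γ → Option Γ
  | [] => none
  | [x] => some x
  | _ :: y :: _ => some y

/-- Among at most two symbols that replace a stack top, the upper one, if there are two. -/
def upper : List Γ → Option Γ
  | x :: _ :: _ => some x
  | _ => none

theorem upper_append_lower (l : List Γ) : (upper l).toList ++ (lower l).toList = l.take 2 := by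
  rcases l with _ | ⟨x, _ | ⟨y, l⟩⟩ <;> rfl

/-- The symbol on a cell after writing `g`; the mark of the first cell is kept. -/
def overwrite (r : Option Γ × Bool) (g : Option Γ) : Option Γ × Bool :=
  g.elim r fun x => (some x, r.2)

/-- The move of a work head after it has written `g`. -/
def stepUp (g : Option Γ) : HeadMove := g.elim .stay fun _ => .right

def Scan.toInputMove : Scan → InputMove
  | .stay => .stay
  | .right => .right
  | .jump => .jump

namespace Frag

/-- The Turing machine of a flow chart.  A stack is kept on the cells to the left of the head of a
tape, and the first cell of each tape is marked by `true`. -/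
def machine [Finite B] [Finite K] [Finite Γ] (F : Frag A B K Γ) (addr : K) (one : Γ → Bool) :
    Machine A B where
  State := Phase B K Γ F.Q
  Sym := Option Γ × Bool
  Tp := K
  finite_state := by have := F.fin; infer_instance
  finite_sym := inferInstance
  finite_tp := inferInstance
  start := .init
  blank := (none, false)
  addr := addr
  isOne := fun x => x.1.elim false one
  δ := fun q x r => match q with
    | .init => some ⟨.look (some F.start), fun _ => (none, true), fun _ => .stay, .stay, none⟩
    | .look none => none
    | .look (some q) => some ⟨.pick q fun k => (r k).2, r,
        fun k => if (r k).2 then .stay else .left, .stay, none⟩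
    | .pick q e =>
        let a := F.δ q ⟨x, fun k => if e k then none else (r k).1⟩
        some ⟨.put a.1 (fun k => upper (a.2.put k)) a.2.scan a.2.emit,
          fun k => overwrite (r k) (lower (a.2.put k)),
          fun k => stepUp (lower (a.2.put k)), .stay, none⟩
    | .put q g m b => some ⟨.scan q m b, fun k => overwrite (r k) (g k), fun k => stepUp (g k),
        .stay, none⟩
    | .scan q m b => some ⟨.look q, r, fun _ => .stay, m.toInputMove, b⟩

end Frag

/-- The tape `t` holds the stack `l` on its first cells. -/
def Holds (t : ℕ → Option Γ × Bool) : List Γ → Prop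
  | [] => True
  | x :: l => (t l.length).1 = some x ∧ Holds t l

theorem Holds.update {t : ℕ → Option Γ × Bool} {l : List Γ} (h : Holds t l) {n : ℕ}
    (hn : l.length ≤ n) (x) : Holds (Function.update t n x) l := by
  induction l with
  | nil => trivial
  | cons y l ih =>
    simp only [List.length_cons] at hn
    refine ⟨?_, ih h.2 (by omega)⟩
    rw [Function.update_of_ne (by omega)]
    exact h.1

theorem Holds.tail {t : ℕ → Option Γ × Bool} {l : List Γ} (h : Holds t l) : Holds t l.tail := by
  cases l with
  | nil => trivial
  | cons y l => exact h.2

/-- The tape `t` with its head on the cell `h` represents the stack `l`: the head is on the cell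
just above the topmost symbol. -/
def TapeRep (h : ℕ) (t : ℕ → Option Γ × Bool) (l : List Γ) : Prop :=
  h = l.length ∧ Holds t l ∧ ∀ p, (t p).2 = decide (p = 0)

/-- Writing a symbol and moving to the right pushes the symbol. -/
theorem TapeRep.overwrite {h : ℕ} {t : ℕ → Option Γ × Bool} {l : List Γ} (ht : TapeRep h t l)
    (g : Option Γ) :
    TapeRep (Machine.moveHead h (stepUp g)) (Function.update t h (overwrite (t h) g))
      (g.toList ++ l) := by
  obtain ⟨rfl, h2, h3⟩ := ht
  cases g with
  | none => simpa [_root_.overwrite, stepUp, Machine.moveHead, TapeRep] using ⟨h2, h3⟩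
  | some x =>
    refine ⟨by simp [stepUp, Machine.moveHead], ⟨by simp [_root_.overwrite], h2.update le_rfl _⟩,
      fun p => ?_⟩
    by_cases hp : p = l.length
    · subst hp; rw [Function.update_self]; exact h3 _
    · rw [Function.update_of_ne hp]; exact h3 p

/-- Moving to the left, but not beyond the first cell, pops the topmost symbol. -/
theorem TapeRep.down {h : ℕ} {t : ℕ → Option Γ × Bool} {l : List Γ} (ht : TapeRep h t l) :
    TapeRep (Machine.moveHead h (if (t h).2 then .stay else .left)) t l.tail := by
  obtain ⟨rfl, h2, h3⟩ := ht
  refine ⟨?_, h2.tail, h3⟩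
  rw [h3]
  cases l <;> simp [Machine.moveHead]

/-- After a move to the left the head reads the topmost symbol. The stack was empty if the head was
on the first cell, where it cannot move. -/
theorem TapeRep.top {h : ℕ} {t : ℕ → Option Γ × Bool} {l : List Γ} (ht : TapeRep h t l) :
    (if (t h).2 then none else
      (t (Machine.moveHead h (if (t h).2 then .stay else .left))).1) = l.head? := by
  obtain ⟨rfl, h2, h3⟩ := ht
  rw [h3]
  cases l with
  | nil => simp
  | cons x l => simpa [Machine.moveHead] using h2.1

/-- The number that a machine reads off the tape of a stack. -/
theorem Holds.sum_eq (one : Γ → Bool) {t : ℕ → Option Γ × Bool} {l : List Γ} (h : Holds t l) :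
    ∑ p ∈ Finset.range l.length, ((t p).1.elim false one).toNat * 2 ^ p = addrVal one l := by
  induction l with
  | nil => rfl
  | cons x l ih =>
    rw [List.length_cons, Finset.sum_range_succ, ih h.2, h.1]
    rfl

theorem inputTape_append {A : Type} (l l' : List (List A)) :
    inputTape (l ++ l') = inputTape l ++ inputTape l' := by
  simp [inputTape]

theorem drop_blockStart {A : Type} (bs : List (List A)) (n : ℕ) :
    (inputTape bs).drop (blockStart bs n) = inputTape (bs.drop n) := by
  conv_lhs => rw [← List.take_append_drop n bs, inputTape_append, blockStart]
  rw [List.take_append_drop]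
  simp

namespace Frag

variable [Finite B] [Finite K] [Finite Γ] (F : Frag A B K Γ) (E : Env A K Γ)

/-- A configuration of the machine of a flow chart represents data of a program. -/
structure Rep (c : (F.machine E.addr E.one).Conf) (s : Store A B K Γ) : Prop where
  tape : ∀ k, TapeRep (c.head k) (c.tape k) (s.reg k)
  inp : (inputTape E.bs).drop c.inputPos = s.inp
  out : c.out = s.out

variable {F E}

theorem Rep.sym {c : (F.machine E.addr E.one).Conf} {s : Store A B K Γ} (h : F.Rep E c s) :
    (inputTape E.bs).getD c.inputPos none = s.inp.head?.join := by
  rw [← h.inp, List.head?_drop, List.getD_eq_getElem?_getD]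
  cases (inputTape E.bs)[c.inputPos]? <;> rfl

/-- One action of the flow chart is simulated by four steps of the machine. -/
theorem Rep.four_steps {c : (F.machine E.addr E.one).Conf} {s : Store A B K Γ} (h : F.Rep E c s)
    {q : F.Q} (hq : c.state = .look (some q)) (hs : s.Le E.H)
    (hs' : (s.apply E (F.δ q s.view).2).Le E.H) :
    let c' := ((F.machine E.addr E.one).step E.bs)^[4] c
    F.Rep E c' (s.apply E (F.δ q s.view).2) ∧ c'.state = .look (F.δ q s.view).1 ∧
      ∀ m ≤ 4, ∀ k, (((F.machine E.addr E.one).step E.bs)^[m] c).head k ≤ E.H := by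
  generalize ha : (F.δ q s.view).2 = a at hs' ⊢
  obtain ⟨st, ip, hd, tp, ou⟩ := c
  obtain ⟨ht, hi, ho⟩ := h
  have hsym := Rep.sym ⟨ht, hi, ho⟩
  change (inputTape E.bs).getD ip none = _ at hsym
  change st = _ at hq
  change ∀ k : K, TapeRep (hd k) (tp k) (s.reg k) at ht
  change List.drop ip _ = _ at hi
  change ou = _ at ho
  subst hq
  let hd1 : K → ℕ := fun k =>
    Machine.moveHead (hd k) (if (tp k (hd k)).2 then .stay else .left)
  have e1 : (F.machine E.addr E.one).step E.bs ⟨Phase.look (some q), ip, hd, tp, ou⟩ =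
      ⟨Phase.pick q fun k => (tp k (hd k)).2, ip, hd1, tp, ou⟩ := by
    trans ⟨Phase.pick q fun k => (tp k (hd k)).2, ip, hd1,
      fun k => Function.update (tp k) (hd k) (tp k (hd k)), ou ++ []⟩
    · rfl
    · simp only [Function.update_eq_self, List.append_nil]
  have t1 : ∀ k, TapeRep (hd1 k) (tp k) (s.reg k).tail := fun k => (ht k).down
  have hv : (⟨(inputTape E.bs).getD ip none,
      fun k => if (tp k (hd k)).2 then none else (tp k (hd1 k)).1⟩ : View A K Γ) = s.view := by
    rw [hsym, Store.view]
    congr 1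
    exact funext fun k => (ht k).top
  let hd2 : K → ℕ := fun k => Machine.moveHead (hd1 k) (stepUp (lower (a.put k)))
  let tp2 : K → ℕ → Option Γ × Bool := fun k =>
    Function.update (tp k) (hd1 k) (overwrite (tp k (hd1 k)) (lower (a.put k)))
  have e2 : (F.machine E.addr E.one).step E.bs
      ⟨Phase.pick q fun k => (tp k (hd k)).2, ip, hd1, tp, ou⟩ =
      ⟨Phase.put (F.δ q s.view).1 (fun k => upper (a.put k)) a.scan a.emit, ip, hd2, tp2, ou⟩ := by
    subst ha
    simp only [hd2, tp2, ← hv]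
    conv_rhs => rw [← List.append_nil ou]
    rfl
  have t2 : ∀ k, TapeRep (hd2 k) (tp2 k) ((lower (a.put k)).toList ++ (s.reg k).tail) :=
    fun k => (t1 k).overwrite _
  let hd3 : K → ℕ := fun k => Machine.moveHead (hd2 k) (stepUp (upper (a.put k)))
  let tp3 : K → ℕ → Option Γ × Bool := fun k => Function.update (tp2 k) (hd2 k)
    (overwrite (tp2 k (hd2 k)) (upper (a.put k)))
  have e3 : (F.machine E.addr E.one).step E.bs
      ⟨Phase.put (F.δ q s.view).1 (fun k => upper (a.put k)) a.scan a.emit, ip, hd2, tp2, ou⟩ =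
      ⟨Phase.scan (F.δ q s.view).1 a.scan a.emit, ip, hd3, tp3, ou⟩ := by
    conv_rhs => rw [← List.append_nil ou]
    rfl
  have t3 : ∀ k, TapeRep (hd3 k) (tp3 k) ((a.put k).take 2 ++ (s.reg k).tail) := by
    intro k
    rw [← upper_append_lower, List.append_assoc]
    exact (t2 k).overwrite _
  let ip4 := (F.machine E.addr E.one).moveInput E.bs
    ⟨Phase.scan (F.δ q s.view).1 a.scan a.emit, ip, hd3, tp3, ou⟩ a.scan.toInputMove
  have e4 : (F.machine E.addr E.one).step E.bs
      ⟨Phase.scan (F.δ q s.view).1 a.scan a.emit, ip, hd3, tp3, ou⟩ =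
      ⟨Phase.look (F.δ q s.view).1, ip4, hd3, tp3, ou ++ a.emit.toList⟩ := by
    have hu : tp3 = fun k => Function.update (tp3 k) (hd3 k) (tp3 k (hd3 k)) := by
      simp only [Function.update_eq_self]
    conv_rhs => rw [hu]
    rfl
  have hin : (inputTape E.bs).drop ip4 = (s.apply E a).inp := by
    simp only [Store.apply, ip4]
    rcases a.scan with _ | _ | _
    · exact hi
    · simp only [Scan.toInputMove, Machine.moveInput, ← hi]
      rw [List.tail_drop]
      rcases le_total (ip + 1) (inputTape E.bs).length with h | h
      · rw [min_eq_left h]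
      · rw [min_eq_right h, List.drop_length, List.drop_eq_nil_of_le h]
    · simp only [Scan.toInputMove, Machine.moveInput]
      rw [drop_blockStart]
      congr 2
      have := t3 E.addr
      rw [← this.2.1.sum_eq, ← this.1]
      rfl
  have h4 : ((F.machine E.addr E.one).step E.bs)^[4] ⟨Phase.look (some q), ip, hd, tp, ou⟩ =
      ⟨Phase.look (F.δ q s.view).1, ip4, hd3, tp3, ou ++ a.emit.toList⟩ := by
    simp only [Function.iterate_succ, Function.iterate_zero, Function.comp, id, e1, e2, e3, e4]
  refine ⟨?_, ?_, ?_⟩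
  · rw [h4]
    exact ⟨t3, hin, by rw [ho]; rfl⟩
  · rw [h4]
  · have len : ∀ k, ((lower (a.put k)).toList ++ (s.reg k).tail).length ≤ E.H := by
      intro k
      refine le_trans ?_ (hs' k)
      simp [Store.apply, ← upper_append_lower]
    intro m hm k
    interval_cases m
    · exact (ht k).1.trans_le (hs k)
    · simp only [Function.iterate_succ, Function.iterate_zero, Function.comp, id, e1]
      exact (t1 k).1.trans_le ((by simp : _ ≤ _).trans (hs k))
    · simp only [Function.iterate_succ, Function.iterate_zero, Function.comp, id, e1, e2]
      exact (t2 k).1.trans_le (len k)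
    · simp only [Function.iterate_succ, Function.iterate_zero, Function.comp, id, e1, e2, e3]
      exact (t3 k).1.trans_le (hs' k)
    · rw [h4]
      exact (t3 k).1.trans_le (hs' k)

/-- In `4 * n` steps the machine simulates `n` actions of the flow chart. -/
theorem Rep.reach {n : ℕ} {q q' : Option F.Q} {s s' : Store A B K Γ}
    (hr : F.Reach E n q s q' s') {c : (F.machine E.addr E.one).Conf} (h : F.Rep E c s)
    (hq : c.state = .look q) (hs : s.Le E.H) :
    let c' := ((F.machine E.addr E.one).step E.bs)^[4 * n] c
    F.Rep E c' s' ∧ c'.state = .look q' ∧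
      ∀ m ≤ 4 * n, ∀ k, (((F.machine E.addr E.one).step E.bs)^[m] c).head k ≤ E.H := by
  induction hr generalizing c with
  | refl q s =>
    refine ⟨h, hq, fun m hm k => ?_⟩
    obtain rfl : m = 0 := by omega
    exact (h.tape k).1.trans_le (hs k)
  | step n q s q' s' hH hr ih =>
    obtain ⟨h1, h2, h3⟩ := h.four_steps hq hs hH
    obtain ⟨h4, h5, h6⟩ := ih h1 h2 hH
    rw [mul_add, Function.iterate_add_apply]
    refine ⟨h4, h5, fun m hm k => ?_⟩
    rcases le_total m 4 with h | h
    · exact h3 m h k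
    · obtain ⟨m, rfl⟩ := Nat.exists_eq_add_of_le' h
      rw [Function.iterate_add_apply]
      exact h6 m (by omega) k

end Frag

/-- The data at the beginning of a computation. -/
def Store.start (bs : List (List A)) : Store A B K Γ := ⟨fun _ => [], inputTape bs, []⟩

/-- A run of a program is a computation of its Turing machine. -/
theorem Prog.Run.haltsWithin [Finite B] [Finite K] [Finite Γ] {p : Prog A B K Γ} {E : Env A K Γ}
    {s : Store A B K Γ} (h : p.Run E (Store.start E.bs) s) :
    (p.frag.machine E.addr E.one).HaltsWithin E.bs s.out (4 * p.cost E.N + 1)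
      (Nat.card K * (E.H + 1)) := by
  set M := p.frag.machine E.addr E.one with hM
  have h0 : (Store.start E.bs : Store A B K Γ).Le E.H := fun k => Nat.zero_le _
  obtain ⟨n, hn, hr⟩ := h.reach h0
  have hrep : p.frag.Rep E (M.step E.bs M.init) (Store.start E.bs) := by
    refine ⟨fun k => ⟨rfl, trivial, fun q => ?_⟩, List.drop_zero, rfl⟩
    change (Function.update (fun _ => (none, false)) 0 (none, true) q : Option Γ × Bool).2 = _
    by_cases hq : q = 0
    · subst hq; simp
    · simp [hq]
  obtain ⟨h1, h2, h3⟩ := hrep.reach hr rfl h0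
  have hc : M.conf E.bs (4 * n + 1) = (M.step E.bs)^[4 * n] (M.step E.bs M.init) := by
    rw [Machine.conf, Function.iterate_succ_apply]
  refine ⟨4 * n + 1, by omega, ?_, ?_, ?_⟩
  · rw [hc]
    simp only [Machine.action]
    rw [h2]
    rfl
  · rw [hc]; exact h1.out
  · have hsub : M.scanned E.bs (4 * n + 1) ⊆ Set.univ ×ˢ (Finset.range (E.H + 1) : Set ℕ) := by
      rintro ⟨k, j⟩ ⟨m, hm, hj⟩
      simp only [Set.mem_prod, Set.mem_univ, true_and, Finset.coe_range, Set.mem_Iio] at hj ⊢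
      rw [← hj, Nat.lt_succ_iff]
      cases m with
      | zero => exact Nat.zero_le _
      | succ m =>
        rw [Machine.conf, Function.iterate_succ_apply]
        exact h3 m (by omega) k
    refine (Set.encard_le_encard hsub).trans ?_
    have : Finite M.Tp := M.finite_tp
    rw [Set.encard_prod, Set.encard_univ, Set.encard_coe_eq_coe_finsetCard, Finset.card_range]
    rw [ENat.card_eq_coe_natCard, ← Nat.cast_mul]
    rfl

/-! ### A library of stack programs -/

/-- The bounds on the stacks and on the rest of the input.  They bound the number of rounds of loops
that run through a stack or through the input. -/
def Store.Ok (E : Env A K Γ) (s : Store A B K Γ) : Prop := s.Le E.H ∧ s.inp.length ≤ E.N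

theorem inputTape_drop_length_le {A : Type} (bs : List (List A)) (n : ℕ) :
    (inputTape (bs.drop n)).length ≤ (inputTape bs).length := by
  rw [← drop_blockStart, List.length_drop]
  omega

namespace Prog

theorem Run.ok {E : Env A K Γ} {p : Prog A B K Γ} {s s' : Store A B K Γ} (h : p.Run E s s')
    (hs : s.Ok E) : s'.Ok E := by
  refine ⟨h.le hs.1, ?_⟩
  induction p generalizing s s' with
  | act f =>
    obtain ⟨rfl, -⟩ := h
    simp only [Store.apply]
    rcases (f s.view).scan with _ | _ | _
    · exact hs.2
    · exact (by simp : _ ≤ _).trans hs.2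
    · exact (inputTape_drop_length_le _ _).trans E.tape_le
  | seq p q hp hq =>
    obtain ⟨m, h1, h2⟩ := h
    exact hq h2 ⟨h1.le hs.1, hp h1 hs⟩
  | ite c p q hp hq =>
    simp only [Run] at h
    split_ifs at h
    · exact hp h hs
    · exact hq h hs
  | loop c p hp =>
    obtain ⟨k, -, h⟩ := h
    induction k generalizing s with
    | zero => obtain ⟨-, rfl⟩ := h; exact hs.2
    | succ k ih => obtain ⟨-, m, h1, h2⟩ := h; exact ih ⟨h1.le hs.1, hp h1 hs⟩ h2

/-- `p` leads from `s` to `s'`, provided that `s` respects the bounds.  The lemmas `exec_p` below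
describe in this form what a program `p` does. -/
def Exec (E : Env A K Γ) (p : Prog A B K Γ) (s s' : Store A B K Γ) : Prop := s.Ok E → p.Run E s s'

variable {E : Env A K Γ} {p q : Prog A B K Γ} {s m s' : Store A B K Γ} {c : View A K Γ → Bool}

infixr:60 " ;; " => Prog.seq

theorem Exec.seq (h : p.Exec E s m) (h' : q.Exec E m s') : (p ;; q).Exec E s s' :=
  fun hs => ⟨m, h hs, h' ((h hs).ok hs)⟩

theorem Exec.congr {s'' : Store A B K Γ} (h : p.Exec E s s'') (e : s'' = s') : p.Exec E s s' :=
  e ▸ h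

theorem Exec.ite_pos (hc : c s.view = true) (h : p.Exec E s s') : (ite c p q).Exec E s s' :=
  fun hs => by simpa only [Run, hc, if_true] using h hs

theorem Exec.ite_neg (hc : c s.view = false) (h : q.Exec E s s') : (ite c p q).Exec E s s' :=
  fun hs => by simpa only [Run, hc, Bool.false_eq_true, if_false] using h hs

theorem Exec.of_ok (h : s.Ok E → p.Exec E s s') : p.Exec E s s' := fun hs => h hs hs

/-- A loop that processes a list.  Its invariant `f d r` is given in terms of the part `d` that has
been processed and the part `r` that is left. -/
theorem Exec.loop_list {α : Type} (l : List α) (f : List α → List α → Store A B K Γ)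
    (hN : (f [] l).Ok E → l.length ≤ E.N)
    (h1 : ∀ d x r, d ++ x :: r = l → c (f d (x :: r)).view = true ∧
      p.Exec E (f d (x :: r)) (f (d ++ [x]) r))
    (h2 : c (f l []).view = false) (hs0 : s = f [] l) (hs1 : f l [] = s') :
    (loop c p).Exec E s s' := by
  subst hs0 hs1
  intro hs
  refine ⟨l.length, hN hs, ?_⟩
  have key : ∀ r d, d ++ r = l → (f d r).Ok E →
      Iter (fun s => c s.view = true) (Run E p) r.length (f d r) (f l []) := by
    intro r
    induction r with
    | nil =>
      intro d hd _
      rw [List.append_nil] at hd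
      subst hd
      exact ⟨by simp [h2], rfl⟩
    | cons x r ih =>
      intro d hd hok
      obtain ⟨hc, hb⟩ := h1 d x r hd
      exact ⟨hc, _, hb hok, ih (d ++ [x]) (by simpa using hd) ((hb hok).ok hok)⟩
  exact key l [] rfl hs

/-- A loop with `n` rounds. -/
theorem Exec.loop_nat (n : ℕ) (f : ℕ → Store A B K Γ) (hN : (f 0).Ok E → n ≤ E.N)
    (h1 : ∀ i < n, c (f i).view = true ∧ p.Exec E (f i) (f (i + 1)))
    (h2 : c (f n).view = false) (hs0 : s = f 0) (hs1 : f n = s') : (loop c p).Exec E s s' := by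
  subst hs0 hs1
  intro hs
  refine ⟨n, hN hs, ?_⟩
  have key : ∀ m i, i + m = n → (f i).Ok E →
      Iter (fun s => c s.view = true) (Run E p) m (f i) (f n) := by
    intro m
    induction m with
    | zero =>
      intro i hi _
      obtain rfl : i = n := by omega
      exact ⟨by simp [h2], rfl⟩
    | succ m ih =>
      intro i hi hok
      obtain ⟨hc, hb⟩ := h1 i (by omega)
      exact ⟨hc, _, hb hok, ih (i + 1) (by omega) ((hb hok).ok hok)⟩
  exact key n 0 (by omega) hs

end Prog

/-! #### Updating the data -/

namespace Store

variable (s : Store A B K Γ)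

/-- Replaces the rest of the input. -/
def setInp (i : List (Option A)) : Store A B K Γ := { s with inp := i }

/-- Appends to the output. -/
def write (o : List B) : Store A B K Γ := { s with out := s.out ++ o }

@[simp] theorem setInp_reg (i : List (Option A)) : (s.setInp i).reg = s.reg := rfl

@[simp] theorem setInp_inp (i : List (Option A)) : (s.setInp i).inp = i := rfl

@[simp] theorem setInp_out (i : List (Option A)) : (s.setInp i).out = s.out := rfl

@[simp] theorem write_reg (o : List B) : (s.write o).reg = s.reg := rfl

@[simp] theorem write_inp (o : List B) : (s.write o).inp = s.inp := rfl

@[simp] theorem write_out (o : List B) : (s.write o).out = s.out ++ o := rfl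

@[simp] theorem view_sym : s.view.sym = s.inp.head?.join := rfl

@[simp] theorem view_top (k : K) : s.view.top k = (s.reg k).head? := rfl

variable [DecidableEq K] (a b : K) (l l' : List Γ)

/-- Replaces the contents of one stack. -/
def set : Store A B K Γ := { s with reg := Function.update s.reg a l }

@[simp] theorem set_reg_self : (s.set a l).reg a = l := Function.update_self ..

@[simp] theorem set_reg_ne {a b : K} (h : b ≠ a) : (s.set a l).reg b = s.reg b :=
  Function.update_of_ne h ..

theorem set_reg (k : K) : (s.set a l).reg k = if k = a then l else s.reg k := by
  simp [set, Function.update_apply]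

@[simp] theorem set_inp : (s.set a l).inp = s.inp := rfl

@[simp] theorem set_out : (s.set a l).out = s.out := rfl

omit [DecidableEq K] in
theorem ext_of_reg {s s' : Store A B K Γ} (hr : ∀ k, s.reg k = s'.reg k) (hi : s.inp = s'.inp)
    (ho : s.out = s'.out) : s = s' := Store.ext (funext hr) hi ho

theorem Le.set {s : Store A B K Γ} {H : ℕ} (hs : s.Le H) {a : K} {l : List Γ} (h : l.length ≤ H) :
    (s.set a l).Le H := by
  intro k
  rw [set_reg]
  split_ifs
  · exact h
  · exact hs k

end Store

namespace Prog

/-! #### Basic actions -/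

/-- Pops the stacks in `pops`, then pushes `push v k` onto each stack `k`. -/
def xfer (pops : K → Bool) (push : View A K Γ → K → Option Γ) (m : Scan := .stay)
    (b : View A K Γ → Option B := fun _ => none) : Prog A B K Γ :=
  act fun v => ⟨fun k => (push v k).toList ++ if pops k then [] else (v.top k).toList, m, b v⟩

theorem exec_xfer {E : Env A K Γ} {s s' : Store A B K Γ} {pops : K → Bool}
    {push : View A K Γ → K → Option Γ} {m : Scan} {b : View A K Γ → Option B}
    (hr : ∀ k, s'.reg k =
      (push s.view k).toList ++ if pops k then (s.reg k).tail else s.reg k)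
    (hi : s'.inp = match m with
      | .stay => s.inp
      | .right => s.inp.tail
      | .jump => inputTape (E.bs.drop (addrVal E.one (s'.reg E.addr))))
    (ho : s'.out = s.out ++ (b s.view).toList) (hle : s.Le E.H → s'.Le E.H) :
    (xfer pops push m b).Exec E s s' := by
  have hreg : s'.reg = fun k => ((push s.view k).toList ++
      if pops k then [] else (s.view.top k).toList).take 2 ++ (s.reg k).tail := by
    funext k
    rw [hr]
    simp only [Store.view_top]
    generalize push s.view k = g
    cases g <;> cases pops k <;> cases s.reg k <;> simp
  refine fun hs => ⟨?_, hle hs.1⟩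
  ext1
  · exact hreg
  · rw [hi, hreg]
    rfl
  · exact ho

variable {E : Env A K Γ} {s : Store A B K Γ}

/-- Moves the input head to the right. -/
def next : Prog A B K Γ := xfer (fun _ => false) (fun _ _ => none) .right

theorem exec_next : (next : Prog A B K Γ).Exec E s (s.setInp s.inp.tail) :=
  exec_xfer (fun k => by simp) rfl (by simp [Store.setInp]) fun hs => hs

/-- Moves the input head to the block whose number is on the address stack. -/
def jump : Prog A B K Γ := xfer (fun _ => false) (fun _ _ => none) .jump

theorem exec_jump : (jump : Prog A B K Γ).Exec E s
    (s.setInp (inputTape (E.bs.drop (addrVal E.one (s.reg E.addr))))) :=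
  exec_xfer (fun k => by simp) rfl (by simp [Store.setInp]) fun hs => hs

/-- Writes a symbol to the output. -/
def emit (b : B) : Prog A B K Γ := xfer (fun _ => false) (fun _ _ => none) .stay fun _ => some b

theorem exec_emit (b : B) : (emit b : Prog A B K Γ).Exec E s (s.write [b]) :=
  exec_xfer (fun k => by simp) rfl rfl fun hs => hs

variable [DecidableEq K]

def push (a : K) (x : Γ) : Prog A B K Γ :=
  xfer (fun _ => false) fun _ k => if k = a then some x else none

theorem exec_push (a : K) (x : Γ) (h : (s.reg a).length + 1 ≤ E.H) :
    (push a x).Exec E s (s.set a (x :: s.reg a)) := by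
  refine exec_xfer (fun k => ?_) rfl (by simp) fun hs => hs.set (by simpa using h)
  rw [Store.set_reg]
  split_ifs with hk <;> simp_all

/-- Moves the top of `a` to `b`. -/
def shift (a b : K) : Prog A B K Γ :=
  xfer (fun k => k = a) fun v k => if k = b then v.top a else none

theorem exec_shift {a b : K} (hab : a ≠ b) {x : Γ} {l : List Γ} (ha : s.reg a = x :: l)
    (h : (s.reg b).length + 1 ≤ E.H) :
    (shift a b).Exec E s ((s.set a l).set b (x :: s.reg b)) := by
  refine exec_xfer (fun k => ?_) rfl (by simp) fun hs => (hs.set ?_).set (by simpa using h)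
  · simp only [Store.set_reg]
    split_ifs <;> simp_all
  · have := hs a
    rw [ha, List.length_cons] at this
    omega

/-- Moves the top of `a` to both `b` and `c`. -/
def shift₂ (a b c : K) : Prog A B K Γ :=
  xfer (fun k => k = a) fun v k => if k = b ∨ k = c then v.top a else none

theorem exec_shift₂ {a b c : K} (hab : a ≠ b) (hac : a ≠ c) (hbc : b ≠ c) {x : Γ} {l : List Γ}
    (ha : s.reg a = x :: l) (h : (s.reg b).length + 1 ≤ E.H) (h' : (s.reg c).length + 1 ≤ E.H) :
    (shift₂ a b c).Exec E s (((s.set a l).set b (x :: s.reg b)).set c (x :: s.reg c)) := by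
  refine exec_xfer (fun k => ?_) rfl (by simp) fun hs =>
    ((hs.set ?_).set (by simpa using h)).set (by simpa using h')
  · simp only [Store.set_reg]
    split_ifs <;> simp_all
  · have := hs a
    rw [ha, List.length_cons] at this
    omega

/-- Pops both `a` and `b`, and pushes the top of `a` onto `t`. -/
def shiftCommon (a b t : K) : Prog A B K Γ :=
  xfer (fun k => k = a ∨ k = b) fun v k => if k = t then v.top a else none

theorem exec_shiftCommon {a b t : K} (hab : a ≠ b) (hat : a ≠ t) (hbt : b ≠ t) {x y : Γ}
    {l l' : List Γ} (ha : s.reg a = x :: l) (hb : s.reg b = y :: l')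
    (h : (s.reg t).length + 1 ≤ E.H) :
    (shiftCommon a b t).Exec E s (((s.set a l).set b l').set t (x :: s.reg t)) := by
  refine exec_xfer (fun k => ?_) rfl (by simp) fun hs =>
    ((hs.set ?_).set ?_).set (by simpa using h)
  · simp only [Store.set_reg, decide_eq_true_eq]
    split_ifs with h1 h2 h3 h4 <;> first | subst h1 | skip
    · exact absurd h2 (by simp [hat.symm, hbt.symm])
    all_goals simp_all
  · have := hs a
    rw [ha, List.length_cons] at this
    omega
  · have := hs b
    rw [hb, List.length_cons] at this
    omega

/-! #### Moving and copying stacks -/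

omit [DecidableEq K] in
theorem length_le_N {l : List Γ} (hs : s.Ok E) (a : K) (ha : s.reg a = l) : l.length ≤ E.N :=
  ha ▸ (hs.1 a).trans E.height_le

/-- Pours `a` onto `b`. -/
def move (a b : K) : Prog A B K Γ := loop (fun v => (v.top a).isSome) (shift a b)

theorem exec_move {a b : K} (hab : a ≠ b) (h : (s.reg a).length + (s.reg b).length ≤ E.H) :
    (move a b).Exec E s ((s.set a []).set b ((s.reg a).reverse ++ s.reg b)) := by
  refine Exec.loop_list (s.reg a) (fun d r => (s.set a r).set b (d.reverse ++ s.reg b))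
    (fun hs => length_le_N hs a (by simp [hab])) (fun d x r hd => ⟨by simp [hab], ?_⟩)
    (by simp [hab]) (by ext1 <;> simp [Store.set]) rfl
  have := congrArg List.length hd
  simp only [List.length_append, List.length_cons] at this
  refine (exec_shift hab (x := x) (l := r) (by simp [hab]) (by simp; omega)).congr ?_
  ext1 <;> try rfl
  funext k
  simp only [Store.set_reg]
  split_ifs <;> simp_all

/-- Pours `a` onto both `b` and `c`. -/
def move₂ (a b c : K) : Prog A B K Γ := loop (fun v => (v.top a).isSome) (shift₂ a b c)

theorem exec_move₂ {a b c : K} (hab : a ≠ b) (hac : a ≠ c) (hbc : b ≠ c)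
    (h : (s.reg a).length + (s.reg b).length ≤ E.H)
    (h' : (s.reg a).length + (s.reg c).length ≤ E.H) :
    (move₂ a b c).Exec E s (((s.set a []).set b ((s.reg a).reverse ++ s.reg b)).set c
      ((s.reg a).reverse ++ s.reg c)) := by
  refine Exec.loop_list (s.reg a)
    (fun d r => ((s.set a r).set b (d.reverse ++ s.reg b)).set c (d.reverse ++ s.reg c))
    (fun hs => length_le_N hs a (by simp [hab, hac])) (fun d x r hd => ⟨by simp [hab, hac], ?_⟩)
    (by simp [hab, hac]) (by ext1 <;> simp [Store.set]) rfl
  have := congrArg List.length hd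
  simp only [List.length_append, List.length_cons] at this
  refine (exec_shift₂ hab hac hbc (x := x) (l := r) (by simp [hab, hac]) (by simp [hbc]; omega)
    (by simp; omega)).congr ?_
  ext1 <;> try rfl
  funext k
  simp only [Store.set_reg]
  split_ifs <;> simp_all

/-- Pushes the reversal of `a` onto `b`, using the empty stack `t`. -/
def copyRev (a b t : K) : Prog A B K Γ := move₂ a b t ;; move t a

theorem exec_copyRev {a b t : K} (hab : a ≠ b) (hat : a ≠ t) (hbt : b ≠ t) (ht : s.reg t = [])
    (h : (s.reg a).length + (s.reg b).length ≤ E.H) :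
    (copyRev a b t).Exec E s (s.set b ((s.reg a).reverse ++ s.reg b)) := by
  have hA : (s.reg a).length ≤ E.H := by omega
  refine ((exec_move₂ hab hat hbt h (by simpa [ht] using hA)).seq
    (exec_move hat.symm (by simpa [ht, hat, hab] using hA))).congr ?_
  ext1 <;> try rfl
  funext k
  simp only [Store.set_reg]
  split_ifs <;> simp_all

/-- Pushes `a` onto `b`, using the empty stack `t`. -/
def copy (a b t : K) : Prog A B K Γ := move a t ;; move₂ t a b

theorem exec_copy {a b t : K} (hab : a ≠ b) (hat : a ≠ t) (hbt : b ≠ t) (ht : s.reg t = [])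
    (h : (s.reg a).length + (s.reg b).length ≤ E.H) :
    (copy a b t).Exec E s (s.set b (s.reg a ++ s.reg b)) := by
  have hA : (s.reg a).length ≤ E.H := by omega
  refine ((exec_move hat (by simpa [ht] using hA)).seq
    (exec_move₂ hat.symm hbt.symm hab (by simpa [ht, hat] using hA)
      (by simpa [ht, hat, hab.symm, hbt] using h))).congr ?_
  ext1 <;> try rfl
  funext k
  simp only [Store.set_reg]
  split_ifs <;> simp_all

open Classical in
/-- Empties the stacks in `P`. -/
noncomputable def clear (P : K → Bool) : Prog A B K Γ :=
  loop (fun v => decide (∃ k, P k ∧ (v.top k).isSome)) (xfer P fun _ _ => none)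

omit [DecidableEq K] in
theorem exec_clear (P : K → Bool) :
    (clear P).Exec E s { s with reg := fun k => if P k then [] else s.reg k } := by
  classical
  refine Exec.of_ok fun hs => ?_
  have hex : ∃ n, ∀ k, P k = true → (s.reg k).length ≤ n := ⟨E.H, fun k _ => hs.1 k⟩
  refine Exec.loop_nat (Nat.find hex)
    (fun i => { s with reg := fun k => if P k then (s.reg k).drop i else s.reg k })
    (fun _ => (Nat.find_min' hex fun k _ => hs.1 k).trans E.height_le)
    (fun i hi => ⟨?_, exec_xfer (fun k => ?_) rfl (by simp) fun h k => ?_⟩) ?_ (by simp) ?_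
  · have := Nat.find_min hex hi
    push Not at this
    obtain ⟨k, hk, hlt⟩ := this
    simp only [decide_eq_true_eq]
    refine ⟨k, hk, ?_⟩
    simp [hk, hlt]
  · dsimp only
    split_ifs <;> simp
  · have := h k
    by_cases hk : P k = true
    · simp only [hk, if_true, List.length_drop] at this ⊢
      omega
    · simpa only [hk, Bool.false_eq_true, if_false] using this
  · simp only [decide_eq_false_iff_not, not_exists, not_and]
    intro k hk
    have := Nat.find_spec hex k hk
    simp only [Store.view_top, hk, if_true, List.drop_eq_nil_of_le this]
    simp
  · congr 1
    funext k
    split_ifs with hk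
    · exact List.drop_eq_nil_of_le (Nat.find_spec hex k hk)
    · rfl

theorem exec_clear_one (a : K) : (clear fun k => decide (k = a)).Exec E s (s.set a []) := by
  refine (exec_clear _).congr ?_
  ext1 <;> try rfl
  funext k
  simp [Store.set_reg]

/-! #### Comparing stacks -/

section Compare

variable [DecidableEq Γ]

/-- Performs `p` or `q` according to whether the stacks `a` and `b` are equal; their common part is
moved to the empty stack `t` and back. -/
def ifEq (a b t : K) (p q : Prog A B K Γ) : Prog A B K Γ :=
  loop (fun v => (v.top a).isSome && decide (v.top a = v.top b)) (shiftCommon a b t) ;;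
    ite (fun v => (v.top a).isNone && (v.top b).isNone) (move₂ t a b ;; p) (move₂ t a b ;; q)

omit [DecidableEq Γ] in
theorem exists_common_prefix (l l' : List Γ) : ∃ w r r', l = w ++ r ∧ l' = w ++ r' ∧
    (r.head? = none ∨ r.head? ≠ r'.head?) := by
  induction l generalizing l' with
  | nil => exact ⟨[], [], l', rfl, rfl, .inl rfl⟩
  | cons x l ih =>
    cases l' with
    | nil => exact ⟨[], x :: l, [], rfl, rfl, .inr (by simp)⟩
    | cons y l' =>
      by_cases hxy : x = y
      · subst hxy
        obtain ⟨w, r, r', rfl, rfl, h⟩ := ih l'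
        exact ⟨x :: w, r, r', rfl, rfl, h⟩
      · exact ⟨[], x :: l, y :: l', rfl, rfl, .inr (by simpa using hxy)⟩

theorem exec_ifEq {a b t : K} (hab : a ≠ b) (hat : a ≠ t) (hbt : b ≠ t) (ht : s.reg t = [])
    {p q : Prog A B K Γ} {s' : Store A B K Γ}
    (hp : s.reg a = s.reg b → p.Exec E s s') (hq : s.reg a ≠ s.reg b → q.Exec E s s') :
    (ifEq a b t p q).Exec E s s' := by
  refine Exec.of_ok fun hs => ?_
  obtain ⟨w, r, r', ha, hb, hr⟩ := exists_common_prefix (s.reg a) (s.reg b)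
  have hla := hs.1 a
  have hlb := hs.1 b
  rw [ha, List.length_append] at hla
  rw [hb, List.length_append] at hlb
  have h1 : (loop (fun v : View A K Γ => (v.top a).isSome && decide (v.top a = v.top b))
      (shiftCommon a b t)).Exec (B := B) E s (((s.set a r).set b r').set t w.reverse) := by
    refine Exec.loop_list w
      (fun d w' => ((s.set a (w' ++ r)).set b (w' ++ r')).set t d.reverse)
      (fun _ => by have := E.height_le; omega) (fun d x w' hd => ⟨by simp [hab, hat, hbt], ?_⟩)
      ?_ ?_ (by simp)
    · have := congrArg List.length hd
      simp only [List.length_append, List.length_cons] at this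
      refine (exec_shiftCommon hab hat hbt (x := x) (y := x) (l := w' ++ r) (l' := w' ++ r')
        (by simp [hab, hat]) (by simp [hbt]) (by simp; omega)).congr ?_
      ext1 <;> try rfl
      funext k
      simp only [Store.set_reg]
      split_ifs <;> simp_all
    · rcases hr with hr | hr
      · simp [hab, hat, hr]
      · simp [hab, hat, hbt, hr]
    · ext1 <;> try rfl
      funext k
      simp only [Store.set_reg]
      split_ifs <;> simp_all
  have h2 : (move₂ t a b).Exec (B := B) E (((s.set a r).set b r').set t w.reverse) s := by
    refine (exec_move₂ hat.symm hbt.symm hab (by simpa [hab, hat] using hla)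
      (by simpa [hbt] using hlb)).congr ?_
    ext1 <;> try rfl
    funext k
    simp only [Store.set_reg]
    split_ifs <;> simp_all
  refine h1.seq ?_
  by_cases h : s.reg a = s.reg b
  · obtain rfl : r = r' := by rw [ha, hb] at h; exact List.append_cancel_left h
    obtain rfl : r = [] := by simpa using hr
    exact Exec.ite_pos (by simp [hab, hat, hbt]) (h2.seq (hp h))
  · refine Exec.ite_neg ?_ (h2.seq (hq h))
    have : ¬ (r = [] ∧ r' = []) := by
      rintro ⟨rfl, rfl⟩
      exact h (ha.trans hb.symm)
    simp only [Store.view_top, Store.set_reg, hab, hat, hbt, if_true, if_false]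
    cases r <;> cases r' <;> simp_all

end Compare

/-! #### Input and output -/

/-- Pushes the input symbols onto `a`, translated by `f`, as long as `f` is defined. -/
def readWhile (f : A → Option Γ) (a : K) : Prog A B K Γ :=
  loop (fun v => (v.sym.bind f).isSome)
    (xfer (fun _ => false) (fun v k => if k = a then v.sym.bind f else none) .right)

theorem exec_readWhile {α : Type} {f : A → Option Γ} {a : K} (l : List α) (i : α → A) (g : α → Γ)
    (hf : ∀ y, f (i y) = some (g y)) {rest : List (Option A)}
    (hi : s.inp = (l.map i).map some ++ rest) (hr : rest.head?.join.bind f = none)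
    (h : l.length + (s.reg a).length ≤ E.H) :
    (readWhile f a).Exec E s ((s.set a ((l.map g).reverse ++ s.reg a)).setInp rest) := by
  refine Exec.loop_list l
    (fun d r => (s.set a ((d.map g).reverse ++ s.reg a)).setInp ((r.map i).map some ++ rest))
    (fun _ => by have := E.height_le; omega)
    (fun d x r hd => ⟨by simp [hf], exec_xfer (fun k => ?_) (by simp) (by simp [Store.setInp]) ?_⟩)
    (by simp [hr]) ?_ rfl
  · simp only [Store.set_reg, Store.setInp_reg]
    split_ifs <;> simp_all
  · have := congrArg List.length hd
    simp only [List.length_append, List.length_cons] at this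
    intro hs k
    have hk := hs k
    simp only [Store.set_reg, Store.setInp_reg] at hk ⊢
    split_ifs at hk ⊢
    · simp; omega
    · exact hk
  · ext1
    · simp [Store.set]
    · simp [hi]
    · rfl

/-- Skips the input symbols with `f`. -/
def skipWhile (f : A → Bool) : Prog A B K Γ :=
  loop (fun v => v.sym.elim false f) next

omit [DecidableEq K] in
theorem exec_skipWhile {f : A → Bool} (l : List A) (hf : ∀ x ∈ l, f x = true)
    {rest : List (Option A)} (hi : s.inp = l.map some ++ rest)
    (hr : rest.head?.join.elim false f = false) :
    (skipWhile f : Prog A B K Γ).Exec E s (s.setInp rest) := by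
  refine Exec.loop_list l (fun d r => s.setInp (r.map some ++ rest)) (fun hs => ?_)
    (fun d x r hd => ⟨?_, exec_next.congr (by simp [Store.setInp])⟩)
    (by simpa using hr) ?_ rfl
  · have := hs.2
    simp only [Store.setInp_inp, List.length_append, List.length_map] at this
    omega
  · simpa using hf x (by simp [← hd])
  · ext1
    · rfl
    · simp [hi]
    · rfl

/-- Pops all symbols from `a` and writes them to the output, translated by `g`. -/
def emitAll (a : K) (g : Γ → Option B) : Prog A B K Γ :=
  loop (fun v => (v.top a).isSome)
    (xfer (fun k => decide (k = a)) (fun _ _ => none) .stay fun v => (v.top a).bind g)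

theorem exec_emitAll {a : K} {g : Γ → Option B} :
    (emitAll a g : Prog A B K Γ).Exec E s ((s.set a []).write ((s.reg a).filterMap g)) := by
  refine Exec.loop_list (s.reg a) (fun d r => (s.set a r).write (d.filterMap g))
    (fun hs => length_le_N hs a (by simp))
    (fun d x r hd => ⟨by simp, exec_xfer (fun k => ?_) rfl ?_ fun hs k => ?_⟩)
    (by simp) (by ext1 <;> simp [Store.set]) rfl
  · simp only [Store.set_reg, Store.write_reg]
    split_ifs <;> simp_all
  · cases h : g x <;> simp [h]
  · have hk := hs k
    simp only [Store.set_reg, Store.write_reg] at hk ⊢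
    split_ifs at hk ⊢
    · simp at hk; omega
    · exact hk

end Prog

/-! ### Programs on a part of the stacks -/

/-- Replaces the contents of the stacks in the range of `ι`. -/
noncomputable def Store.place {K' : Type} (s : Store A B K Γ) (ι : K' → K) (r : K' → List Γ) :
    Store A B K Γ :=
  { s with reg := Function.extend ι r s.reg }

namespace Prog

variable {K' : Type}

/-- A program without input and output, performed on the stacks in the range of `ι`. -/
noncomputable def lift (ι : K' → K) : Prog Empty Empty K' Γ → Prog A B K Γ
  | act f => act fun v =>
      ⟨Function.extend ι (f ⟨none, v.top ∘ ι⟩).put fun k => (v.top k).toList, .stay, none⟩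
  | seq p q => seq (lift ι p) (lift ι q)
  | ite c p q => ite (fun v => c ⟨none, v.top ∘ ι⟩) (lift ι p) (lift ι q)
  | loop c p => loop (fun v => c ⟨none, v.top ∘ ι⟩) (lift ι p)

theorem view_place {ι : K' → K} (hι : ι.Injective) (b : Store A B K Γ)
    (s : Store Empty Empty K' Γ) :
    (⟨none, (b.place ι s.reg).view.top ∘ ι⟩ : View Empty K' Γ) = s.view := by
  have h : s.inp.head?.join = none := by
    cases s.inp.head?.join with
    | none => rfl
    | some x => exact x.elim
  simp only [Store.view, h, View.mk.injEq, true_and]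
  funext k
  simp [Store.place, hι.extend_apply]

/-- A program acts on the stacks in the range of `ι` as it does on its own, and leaves the other
stacks as they are. -/
theorem Run.lift {ι : K' → K} (hι : ι.Injective) {E' : Env Empty K' Γ} {E : Env A K Γ}
    (hN : E'.N = E.N) (hH : E'.H = E.H) {p : Prog Empty Empty K' Γ}
    {s s' : Store Empty Empty K' Γ} (h : p.Run E' s s') (b : Store A B K Γ) (hb : b.Le E.H) :
    (p.lift ι).Run E (b.place ι s.reg) (b.place ι s'.reg) := by
  induction p generalizing s s' with
  | act f =>
    obtain ⟨rfl, hle⟩ := h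
    refine ⟨?_, fun k => ?_⟩
    · change b.place ι _ = Store.apply E _ ⟨Function.extend ι (f ⟨none, _⟩).put _, .stay, none⟩
      rw [view_place hι]
      ext1
      · funext k
        by_cases hk : ∃ k', ι k' = k
        · obtain ⟨k', rfl⟩ := hk
          simp [Store.place, Store.apply, hι.extend_apply]
        · simp only [Store.place, Store.apply, Function.extend_apply' _ _ _ hk, Store.view]
          cases b.reg k <;> simp
      · rfl
      · simp [Store.place, Store.apply]
    · by_cases hk : ∃ k', ι k' = k
      · obtain ⟨k', rfl⟩ := hk
        simpa only [Store.place, hι.extend_apply, hH] using hle k'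
      · simpa only [Store.place, Function.extend_apply' _ _ _ hk] using hb k
  | seq p q hp hq =>
    obtain ⟨m, h1, h2⟩ := h
    exact ⟨_, hp h1, hq h2⟩
  | ite c p q hp hq =>
    simp only [Run, Prog.lift, view_place hι] at h ⊢
    split_ifs at h ⊢
    · exact hp h
    · exact hq h
  | loop c p hp =>
    obtain ⟨k, hk, h⟩ := h
    refine ⟨k, hN ▸ hk, ?_⟩
    clear hk
    induction k generalizing s with
    | zero =>
      obtain ⟨hc, rfl⟩ := h
      exact ⟨by simpa only [view_place hι] using hc, rfl⟩
    | succ k ih =>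
      obtain ⟨hc, m, h1, h2⟩ := h
      exact ⟨by simpa only [view_place hι] using hc, _, hp h1, ih h2⟩

end Prog

/-! ### Simulation of a machine by a program -/

/-- The stacks for the simulation of a machine with work tapes `J`.  Each tape is represented by two
stacks, for the parts to the left and to the right of the head; the head is on the top of the right
stack, and blank cells may be missing there.  The control state is on the stack `ctl`, the reversed
output on `out`; `cnt` and `flag` serve to read the address. -/
inductive SimReg (J : Type)
  | inL
  | inR
  | out
  | ctl
  | cnt
  | flag
  | tL (i : J)
  | tR (i : J)

noncomputable instance {J : Type} : DecidableEq (SimReg J) := Classical.decEq _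

instance {J : Type} [Finite J] : Finite (SimReg J) :=
  Finite.of_injective (β := Fin 6 ⊕ J ⊕ J)
    (fun x => match x with
      | .inL => .inl 0
      | .inR => .inl 1
      | .out => .inl 2
      | .ctl => .inl 3
      | .cnt => .inl 4
      | .flag => .inl 5
      | .tL i => .inr (.inl i)
      | .tR i => .inr (.inr i))
    (by rintro (_ | _ | _ | _ | _ | _ | _ | _) (_ | _ | _ | _ | _ | _ | _ | _) <;> simp)

/-- How the states and symbols of a machine are represented by symbols on stacks, together with two
marks `one` and `big` for addresses. -/
structure SimCode (M : Machine A B) (Γ : Type) where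
  st : M.State → Γ
  unst : Γ → M.State
  unst_st : ∀ q, unst (st q) = q
  sy : M.Sym → Γ
  unsy : Γ → M.Sym
  unsy_sy : ∀ x, unsy (sy x) = x
  inp : Option A → Γ
  uninp : Γ → Option A
  uninp_inp : ∀ x, uninp (inp x) = x
  em : B → Γ
  one : Γ
  big : Γ
  one_ne_big : one ≠ big

def InputMove.isJump : InputMove → Bool
  | .jump => true
  | _ => false

namespace SimCode

open Prog SimReg

variable {M : Machine A B} (D : SimCode M Γ)

abbrev SimView (M : Machine A B) (Γ : Type) := View Empty (SimReg M.Tp) Γ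

abbrev SimStore (M : Machine A B) (Γ : Type) := Store Empty Empty (SimReg M.Tp) Γ

abbrev SimProg (M : Machine A B) (Γ : Type) := Prog Empty Empty (SimReg M.Tp) Γ

/-- The action of the simulated machine; an empty control stack stands for the initial state. -/
def action (v : SimView M Γ) : Option (MachineAction M.State M.Sym M.Tp B) :=
  M.δ ((v.top ctl).elim M.start D.unst) ((v.top inR).bind D.uninp)
    fun i => (v.top (tR i)).elim M.blank D.unsy

/-- How the stack tops are replaced in one step of the simulated machine, except that a jump leaves
the input head in its place. -/
def stepPut (a : MachineAction M.State M.Sym M.Tp B) (v : SimView M Γ) : SimReg M.Tp → List Γ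
  | inL => match a.inputMove with
    | .left => []
    | .right => (v.top inR).toList ++ (v.top inL).toList
    | _ => (v.top inL).toList
  | inR => match a.inputMove with
    | .left => (v.top inL).toList ++ (v.top inR).toList
    | .right => []
    | _ => (v.top inR).toList
  | out => (a.emit.map D.em).toList ++ (v.top out).toList
  | ctl => [D.st a.next]
  | tL i => match a.move i with
    | .left => []
    | .stay => (v.top (tL i)).toList
    | .right => D.sy (a.write i) :: (v.top (tL i)).toList
  | tR i => match a.move i with
    | .left => (v.top (tL i)).toList ++ [D.sy (a.write i)]
    | .stay => [D.sy (a.write i)]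
    | .right => []
  | cnt => (v.top cnt).toList
  | flag => (v.top flag).toList

/-- One step of the machine as a basic action, except that a jump leaves the input head in its
place. -/
def stepAct (v : SimView M Γ) : Act Empty (SimReg M.Tp) Γ :=
  match D.action v with
  | none => Act.keep v
  | some a => ⟨D.stepPut a v, .stay, none⟩

/-- Among two blocks only the addresses `0`, `1` and larger ones have to be distinguished: whether
the symbol `x` is the digit `1` on the first cell or on another one is recorded in the flag. -/
noncomputable def readDigit (v : SimView M Γ) : Act Empty (SimReg M.Tp) Γ :=
  ⟨fun k => if k = cnt then [] else if k = tL M.addr then (v.top cnt).toList ++ (v.top k).toList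
    else if k = flag ∧ (v.top cnt).elim false (fun x => M.isOne (D.unsy x)) then
      [if (v.top (tL M.addr)).isNone then D.one else D.big]
    else (v.top k).toList, .stay, none⟩

/-- Computes the flag from the address. -/
noncomputable def readAddress : SimProg M Γ :=
  move (tL M.addr) cnt ;; loop (fun v => (v.top cnt).isSome) (act D.readDigit)

open Classical in
/-- Moves the simulated input head from the first cell to the block given by the flag. -/
noncomputable def advance : SimProg M Γ :=
  ite (fun v => decide (v.top flag = some D.one))
    (loop (fun v => ((v.top inR).bind D.uninp).isSome) (shift inR inL) ;; shift inR inL)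
    (ite (fun v => decide (v.top flag = some D.big)) (move inR inL) (act Act.keep))

/-- Moves the simulated input head to the block given by the flag. -/
noncomputable def seek : SimProg M Γ :=
  move inL inR ;; D.advance ;; clear fun k => decide (k = flag)

/-- One step of the simulated machine. -/
noncomputable def round : SimProg M Γ :=
  ite (fun v => (D.action v).any fun a => a.inputMove.isJump)
    (D.readAddress ;; act D.stepAct ;; D.seek) (act D.stepAct)

/-- Simulates the machine until it halts, and cleans up. -/
noncomputable def simulate : SimProg M Γ :=
  loop (fun v => (D.action v).isSome) D.round ;; clear fun k => decide (k ≠ out)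

/-- The stacks represent a configuration that is reached in at most `n` steps. -/
structure Rep (bs : List (List A)) (n : ℕ) (c : M.Conf) (s : SimStore M Γ) : Prop where
  inp : (s.reg inL).reverse ++ s.reg inR = (inputTape bs).map D.inp
  inputPos : (s.reg inL).length = c.inputPos
  out : s.reg out = (c.out.map D.em).reverse
  out_le : (s.reg SimReg.out).length ≤ n
  state : (s.reg ctl).head?.elim M.start D.unst = c.state
  ctl_le : (s.reg ctl).length ≤ 1
  cnt : s.reg cnt = []
  head : ∀ i, (s.reg (tL i)).length = c.head i
  tape : ∀ i p, c.tape i p = (((s.reg (tL i)).reverse ++ s.reg (tR i))[p]?).elim M.blank D.unsy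
  tape_le : ∀ i, (s.reg (tL i)).length + (s.reg (tR i)).length ≤ n

variable {D} {bs : List (List A)} {n : ℕ} {c : M.Conf} {s : SimStore M Γ}

/-- The program determines the action of the machine from the stack tops. -/
theorem Rep.action (h : D.Rep bs n c s) : D.action s.view = M.action bs c := by
  have hi : (inputTape bs).getD c.inputPos none = ((s.reg inR).head?).bind D.uninp := by
    have h1 : ((inputTape bs).map D.inp)[c.inputPos]? = (s.reg inR).head? := by
      rw [← h.inp, ← h.inputPos, List.getElem?_append_right (by simp)]
      simp [List.head?_eq_getElem?]
    rw [← h1, List.getElem?_map, List.getD_eq_getElem?_getD]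
    cases (inputTape bs)[c.inputPos]? <;> simp [D.uninp_inp]
  have ht : ∀ i, ((s.reg (tR i)).head?).elim M.blank D.unsy = c.tape i (c.head i) := by
    intro i
    rw [h.tape, ← h.head, List.getElem?_append_right (by simp)]
    simp [List.head?_eq_getElem?]
  simp only [SimCode.action, Machine.action, Store.view_top, hi, h.state, ht]

theorem Rep.apply_reg (h : D.Rep bs n c s) {a : MachineAction M.State M.Sym M.Tp B}
    (ha : M.action bs c = some a) (E : Env Empty (SimReg M.Tp) Γ) (k : SimReg M.Tp) :
    (s.apply E (D.stepAct s.view)).reg k = (D.stepPut a s.view k).take 2 ++ (s.reg k).tail := by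
  simp only [Store.apply, stepAct, h.action, ha]

/-- One step of the machine, where a jump leaves the input head in its place. -/
theorem Rep.stepAct (h : D.Rep bs n c s) {a : MachineAction M.State M.Sym M.Tp B}
    (ha : M.action bs c = some a) (E : Env Empty (SimReg M.Tp) Γ) :
    D.Rep bs (n + 1) { M.perform bs c a with
        inputPos := if a.inputMove.isJump then c.inputPos else M.moveInput bs c a.inputMove }
      (s.apply E (D.stepAct s.view)) ∧ (s.apply E (D.stepAct s.view)).reg flag = s.reg flag := by
  have hreg := h.apply_reg ha E
  generalize s.apply E (D.stepAct s.view) = s' at hreg ⊢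
  have hlen := congrArg List.length h.inp
  simp only [List.length_append, List.length_reverse, List.length_map] at hlen
  have htape : ∀ i,
      (s'.reg (tL i)).length = Machine.moveHead (c.head i) (a.move i) ∧
      (s'.reg (tL i)).reverse ++ s'.reg (tR i) =
        (s.reg (tL i)).reverse ++ D.sy (a.write i) :: (s.reg (tR i)).tail := by
    intro i
    rw [← h.head]
    simp only [hreg, stepPut]
    cases a.move i <;> simp only [Machine.moveHead, Store.view_top] <;> cases s.reg (tL i) <;>
      simp
  refine ⟨⟨?_, ?_, ?_, ?_, ?_, ?_, ?_, ?_, ?_, ?_⟩, ?_⟩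
  · rw [← h.inp]
    simp only [hreg, stepPut]
    cases a.inputMove <;> simp only [Store.view_top] <;> cases s.reg inL <;> cases s.reg inR <;>
      simp
  · simp only [hreg, stepPut]
    rw [← h.inputPos]
    revert hlen
    cases a.inputMove <;>
      simp only [Store.view_top, Machine.moveInput, ← h.inputPos, InputMove.isJump] <;>
      cases s.reg inL <;> cases s.reg inR <;> simp <;> omega
  · simp only [hreg, stepPut, Machine.perform]
    rw [List.map_append, List.reverse_append, ← h.out]
    cases a.emit <;> simp only [Store.view_top] <;> cases s.reg SimReg.out <;> simp
  · have h1 := h.out_le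
    simp only [hreg, stepPut]
    revert h1
    cases a.emit <;> simp only [Store.view_top] <;> cases s.reg SimReg.out <;> simp <;> omega
  · simp only [hreg, stepPut, Machine.perform]
    simp [D.unst_st]
  · simp only [hreg, stepPut]
    have := h.ctl_le
    simp
    omega
  · simp only [hreg, stepPut, Store.view_top]
    simp [h.cnt]
  · exact fun i => (htape i).1
  · intro i p
    rw [(htape i).2]
    simp only [Machine.perform]
    rw [← h.head]
    rcases lt_trichotomy p (s.reg (tL i)).length with hp | hp | hp
    · rw [Function.update_of_ne hp.ne, h.tape, List.getElem?_append_left (by simpa using hp),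
        List.getElem?_append_left (by simpa using hp)]
    · subst hp
      simp [D.unsy_sy]
    · rw [Function.update_of_ne hp.ne', h.tape, List.getElem?_append_right (by simpa using hp.le),
        List.getElem?_append_right (by simpa using hp.le), List.length_reverse]
      obtain ⟨j, hj⟩ := Nat.exists_eq_add_of_lt hp
      rw [hj, add_assoc, Nat.add_sub_cancel_left, List.getElem?_cons_succ, List.getElem?_tail]
  · intro i
    have h1 := congrArg List.length (htape i).2
    have h2 := h.tape_le i
    simp only [List.length_append, List.length_reverse, List.length_cons, List.length_tail] at h1
    omega
  · simp only [hreg, stepPut, Store.view_top]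
    cases s.reg flag <;> simp

theorem sum_eq_addrVal {Γ : Type} (one : Γ → Bool) (f : ℕ → Bool) (l : List Γ)
    (h : ∀ p, p < l.length → f p = (l.reverse[p]?).elim false one) :
    ∑ p ∈ Finset.range l.length, (f p).toNat * 2 ^ p = addrVal one l := by
  induction l with
  | nil => rfl
  | cons x l ih =>
    rw [List.length_cons, Finset.sum_range_succ, addrVal, ih, h l.length (by simp)]
    · simp
    · intro p hp
      rw [h p (by simp; omega), List.reverse_cons, List.getElem?_append_left (by simpa using hp)]

theorem Rep.address (h : D.Rep bs n c s) :
    M.address c = addrVal (fun x => M.isOne (D.unsy x)) (s.reg (tL M.addr)) := by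
  rw [← sum_eq_addrVal _ fun p => M.isOne (c.tape M.addr p), Machine.address, h.head]
  intro p hp
  rw [h.tape, List.getElem?_append_left (by simpa using hp),
    List.getElem?_eq_getElem (by simpa using hp)]
  rfl

variable (D) in
/-- The flag for a block number. -/
def flagOf : ℕ → List Γ
  | 0 => []
  | 1 => [D.one]
  | _ => [D.big]

theorem flagOf_of_two_le {m : ℕ} (h : 2 ≤ m) : D.flagOf m = [D.big] := by
  obtain ⟨m, rfl⟩ := Nat.exists_eq_add_of_le' h
  rfl

variable {E : Env Empty (SimReg M.Tp) Γ}

theorem exec_readDigit {x : Γ} {r l : List Γ} {m : ℕ} (h1 : s.reg cnt = x :: r)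
    (h2 : s.reg (tL M.addr) = l) (h3 : s.reg flag = D.flagOf m)
    (hm : m = addrVal (fun x => M.isOne (D.unsy x)) l) (hl : l.length + 1 ≤ E.H) :
    (act D.readDigit).Exec E s (((s.set cnt r).set (tL M.addr) (x :: l)).set flag
      (D.flagOf (addrVal (fun x => M.isOne (D.unsy x)) (x :: l)))) := by
  have hfl : D.flagOf (addrVal (fun x => M.isOne (D.unsy x)) (x :: l)) =
      if M.isOne (D.unsy x) then [if l = [] then D.one else D.big] else D.flagOf m := by
    simp only [addrVal, ← hm]
    cases hx : M.isOne (D.unsy x)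
    · simp
    · cases l with
      | nil =>
        rw [hm]
        simp [addrVal, flagOf]
      | cons y l =>
        have : 1 ≤ 2 ^ l.length := Nat.one_le_two_pow
        rw [flagOf_of_two_le]
        · simp
        · simp only [Bool.toNat_true, List.length_cons, pow_succ]
          omega
  have hfo : ∀ m, (D.flagOf m).length ≤ 1 := by
    intro m
    rcases m with _ | _ | m <;> simp [flagOf]
  have hreg : ((s.set cnt r).set (tL M.addr) (x :: l)).set flag
      (D.flagOf (addrVal (fun x => M.isOne (D.unsy x)) (x :: l))) =
      s.apply E (D.readDigit s.view) := by
    ext1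
    · funext k
      simp only [Store.apply, readDigit, Store.view_top, Store.set_reg, hfl]
      by_cases hk : k = flag
      · subst hk
        have := hfo m
        rw [← h3] at this
        simp only [h1, h2, h3, reduceCtorEq, if_false, if_true, true_and]
        rw [h3] at this
        cases hx : M.isOne (D.unsy x)
        · simp only [List.head?_cons, Option.elim, hx]
          cases hf : D.flagOf m <;> simp
        · simp only [List.head?_cons, Option.elim, hx]
          have ht : (D.flagOf m).tail = [] := List.length_eq_zero_iff.1 (by simp; omega)
          cases l <;> simp [ht]
      · by_cases hk1 : k = cnt
        · subst hk1; simp [h1]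
        · by_cases hk2 : k = tL M.addr
          · subst hk2
            cases l <;> simp [h1, h2]
          · simp only [hk, hk1, hk2, if_false, false_and]
            cases s.reg k <;> simp
    · rfl
    · simp [Store.apply, readDigit]
  refine fun hs => ⟨hreg, ?_⟩
  refine ((hs.1.set ?_).set (by simpa using hl)).set ((hfo _).trans (by omega))
  have := hs.1 cnt
  rw [h1, List.length_cons] at this
  omega

theorem exec_readAddress (h1 : s.reg cnt = []) (h2 : s.reg flag = [])
    (hl : (s.reg (tL M.addr)).length ≤ E.H) :
    D.readAddress.Exec E s (s.set flag
      (D.flagOf (addrVal (fun x => M.isOne (D.unsy x)) (s.reg (tL M.addr))))) := by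
  refine (exec_move (by simp) (by simpa [h1] using hl)).seq ?_
  refine Exec.loop_list (s.reg (tL M.addr)).reverse
    (fun d r => ((s.set cnt r).set (tL M.addr) d.reverse).set flag
      (D.flagOf (addrVal (fun x => M.isOne (D.unsy x)) d.reverse)))
    (fun hs => by simpa using hl.trans E.height_le) (fun d x r hd => ⟨by simp, ?_⟩) (by simp) ?_ ?_
  · have := congrArg List.length hd
    simp only [List.length_append, List.length_cons, List.length_reverse] at this
    refine (exec_readDigit (x := x) (r := r) (l := d.reverse) (by simp) (by simp) (by simp) rfl
      (by simp; omega)).congr ?_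
    ext1 <;> try rfl
    funext k
    simp only [Store.set_reg]
    split_ifs <;> simp_all
  · ext1 <;> try rfl
    funext k
    simp only [Store.set_reg]
    split_ifs <;> simp_all [addrVal, flagOf]
  · ext1 <;> try rfl
    funext k
    simp only [Store.set_reg]
    split_ifs <;> simp_all

/-- With the flag for the address `m` the program moves the input head to the block number `m`. -/
theorem exec_seek {x y : List A} {m : ℕ} (h : D.Rep [x, y] n c s) (hf : s.reg flag = D.flagOf m)
    (hl : (inputTape [x, y]).length ≤ E.H) :
    ∃ s', D.seek.Exec E s s' ∧ D.Rep [x, y] n { c with inputPos := blockStart [x, y] m } s' ∧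
      s'.reg flag = [] := by
  have hlen := congrArg List.length h.inp
  simp only [List.length_append, List.length_reverse, List.length_map] at hlen
  have e1 : (move inL inR).Exec E s
      ((s.set inL []).set inR ((inputTape [x, y]).map D.inp)) := by
    refine (exec_move (by simp) (by omega)).congr ?_
    rw [h.inp]
  have key : ∃ l r, l ++ r = (inputTape [x, y]).map D.inp ∧ l.length = blockStart [x, y] m ∧
      D.seek.Exec E s (((s.set inL l.reverse).set inR r).set flag []) := by
    suffices hs : ∃ l r, l ++ r = (inputTape [x, y]).map D.inp ∧ l.length = blockStart [x, y] m ∧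
        D.advance.Exec E ((s.set inL []).set inR ((inputTape [x, y]).map D.inp))
          ((s.set inL l.reverse).set inR r) by
      obtain ⟨l, r, h1, h2, h3⟩ := hs
      exact ⟨l, r, h1, h2, e1.seq (h3.seq (exec_clear_one _))⟩
    have ht : (inputTape [x, y]).map D.inp =
        x.map (fun z => D.inp (some z)) ++ D.inp none :: (inputTape [y]).map D.inp := by
      simp [inputTape, Function.comp_def]
    rcases m with _ | _ | m
    · refine ⟨[], _, rfl, rfl, .ite_neg (by simp [hf, flagOf]) (.ite_neg (by simp [hf, flagOf]) ?_)⟩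
      exact fun hs => ⟨(Store.apply_keep ..).symm, hs.1⟩
    · refine ⟨x.map (fun z => D.inp (some z)) ++ [D.inp none], (inputTape [y]).map D.inp,
        by rw [ht]; simp, by simp [blockStart, inputTape], .ite_pos (by simp [hf, flagOf]) ?_⟩
      rw [ht] at e1 ⊢
      have hl' := hl
      rw [← List.length_map D.inp, ht] at hl'
      simp only [List.length_append, List.length_cons, List.length_map] at hl'
      refine Exec.seq (m := (s.set inL (x.map fun z => D.inp (some z)).reverse).set inR
        (D.inp none :: (inputTape [y]).map D.inp)) ?_ ?_
      · refine Exec.loop_list x (fun d r => (s.set inL (d.map fun z => D.inp (some z)).reverse).set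
            inR (r.map (fun z => D.inp (some z)) ++ D.inp none :: (inputTape [y]).map D.inp))
          (fun hs => by have := E.height_le; omega)
          (fun d z r hd => ⟨by simp [D.uninp_inp], ?_⟩) (by simp [D.uninp_inp]) rfl rfl
        have := congrArg List.length hd
        simp only [List.length_append, List.length_cons] at this
        refine (exec_shift (by simp) (x := D.inp (some z)) (l := _) (by simp; rfl)
          (by simp; omega)).congr ?_
        ext1 <;> try rfl
        funext k
        simp only [Store.set_reg]
        split_ifs <;> simp_all
      · refine (exec_shift (by simp) (x := D.inp none) (l := (inputTape [y]).map D.inp) (by simp)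
          (by simp; omega)).congr ?_
        ext1 <;> try rfl
        funext k
        simp only [Store.set_reg]
        split_ifs <;> simp_all
    · refine ⟨(inputTape [x, y]).map D.inp, [], by simp, by simp [blockStart],
        .ite_neg (by simp [hf, flagOf, D.one_ne_big.symm]) (.ite_pos (by simp [hf, flagOf]) ?_)⟩
      refine (exec_move (by simp) (by simpa using hl)).congr ?_
      ext1 <;> try rfl
      funext k
      simp only [Store.set_reg]
      split_ifs <;> simp_all
  obtain ⟨l, r, h1, h2, h3⟩ := key
  refine ⟨_, h3, ⟨?_, ?_, ?_, ?_, ?_, ?_, ?_, ?_, ?_, ?_⟩, by simp⟩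
  · simpa using h1
  · simpa using h2
  · simpa using h.out
  · simpa using h.out_le
  · simpa using h.state
  · simpa using h.ctl_le
  · simpa using h.cnt
  · simpa using h.head
  · simpa using h.tape
  · simpa using h.tape_le

theorem Rep.set_flag (h : D.Rep bs n c s) (l : List Γ) : D.Rep bs n c (s.set flag l) := by
  refine ⟨?_, ?_, ?_, ?_, ?_, ?_, ?_, ?_, ?_, ?_⟩
  · simpa using h.inp
  · simpa using h.inputPos
  · simpa using h.out
  · simpa using h.out_le
  · simpa using h.state
  · simpa using h.ctl_le
  · simpa using h.cnt
  · simpa using h.head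
  · simpa using h.tape
  · simpa using h.tape_le

theorem Rep.le (h : D.Rep bs n c s) (hf : s.reg flag = []) (hn : n ≤ E.H) (h1 : 1 ≤ E.H)
    (hl : (inputTape bs).length ≤ E.H) : s.Le E.H := by
  have hlen := congrArg List.length h.inp
  simp only [List.length_append, List.length_reverse, List.length_map] at hlen
  rintro (_ | _ | _ | _ | _ | _ | i | i)
  · omega
  · omega
  · exact h.out_le.trans hn
  · exact h.ctl_le.trans h1
  · simp [h.cnt]
  · simp [hf]
  · have := h.tape_le i; omega
  · have := h.tape_le i; omega

theorem Rep.apply_le (h : D.Rep bs (n + 1) c s) (hf : (s.reg flag).length ≤ 1) (hn : n + 1 ≤ E.H)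
    (hl : (inputTape bs).length ≤ E.H) : s.Le E.H := by
  have h0 := (h.set_flag []).le (E := E) (by simp) hn (by omega) hl
  intro k
  by_cases hk : k = flag
  · subst hk; omega
  · simpa [hk] using h0 k

/-- A round of the simulation is one step of the machine. -/
theorem exec_round {x y : List A} (h : D.Rep [x, y] n c s) (hf : s.reg flag = [])
    (hn : n + 1 ≤ E.H) (hl : (inputTape [x, y]).length ≤ E.H)
    (ha : (M.action [x, y] c).isSome = true) :
    ∃ s', D.round.Exec E s s' ∧ D.Rep [x, y] (n + 1) (M.step [x, y] c) s' ∧ s'.reg flag = [] := by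
  obtain ⟨a, ha⟩ := Option.isSome_iff_exists.1 ha
  have hstep : M.step [x, y] c = M.perform [x, y] c a := by simp [Machine.step, ha]
  rw [hstep]
  cases hj : a.inputMove.isJump
  · obtain ⟨h1, h2⟩ := h.stepAct ha E
    rw [hf] at h2
    refine ⟨_, .ite_neg ?_ fun hs => ⟨rfl, h1.apply_le (by simp [h2]) hn hl⟩, ?_, h2⟩
    · simp [h.action, ha, hj]
    · simpa [hj, Machine.perform] using h1
  · have hlen : (s.reg (tL M.addr)).length ≤ E.H := by have := h.tape_le M.addr; omega
    have hm : a.inputMove = .jump := by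
      revert hj
      cases a.inputMove <;> simp [InputMove.isJump]
    have hs1 := h.set_flag (D.flagOf (M.address c))
    obtain ⟨h1, h2⟩ := hs1.stepAct ha E
    rw [Store.set_reg_self] at h2
    rw [if_pos hj] at h1
    obtain ⟨s', h3, h4, h5⟩ := exec_seek (E := E) h1 h2 hl
    refine ⟨s', .ite_pos ?_ ((exec_readAddress h.cnt hf hlen).seq (Exec.seq (m := _) ?_ h3)), ?_,
      h5⟩
    · simp [h.action, ha, hj]
    · rw [← h.address]
      refine fun hs => ⟨rfl, h1.apply_le ?_ hn hl⟩
      rw [h2]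
      rcases M.address c with _ | _ | m <;> simp [flagOf]
    · simpa [Machine.perform, hm, Machine.moveInput] using h4

/-- If the machine halts on two blocks with output `o`, then so does the simulation; it leaves `o`
on the stack `out` and all other stacks empty. -/
theorem exec_simulate {x y : List A} {o : List B} {t sp : ℕ} (hM : M.HaltsWithin [x, y] o t sp)
    (ht : t + 1 ≤ E.H) (hl : (inputTape [x, y]).length ≤ E.H) (s : SimStore M Γ)
    (hs : ∀ k, s.reg k = if k = inR then (inputTape [x, y]).map D.inp else []) :
    ∃ s', D.simulate.Exec E s s' ∧
      ∀ k, s'.reg k = if k = SimReg.out then (o.map D.em).reverse else [] := by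
  obtain ⟨n, hn, hact, hout, -⟩ := hM
  have key : ∀ m j c (s : SimStore M Γ), j + m ≤ t → D.Rep [x, y] j c s → s.reg flag = [] →
      M.action [x, y] ((M.step [x, y])^[m] c) = none →
      ∃ k ≤ m, ∃ j' s', (s.Ok E → Iter (fun s => (D.action s.view).isSome = true)
        (Run E D.round) k s s') ∧ D.Rep [x, y] j' ((M.step [x, y])^[m] c) s' := by
    intro m
    induction m with
    | zero =>
      intro j c s _ h _ ha
      refine ⟨0, le_rfl, j, s, fun _ => ⟨?_, rfl⟩, h⟩
      simp only [h.action]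
      simp [show M.action [x, y] c = none from ha]
    | succ m ih =>
      intro j c s hj h hf ha
      cases hc : (M.action [x, y] c).isSome
      · have hfix : ∀ i, (M.step [x, y])^[i] c = c := by
          intro i
          refine Function.iterate_fixed ?_ i
          simp only [Option.isSome_eq_false_iff, Option.isNone_iff_eq_none] at hc
          simp [Machine.step, hc]
        refine ⟨0, Nat.zero_le _, j, s, fun _ => ⟨?_, rfl⟩, by rwa [hfix]⟩
        simp [h.action, hc]
      · obtain ⟨s1, e1, h1, hf1⟩ := exec_round (E := E) h hf (by omega) hl hc
        obtain ⟨k, hk, j', s', e2, h2⟩ := ih (j + 1) _ s1 (by omega) h1 hf1 ha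
        exact ⟨k + 1, by omega, j', s', fun hs => ⟨by simpa only [h.action] using hc, s1, e1 hs,
          e2 ((e1 hs).ok hs)⟩, h2⟩
  have hinit : D.Rep [x, y] 0 M.init s := by
    refine ⟨?_, ?_, ?_, ?_, ?_, ?_, ?_, ?_, ?_, ?_⟩ <;> simp [hs, Machine.init]
  obtain ⟨k, hk, j', s', e, h⟩ := key n 0 M.init s (by omega) hinit (by simp [hs]) hact
  refine ⟨_, Exec.seq (m := s') (fun h0 => ⟨k, ?_, e h0⟩) (exec_clear _), fun k => ?_⟩
  · have := E.height_le
    omega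
  · by_cases hk : k = SimReg.out
    · subst hk
      have := h.out
      simp only [ne_eq, not_true_eq_false, decide_false, Bool.false_eq_true, if_false, if_true]
      rw [this, ← hout]
      rfl
    · simp [hk]

end SimCode

end Machines

/-! ### Stacks and symbols of the traceback program -/

/-- The stacks of the traceback program, and further ones for its subroutines. -/
inductive Reg (K₂ : Type)
  | addr
  | tab
  | tab'
  | e₁
  | e₂
  | u
  | w
  | best
  | pred
  | x
  | last
  | goal
  | f₀
  | f₁
  | f₂
  | keep
  | tmp
  | arg
  | res
  | sub (k : K₂)

noncomputable instance {K₂ : Type} : DecidableEq (Reg K₂) := Classical.decEq _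

instance {K₂ : Type} [Finite K₂] : Finite (Reg K₂) :=
  Finite.of_injective (β := Fin 19 ⊕ K₂)
    (fun k => match k with
      | .addr => .inl 0
      | .tab => .inl 1
      | .tab' => .inl 2
      | .e₁ => .inl 3
      | .e₂ => .inl 4
      | .u => .inl 5
      | .w => .inl 6
      | .best => .inl 7
      | .pred => .inl 8
      | .x => .inl 9
      | .last => .inl 10
      | .goal => .inl 11
      | .f₀ => .inl 12
      | .f₁ => .inl 13
      | .f₂ => .inl 14
      | .keep => .inl 15
      | .tmp => .inl 16
      | .arg => .inl 17
      | .res => .inl 18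
      | .sub k => .inr k)
    (by
      intro a b h
      cases a <;> cases b <;> first | rfl | (simp at h; done) | (simp at h; subst h; rfl))

/-- The symbols on the stacks of the traceback program: binary digits, symbols of codes of values,
a separator, and further ones for its subroutines. -/
inductive StackSym (V Γ₂ : Type)
  | bit (b : Bool)
  | val (g : V)
  | sep
  | sub (g : Γ₂)

instance {V Γ₂ : Type} [Finite V] [Finite Γ₂] : Finite (StackSym V Γ₂) :=
  Finite.of_injective (β := Bool ⊕ V ⊕ Unit ⊕ Γ₂)
    (fun k => match k with
      | .bit b => .inl b
      | .val g => .inr (.inl g)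
      | .sep => .inr (.inr (.inl ()))
      | .sub g => .inr (.inr (.inr g)))
    (by rintro (_ | _ | _ | _) (_ | _ | _ | _) <;> simp)

noncomputable instance {V Γ₂ : Type} : DecidableEq (StackSym V Γ₂) := Classical.decEq _

namespace StackSym

variable {V Γ₂ : Type}

def isSep : StackSym V Γ₂ → Bool
  | sep => true
  | _ => false

def isOne : StackSym V Γ₂ → Bool
  | bit b => b
  | _ => false

/-- A binary digit on a stack, as an output symbol. -/
def toOut : StackSym V Γ₂ → Option (Option Bool)
  | bit b => some (some b)
  | _ => none

def ofBit : InSym V → Option (StackSym V Γ₂)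
  | .bit b => some (bit b)
  | _ => none

def ofVal : InSym V → Option (StackSym V Γ₂)
  | .val g => some (val g)
  | _ => none

/-- A number on a stack: in binary, the most significant digit on top. -/
def num (n : ℕ) : List (StackSym V Γ₂) := (n.bits.map bit).reverse

/-- A word on a stack, the last symbol on top. -/
def word (l : List V) : List (StackSym V Γ₂) := (l.map val).reverse

theorem length_num (n : ℕ) : (num n : List (StackSym V Γ₂)).length = n.bits.length := by
  simp [num]

theorem length_word (l : List V) : (word l : List (StackSym V Γ₂)).length = l.length := by
  simp [word]

theorem addrVal_append_singleton {Γ : Type} (one : Γ → Bool) (l : List Γ) (x : Γ) :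
    addrVal one (l ++ [x]) = 2 * addrVal one l + (one x).toNat := by
  induction l with
  | nil => simp [addrVal]
  | cons y l ih =>
    simp only [List.cons_append, addrVal, ih, List.length_append, List.length_singleton, pow_succ]
    ring

/-- The representation of numbers on stacks is the one that jumps use. -/
theorem addrVal_num (n : ℕ) : addrVal isOne (num n : List (StackSym V Γ₂)) = n := by
  induction n using Nat.binaryRec' with
  | zero => rfl
  | bit b n h ih =>
    rw [num, Nat.bits_append_bit n b h, List.map_cons, List.reverse_cons,
      addrVal_append_singleton]
    change 2 * addrVal isOne (num n : List (StackSym V Γ₂)) + b.toNat = _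
    rw [ih, Nat.bit_val]

theorem num_injective : Function.Injective (num : ℕ → List (StackSym V Γ₂)) := fun a b h => by
  rw [← addrVal_num (V := V) (Γ₂ := Γ₂) a, h, addrVal_num]

theorem num_eq_nil {n : ℕ} : (num n : List (StackSym V Γ₂)) = [] ↔ n = 0 := by
  constructor
  · intro h
    exact num_injective (V := V) (Γ₂ := Γ₂) (h.trans (by simp [num]))
  · rintro rfl
    simp [num]

theorem isSep_of_mem_num {n : ℕ} {x : StackSym V Γ₂} (h : x ∈ (num n : List (StackSym V Γ₂))) :
    x.isSep = false := by
  obtain ⟨b, -, rfl⟩ : ∃ b, b ∈ n.bits ∧ bit b = x := by simpa [num] using h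
  rfl

theorem isSep_of_mem_word {l : List V} {x : StackSym V Γ₂}
    (h : x ∈ (word l : List (StackSym V Γ₂))) : x.isSep = false := by
  obtain ⟨b, -, rfl⟩ : ∃ b, b ∈ l ∧ val b = x := by simpa [word] using h
  rfl

/-- Binary increment: the digits `1` in front of the first digit `0` are inverted. -/
theorem exists_bits_succ (n : ℕ) : ∃ j r, n.bits = List.replicate j true ++ r ∧
    r.head? ≠ some true ∧ (n + 1).bits = List.replicate j false ++ true :: r.tail := by
  induction n using Nat.binaryRec' with
  | zero => exact ⟨0, [], by simp⟩
  | bit b n h ih =>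
    cases b
    · refine ⟨0, false :: n.bits, ?_, by simp, ?_⟩
      · rw [Nat.bits_append_bit n _ h]; rfl
      · have : Nat.bit false n + 1 = Nat.bit true n := by simp [Nat.bit_val]
        rw [this, Nat.bits_append_bit n _ (by simp)]
        rfl
    · obtain ⟨j, r, h1, h2, h3⟩ := ih
      refine ⟨j + 1, r, ?_, h2, ?_⟩
      · rw [Nat.bits_append_bit n _ h, h1]; rfl
      · have : Nat.bit true n + 1 = Nat.bit false (n + 1) := by simp [Nat.bit_val]; ring
        rw [this, Nat.bits_append_bit _ _ (by simp), h3]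
        rfl

end StackSym

/-! ### Numbers and tables -/

namespace Traceback

open Prog StackSym Reg

variable {A B V K₂ Γ₂ : Type}

abbrev TProg (A B V K₂ Γ₂ : Type) := Prog A B (Reg K₂) (StackSym V Γ₂)

abbrev TStore (A B V K₂ Γ₂ : Type) := Store A B (Reg K₂) (StackSym V Γ₂)

abbrev TEnv (A V K₂ Γ₂ : Type) := Env A (Reg K₂) (StackSym V Γ₂)

def skip : TProg A B V K₂ Γ₂ := act Act.keep

/-- Adds one to the number on the stack `addr`. -/
noncomputable def increment : TProg A B V K₂ Γ₂ :=
  move addr tmp ;;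
    loop (fun v => decide (v.top tmp = some (bit true)))
      (xfer (fun k => decide (k = tmp)) fun _ k => if k = addr then some (bit false) else none) ;;
    xfer (fun k => decide (k = tmp)) (fun _ k => if k = addr then some (bit true) else none) ;;
    move tmp addr

/-- Moves the symbols above the next separator from `a` to `b`, and removes the separator. -/
noncomputable def moveEntry (a b : Reg K₂) : TProg A B V K₂ Γ₂ :=
  loop (fun v => (v.top a).any fun x => !x.isSep) (shift a b) ;;
    xfer (fun k => decide (k = a)) fun _ _ => none

/-- Takes an entry from the table `a`. -/
noncomputable def popEntry (a : Reg K₂) : TProg A B V K₂ Γ₂ := moveEntry a e₁ ;; moveEntry a e₂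

/-- Puts an entry back to the table `a`. -/
noncomputable def pushEntry (a : Reg K₂) : TProg A B V K₂ Γ₂ :=
  push a .sep ;; move e₂ a ;; push a .sep ;; move e₁ a

/-- Moves the table `tab'` back to `tab`, in reverse order. -/
noncomputable def restore : TProg A B V K₂ Γ₂ :=
  loop (fun v => (v.top tab').isSome) (popEntry tab' ;; pushEntry tab)

/-- Pushes the value of the vertex `u`, found in the table, onto `arg`. -/
noncomputable def lookup : TProg A B V K₂ Γ₂ :=
  loop (fun v => (v.top tab).isSome)
    (popEntry tab ;; ifEq e₁ u tmp (copyRev e₂ arg tmp) skip ;; pushEntry tab') ;; restore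

variable {E : TEnv A V K₂ Γ₂} {s : TStore A B V K₂ Γ₂}

theorem exec_skip : (skip : TProg A B V K₂ Γ₂).Exec E s s :=
  fun hs => ⟨(Store.apply_keep ..).symm, hs.1⟩

theorem exec_increment {n : ℕ} (ha : s.reg addr = num n) (ht : s.reg tmp = [])
    (h : (n + 1).bits.length ≤ E.H) :
    (increment : TProg A B V K₂ Γ₂).Exec E s (s.set addr (num (n + 1))) := by
  obtain ⟨j, r, h1, h2, h3⟩ := exists_bits_succ n
  have hr : r.length ≤ r.tail.length + 1 := by cases r <;> simp
  rw [h3] at h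
  simp only [List.length_append, List.length_replicate, List.length_cons] at h
  have hn : (num n : List (StackSym V Γ₂)).reverse =
      List.replicate j (bit true) ++ r.map bit := by
    simp [num, h1]
  have hl : (num n : List (StackSym V Γ₂)).length = j + r.length := by
    rw [← List.length_reverse, hn]
    simp
  refine Exec.seq (m := (s.set addr []).set tmp (num n).reverse) ?_
    (Exec.seq (m := (s.set addr (List.replicate j (bit false))).set tmp (r.map bit)) ?_
      (Exec.seq (m := (s.set addr (bit true :: List.replicate j (bit false))).set tmp
        (r.tail.map bit)) ?_ ?_))
  · refine (exec_move (by simp) (by rw [ha, ht, hl]; simp; omega)).congr ?_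
    rw [ha, ht, List.append_nil]
  · refine Exec.loop_list (List.replicate j (bit true))
      (fun d l => (s.set addr (List.replicate d.length (bit false))).set tmp (l ++ r.map bit))
      (fun _ => by have := E.height_le; simp; omega)
      (fun d y l hd => ?_) ?_ (by simp [hn]) (by simp)
    · have hy : y = bit true := List.eq_of_mem_replicate (n := j) (by rw [← hd]; simp)
      have := congrArg List.length hd
      simp only [List.length_append, List.length_cons, List.length_replicate] at this
      refine ⟨by simp [hy], exec_xfer (fun k => ?_) rfl (by simp) fun hs => Store.Le.set
        (Store.Le.set (s := s) ?_ (by simp; omega)) (by simp; omega)⟩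
      · simp only [Store.set_reg]
        split_ifs <;> simp_all [List.replicate_succ]
      · intro k
        have hk := hs k
        simp only [Store.set_reg] at hk
        split_ifs at hk with h4 h5
        · subst h4; simp [ht]
        · subst h5; rw [ha, hl]; omega
        · exact hk
    · simp only [Store.view_top, Store.set_reg_self, List.nil_append, List.head?_map,
        decide_eq_false_iff_not]
      cases r with
      | nil => simp
      | cons b r => simpa using h2
  · refine exec_xfer (fun k => ?_) rfl (by simp) fun hs k => ?_
    · simp only [Store.set_reg]
      split_ifs <;> simp_all
    · have hk := hs k
      simp only [Store.set_reg] at hk ⊢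
      split_ifs at hk ⊢
      · simp at hk ⊢; omega
      · simp; omega
      · exact hk
  · refine (exec_move (by simp) (by simp; omega)).congr ?_
    ext1 <;> try rfl
    funext k
    simp only [Store.set_reg]
    split_ifs with h4 h5 h6 <;> simp_all [num]

/-- An entry of a table, consisting of a key and a value. -/
def entry (p : List (StackSym V Γ₂) × List (StackSym V Γ₂)) : List (StackSym V Γ₂) :=
  p.1.reverse ++ .sep :: (p.2.reverse ++ [.sep])

/-- The parts of an entry contain no separator. -/
def IsEntry (p : List (StackSym V Γ₂) × List (StackSym V Γ₂)) : Prop :=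
  (∀ y ∈ p.1, y.isSep = false) ∧ ∀ y ∈ p.2, y.isSep = false

theorem exec_moveEntry {a b : Reg K₂} (hab : a ≠ b) {l r : List (StackSym V Γ₂)}
    (hl : ∀ y ∈ l, y.isSep = false) (ha : s.reg a = l.reverse ++ .sep :: r) (hb : s.reg b = []) :
    (moveEntry a b : TProg A B V K₂ Γ₂).Exec E s ((s.set a r).set b l) := by
  refine Exec.of_ok fun hs => ?_
  have hH := hs.1 a
  rw [ha] at hH
  simp only [List.length_append, List.length_reverse, List.length_cons] at hH
  refine Exec.seq (m := (s.set a (.sep :: r)).set b l) ?_ ?_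
  · refine Exec.loop_list l.reverse (fun d m => (s.set a (m ++ .sep :: r)).set b d.reverse)
      (fun _ => by have := E.height_le; simp; omega) (fun d y m hd => ⟨?_, ?_⟩)
      (by simp [hab, StackSym.isSep]) ?_ (by simp)
    · have : y ∈ l := by rw [← List.mem_reverse, ← hd]; simp
      simp [hab, hl y this]
    · have := congrArg List.length hd
      simp only [List.length_append, List.length_cons, List.length_reverse] at this
      refine (exec_shift hab (x := y) (l := m ++ .sep :: r) (by simp [hab])
        (by simp; omega)).congr ?_
      ext1 <;> try rfl
      funext k
      simp only [Store.set_reg]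
      split_ifs <;> simp_all
    · ext1 <;> try rfl
      funext k
      simp only [Store.set_reg]
      split_ifs <;> simp_all
  · refine exec_xfer (fun k => ?_) rfl (by simp) fun h k => ?_
    · simp only [Store.set_reg]
      split_ifs <;> simp_all
    · have hk := h k
      simp only [Store.set_reg] at hk ⊢
      split_ifs at hk ⊢
      · exact hk
      · simp at hk; omega
      · exact hk

theorem exec_popEntry {a : Reg K₂} (h1 : a ≠ e₁) (h2 : a ≠ e₂)
    {p : List (StackSym V Γ₂) × List (StackSym V Γ₂)} (hp : IsEntry p) {r : List (StackSym V Γ₂)}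
    (ha : s.reg a = entry p ++ r) (he₁ : s.reg e₁ = []) (he₂ : s.reg e₂ = []) :
    (popEntry a : TProg A B V K₂ Γ₂).Exec E s (((s.set a r).set e₁ p.1).set e₂ p.2) := by
  refine ((exec_moveEntry h1 hp.1 (r := p.2.reverse ++ .sep :: r) (by simp [ha, entry])
    he₁).seq (exec_moveEntry h2 hp.2 (r := r) (by simp [h1])
      (by simp [h2.symm, he₂]))).congr ?_
  ext1 <;> try rfl
  funext k
  simp only [Store.set_reg]
  split_ifs <;> simp_all

theorem length_entry (p : List (StackSym V Γ₂) × List (StackSym V Γ₂)) :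
    (entry p).length = p.1.length + p.2.length + 2 := by
  simp [entry]
  omega

theorem exec_pushEntry {a : Reg K₂} (h1 : a ≠ e₁) (h2 : a ≠ e₂)
    (hH : (s.reg e₁).length + (s.reg e₂).length + 2 + (s.reg a).length ≤ E.H) :
    (pushEntry a : TProg A B V K₂ Γ₂).Exec E s
      (((s.set a (entry (s.reg e₁, s.reg e₂) ++ s.reg a)).set e₁ []).set e₂ []) := by
  refine ((exec_push a (sep : StackSym V Γ₂) (by omega)).seq ((exec_move h2.symm ?_).seq
    ((exec_push a (sep : StackSym V Γ₂) ?_).seq (exec_move h1.symm ?_)))).congr ?_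
  · simp [h2.symm]; omega
  · simp [h2.symm]; omega
  · simp [h2.symm, h1.symm]; omega
  · ext1 <;> try rfl
    funext k
    simp only [Store.set_reg]
    split_ifs <;> simp_all [entry]

/-- The contents of a table. -/
def table (l : List (List (StackSym V Γ₂) × List (StackSym V Γ₂))) : List (StackSym V Γ₂) :=
  l.flatMap entry

theorem length_entry_append (p : List (StackSym V Γ₂) × List (StackSym V Γ₂))
    (l : List (List (StackSym V Γ₂) × List (StackSym V Γ₂))) :
    (table (p :: l)).length = (entry p).length + (table l).length := by
  simp [table]

theorem length_table_reverse (l : List (List (StackSym V Γ₂) × List (StackSym V Γ₂))) :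
    (table l.reverse).length = (table l).length := by
  simp only [table, List.length_flatMap]
  rw [List.map_reverse, List.sum_reverse]

theorem length_le_length_table (l : List (List (StackSym V Γ₂) × List (StackSym V Γ₂))) :
    l.length ≤ (table l).length := by
  induction l with
  | nil => simp
  | cons p l ih => rw [length_entry_append, length_entry, List.length_cons]; omega

theorem table_cons_ne_nil (p : List (StackSym V Γ₂) × List (StackSym V Γ₂))
    (l : List (List (StackSym V Γ₂) × List (StackSym V Γ₂))) :
    ((table (p :: l)).head?).isSome = true := by
  simp [table, entry]

/-! #### Searching and pruning a table -/

/-- A key with a value. -/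
abbrev Entry (V Γ₂ : Type) := List (StackSym V Γ₂) × List (StackSym V Γ₂)

theorem length_table_filter_le (q : Entry V Γ₂ → Bool) (l : List (Entry V Γ₂)) :
    (table (l.filter q)).length ≤ (table l).length := by
  induction l with
  | nil => simp
  | cons p l ih =>
    rw [List.filter_cons]
    split_ifs
    · rw [length_entry_append, length_entry_append]; omega
    · rw [length_entry_append]; omega

theorem length_table_append (l m : List (Entry V Γ₂)) :
    (table (l ++ m)).length = (table l).length + (table m).length := by
  simp [table]

theorem exec_restore {l m : List (Entry V Γ₂)} (hl : ∀ p ∈ l, IsEntry p)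
    (h1 : s.reg tab' = table l) (h2 : s.reg tab = table m) (h3 : s.reg e₁ = [])
    (h4 : s.reg e₂ = []) (hH : (table l).length + (table m).length ≤ E.H) :
    (restore : TProg A B V K₂ Γ₂).Exec E s
      ((s.set tab' []).set tab (table (l.reverse ++ m))) := by
  refine Exec.loop_list l (fun d r => (s.set tab' (table r)).set tab (table (d.reverse ++ m)))
    (fun _ => ?_) (fun d p r hd => ⟨?_, ?_⟩) ?_ ?_ ?_
  · have := length_le_length_table l
    have := E.height_le
    omega
  · simpa using table_cons_ne_nil p r
  · have hlen := hH
    rw [← hd, length_table_append, length_entry_append] at hlen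
    have hle := length_entry p
    refine ((exec_popEntry (by simp) (by simp) (p := p) (hl p (by simp [← hd])) (r := table r)
      (by simp [table]) (by simp [h3]) (by simp [h4])).seq
      (exec_pushEntry (by simp) (by simp) ?_)).congr ?_
    · simp [length_table_append, length_table_reverse]
      omega
    · exact Store.ext_of_reg (fun k => by cases k <;> simp [table, h3, h4]) (by simp) rfl
  · simp [table]
  · exact Store.ext_of_reg (fun k => by cases k <;> simp [table, h1, h2, h3, h4]) (by simp) rfl
  · simp [table]

/-- The effect of a search for `key` in a table on the stack `a` for the result. -/
noncomputable def search (key : List (StackSym V Γ₂)) (l : List (Entry V Γ₂))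
    (a : List (StackSym V Γ₂)) : List (StackSym V Γ₂) :=
  l.foldl (fun a p => if p.1 = key then p.2.reverse ++ a else a) a

theorem search_of_notMem {key : List (StackSym V Γ₂)} {l : List (Entry V Γ₂)}
    (h : key ∉ l.map Prod.fst) (a : List (StackSym V Γ₂)) : search key l a = a := by
  induction l with
  | nil => rfl
  | cons p l ih =>
    simp only [List.map_cons, List.mem_cons, not_or] at h
    rw [search, List.foldl_cons, if_neg (Ne.symm h.1)]
    exact ih h.2

theorem search_of_mem {key y : List (StackSym V Γ₂)} {l : List (Entry V Γ₂)}
    (hn : (l.map Prod.fst).Nodup) (h : (key, y) ∈ l) (a : List (StackSym V Γ₂)) :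
    search key l a = y.reverse ++ a := by
  induction l with
  | nil => simp at h
  | cons p l ih =>
    rw [List.map_cons, List.nodup_cons] at hn
    rcases List.mem_cons.1 h with rfl | h
    · rw [search, List.foldl_cons, if_pos rfl]
      exact search_of_notMem hn.1 _
    · rw [search, List.foldl_cons, if_neg]
      · exact ih hn.2 h
      · intro hk
        exact hn.1 (hk ▸ List.mem_map_of_mem (f := Prod.fst) h)

/-- A table is searched by pouring it to another stack and back, which reverses its entries twice.
-/
theorem exec_lookup {l : List (Entry V Γ₂)} (hl : ∀ p ∈ l, IsEntry p)
    (hn : (l.map Prod.fst).Nodup) (h1 : s.reg tab = table l) (h2 : s.reg tab' = [])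
    (h3 : s.reg e₁ = []) (h4 : s.reg e₂ = []) (h5 : s.reg tmp = []) {y : List (StackSym V Γ₂)}
    (hy : (s.reg u, y) ∈ l) (hH : (table l).length ≤ E.H)
    (hH' : ∀ p ∈ l, p.2.length + (s.reg arg).length ≤ E.H) :
    (lookup : TProg A B V K₂ Γ₂).Exec E s (s.set arg (y.reverse ++ s.reg arg)) := by
  rw [← search_of_mem hn hy]
  refine Exec.seq (m := ((s.set tab []).set tab' (table l.reverse)).set arg
    (search (s.reg u) l (s.reg arg))) ?_ ?_
  · refine Exec.loop_list l (fun d r => ((s.set tab (table r)).set tab' (table d.reverse)).set arg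
      (search (s.reg u) d (s.reg arg))) (fun _ => ?_) (fun d p r hd => ⟨?_, ?_⟩) ?_ ?_ ?_
    · have := length_le_length_table l
      have := E.height_le
      omega
    · simpa using table_cons_ne_nil p r
    · have hlen := hH
      rw [← hd, length_table_append, length_entry_append] at hlen
      have hle := length_entry p
      have hp : p ∈ l := by simp [← hd]
      have hstep : search (s.reg u) (d ++ [p]) (s.reg arg) =
          if p.1 = s.reg u then p.2.reverse ++ s.reg arg
          else search (s.reg u) d (s.reg arg) := by
        rw [search, List.foldl_append, List.foldl_cons, List.foldl_nil]
        split_ifs with hk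
        · congr 1
          refine search_of_notMem (fun hm => ?_) _
          rw [← hd, List.map_append, List.map_cons] at hn
          rw [← hk] at hm
          exact (List.nodup_append.1 hn).2.2 _ hm _ (by simp) rfl
        · rfl
      refine ((exec_popEntry (by simp) (by simp) (p := p) (hl p hp) (r := table r)
        (by simp [table]) (by simp [h3]) (by simp [h4])).seq (Exec.seq
          (m := ((((s.set tab (table r)).set tab' (table d.reverse)).set arg
            (search (s.reg u) (d ++ [p]) (s.reg arg))).set e₁ p.1).set e₂ p.2)
          (exec_ifEq (by simp) (by simp) (by simp) (by simp [h5]) (fun hk => ?_) fun hk => ?_)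
          (exec_pushEntry (by simp) (by simp) ?_))).congr ?_
      · have hk' : p.1 = s.reg u := by simpa using hk
        have hd' : search (s.reg u) d (s.reg arg) = s.reg arg := by
          refine search_of_notMem (fun hm => ?_) _
          rw [← hd, List.map_append, List.map_cons] at hn
          rw [← hk'] at hm
          exact (List.nodup_append.1 hn).2.2 _ hm _ (by simp) rfl
        refine (exec_copyRev (by simp) (by simp) (by simp) (by simp [h5]) ?_).congr ?_
        · simpa [hd'] using hH' p hp
        · rw [hstep, if_pos hk']
          exact Store.ext_of_reg (fun k => by cases k <;> simp [table, hk', hd']) (by simp) rfl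
      · have hk' : ¬ p.1 = s.reg u := by simpa using hk
        refine exec_skip.congr ?_
        rw [hstep, if_neg hk']
        exact Store.ext_of_reg (fun k => by cases k <;> simp [table]) (by simp) rfl
      · simp [length_table_reverse]
        omega
      · exact Store.ext_of_reg (fun k => by cases k <;> simp [table, h3, h4]) (by simp) rfl
    · simp [table]
    · exact Store.ext_of_reg (fun k => by cases k <;> simp [table, h1, h2, h3, h4, h5, search])
        (by simp) rfl
    · simp [table]
  · refine (exec_restore (l := l.reverse) (m := []) (by simpa using hl) (by simp)
      (by simp [table]) (by simp [h3]) (by simp [h4])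
      (by simpa [table, length_table_reverse] using hH)).congr ?_
    exact Store.ext_of_reg (fun k => by cases k <;> simp [table, h1, h2, h3, h4]) (by simp) rfl

/-- Removes the entries from the table for which `check` leaves the stack `keep` empty. -/
noncomputable def prune (check : TProg A B V K₂ Γ₂) : TProg A B V K₂ Γ₂ :=
  loop (fun v => (v.top tab).isSome)
    (popEntry tab ;; check ;;
      ite (fun v => (v.top keep).isSome) (pushEntry tab' ;; clear fun k => decide (k = keep))
        (clear fun k => decide (k = e₁ ∨ k = e₂))) ;; restore

theorem exec_clear_two (a b : Reg K₂) :
    (clear fun k => decide (k = a ∨ k = b) : TProg A B V K₂ Γ₂).Exec E s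
      ((s.set a []).set b []) := by
  refine (exec_clear _).congr ?_
  ext1 <;> try rfl
  funext k
  simp only [Store.set_reg, decide_eq_true_eq]
  split_ifs <;> simp_all

/-- If `check` marks `keep` for the entries with `q`, then these are the ones that stay in the
table.  The position `i` of the input head afterwards is left open. -/
theorem exec_prune {check : TProg A B V K₂ Γ₂} {l : List (Entry V Γ₂)}
    (hl : ∀ p ∈ l, IsEntry p) (h1 : s.reg tab = table l) (h2 : s.reg tab' = [])
    (h3 : s.reg e₁ = []) (h4 : s.reg e₂ = []) (h5 : s.reg keep = [])
    (hH : (table l).length ≤ E.H) (q : Entry V Γ₂ → Bool)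
    (hc : ∀ p ∈ l, ∀ s' : TStore A B V K₂ Γ₂, s'.reg e₁ = p.1 →
      (∀ k, k ∉ [tab, tab', e₁, e₂] → s'.reg k = s.reg k) →
      check.Exec E s' ((s'.set keep (if q p then [.sep] else [])).setInp [])) :
    ∃ i, (prune check).Exec E s ((s.set tab (table (l.filter q))).setInp i) := by
  refine ⟨if l = [] then s.inp else [], Exec.seq (m := ((s.set tab []).set tab'
    (table (l.filter q).reverse)).setInp (if l = [] then s.inp else [])) ?_ ?_⟩
  · refine Exec.loop_list l (fun d r => ((s.set tab (table r)).set tab'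
      (table (d.filter q).reverse)).setInp (if d = [] then s.inp else []))
      (fun _ => ?_) (fun d p r hd => ⟨?_, ?_⟩) ?_ ?_ ?_
    · have := length_le_length_table l
      have := E.height_le
      omega
    · simpa using table_cons_ne_nil p r
    · have hlen := hH
      rw [← hd, length_table_append, length_entry_append] at hlen
      have hle := length_entry p
      have hf := length_table_filter_le q d
      have hp : p ∈ l := by simp [← hd]
      have e1 := hc p hp (((((s.set tab (table r)).set tab' (table (d.filter q).reverse)).set
        e₁ p.1).set e₂ p.2).setInp (if d = [] then s.inp else [])) (by simp) fun k hk => by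
          simp only [List.mem_cons, List.not_mem_nil, or_false, not_or] at hk
          simp [hk]
      refine Exec.seq (m := ((((s.set tab (table r)).set tab' (table (d.filter q).reverse)).set
        e₁ p.1).set e₂ p.2).setInp (if d = [] then s.inp else [])) ?_ (e1.seq ?_)
      · refine (exec_popEntry (by simp) (by simp) (p := p) (hl p hp) (r := table r)
          (by simp [table]) (by simp [h3]) (by simp [h4])).congr ?_
        exact Store.ext_of_reg (fun k => by cases k <;> simp [table]) (by simp) rfl
      · cases hq : q p
        · refine Exec.ite_neg (by simp) ((exec_clear_two e₁ e₂).congr ?_)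
          exact Store.ext_of_reg (fun k => by cases k <;> simp [table, h3, h4, h5, hq])
            (by simp) rfl
        · refine Exec.ite_pos (by simp) (((exec_pushEntry (by simp) (by simp) ?_).seq
            (exec_clear_one keep)).congr ?_)
          · simp [length_table_reverse]
            omega
          · exact Store.ext_of_reg (fun k => by cases k <;> simp [table, h3, h4, h5, hq])
              (by simp) rfl
    · simp [table]
    · exact Store.ext_of_reg (fun k => by cases k <;> simp [table, h1, h2, h3, h4]) (by simp) rfl
    · by_cases h : l = [] <;> simp [table, h]
  · refine (exec_restore (l := (l.filter q).reverse) (m := []) ?_ (by simp)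
      (by simp [table]) (by simp [h3]) (by simp [h4]) ?_).congr ?_
    · intro p hp
      exact hl p (by simp at hp; exact hp.1)
    · have := length_table_filter_le q l
      rw [length_table_reverse]
      simp only [table, List.flatMap_nil, List.length_nil] at this hH ⊢
      omega
    · exact Store.ext_of_reg (fun k => by cases k <;> simp [table, h2, h3, h4]) (by simp) rfl

end Traceback

/-! ### Reading the description of a vertex -/

namespace DPDag

variable {S : Type} [MaxSemiring S] (G : DPDag S)

open Classical in
/-- One step of the search for the first edge of maximal value. -/
noncomputable def better (o : Option G.edges) (e : G.edges) : Option G.edges :=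
  o.elim (some e) fun f => if G.edgeValue e ≤ G.edgeValue f then some f else some e

/-- The first edge of maximal value in a list. -/
noncomputable def firstMax (l : List G.edges) : Option G.edges := l.foldl G.better none

variable {G}

/-- In a list that respects the tie-breaking order the search ends with the first edge of maximal
value. -/
theorem isFirstMax_of_firstMax {l : List G.edges} (hs : l.Pairwise G.edgeOrder.le) (hl : l ≠ []) :
    ∃ e, G.firstMax l = some e ∧ G.IsFirstMax l e := by
  induction l using List.reverseRecOn with
  | nil => exact absurd rfl hl
  | append_singleton l e ih =>
    rw [firstMax, List.foldl_append, List.foldl_cons, List.foldl_nil]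
    by_cases h : l = []
    · subst h
      exact ⟨e, rfl, isFirstMax_singleton e⟩
    · obtain ⟨f, hf, hm⟩ := ih (List.pairwise_append.1 hs).1 h
      rw [firstMax] at hf
      rw [hf]
      by_cases hle : G.edgeValue e ≤ G.edgeValue f
      · exact ⟨f, by simp [better, hle], hm.append_of_le hs hle⟩
      · exact ⟨e, by simp [better, hle], hm.append_of_lt (not_le.1 hle)⟩

omit [MaxSemiring S] in
theorem length_inList_le {V : Type} (G : DPDag S) (enc : S → List V) (v : Fin G.T) :
    (G.inList v).length ≤ ((G.inList v).flatMap (G.edgeCode enc)).length := by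
  induction G.inList v with
  | nil => simp
  | cons e r ih =>
    have : 1 ≤ (G.edgeCode enc e).length := by simp [edgeCode]; omega
    rw [List.flatMap_cons, List.length_append, List.length_cons]
    omega

end DPDag

theorem inputTape_cons {A : Type} (b : List A) (bs : List (List A)) :
    inputTape (b :: bs) = b.map some ++ none :: inputTape bs := by
  simp [inputTape]

namespace Traceback

open Prog StackSym Reg

section Dag

variable {S V K₂ Γ₂ : Type} [MaxSemiring S] {G : DPDag S} {enc : S → List V}

abbrev VProg (V K₂ Γ₂ : Type) := TProg (InSym V) (Option Bool) V K₂ Γ₂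

abbrev VStore (V K₂ Γ₂ : Type) := TStore (InSym V) (Option Bool) V K₂ Γ₂

abbrev VEnv (V K₂ Γ₂ : Type) := TEnv (InSym V) V K₂ Γ₂

/-- The bounds and the input on which the correctness of the program depends: `b` bounds the lengths
of all numbers and codes that occur in the table, and `h` those of all codes.  In `height` the first
summand is the space for the table, and the second one the space for all other data. -/
structure Ctx (G : DPDag S) (enc : S → List V) (t : Fin G.T) (E : VEnv V K₂ Γ₂) (b h : ℕ) :
    Prop where
  bs : E.bs = G.instanceCode enc t
  addr : E.addr = Reg.addr
  one : E.one = StackSym.isOne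
  bits_le : ∀ n ≤ G.T, n.bits.length ≤ b
  weight_le : ∀ e, (enc (G.weight e)).length ≤ h
  value_le : ∀ v, (enc (G.value v)).length ≤ b
  edgeValue_le : ∀ e, (enc (G.edgeValue e)).length ≤ h
  le_h : b ≤ h
  height : (G.width + 1) * (2 * b + 2) + (6 * h + 6) ≤ E.H
  rounds : G.T + 1 ≤ E.N

def isVal : InSym V → Bool
  | .val _ => true
  | _ => false

/-- Record on the stack `keep` that a condition holds. -/
noncomputable def mark : VProg V K₂ Γ₂ := (clear fun k => decide (k = keep)) ;; push keep .sep

/-- Reads the description of an edge and marks `keep` if its tail is `e₁`. -/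
noncomputable def scanEdge : VProg V K₂ Γ₂ :=
  readWhile ofBit u ;; next ;; skipWhile isVal ;; next ;; ifEq e₁ u tmp mark skip ;;
    clear fun k => decide (k = u)

/-- Reads the description of a vertex and marks `keep` if there is an edge with tail `e₁`. -/
noncomputable def scanBlock : VProg V K₂ Γ₂ :=
  skipWhile isVal ;; next ;; loop (fun v => v.sym.isSome) scanEdge ;; next

/-- Marks `keep` if `e₁` is the tail of an edge to a vertex after the vertex `addr`. -/
noncomputable def check : VProg V K₂ Γ₂ :=
  jump ;; skipWhile (fun _ => true) ;; next ;; loop (fun v => v.sym.isSome) scanBlock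

variable {t : Fin G.T} {E : VEnv V K₂ Γ₂} {b h : ℕ} {s : VStore V K₂ Γ₂}

theorem Ctx.le_height (C : Ctx G enc t E b h) : 6 * h + 6 ≤ E.H := by
  have := C.height
  omega

theorem Ctx.indexBits_le (C : Ctx G enc t E b h) (v : Fin G.T) : (G.indexBits v).length ≤ h :=
  (C.bits_le _ v.isLt).trans C.le_h

open Classical in
theorem exec_scanEdge (C : Ctx G enc t E b h) (e : G.edges) {rest : List (Option (InSym V))}
    (hi : s.inp = (G.edgeCode enc e).map some ++ rest) (hu : s.reg u = []) (ht : s.reg tmp = []) :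
    scanEdge.Exec E s ((s.set keep (if s.reg e₁ = num ((G.src e : ℕ) + 1) then [.sep]
      else s.reg keep)).setInp rest) := by
  have h6 := C.le_height
  have hb := C.indexBits_le (G.src e)
  have hN : ((G.indexBits (G.src e)).map StackSym.bit).reverse =
    (num ((G.src e : ℕ) + 1) : List (StackSym V Γ₂)) := rfl
  refine Exec.seq (m := (s.set u (num ((G.src e : ℕ) + 1))).setInp
    (some .sep :: (((enc (G.weight e)).map .val).map some ++ some .sep :: rest))) ?_
    (exec_next.seq (Exec.seq (m := (s.set u (num ((G.src e : ℕ) + 1))).setInp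
      (some .sep :: rest)) ?_ (exec_next.seq (Exec.seq (m := ((s.set u
        (num ((G.src e : ℕ) + 1))).set keep (if s.reg e₁ = num ((G.src e : ℕ) + 1) then [.sep]
        else s.reg keep)).setInp rest) ?_
        ((exec_clear_one u).congr ?_)))))
  · refine (exec_readWhile (G.indexBits (G.src e)) InSym.bit StackSym.bit (fun _ => rfl)
      (rest := some .sep :: (((enc (G.weight e)).map .val).map some ++ some .sep :: rest)) ?_ rfl
      ?_).congr ?_
    · rw [hi, DPDag.edgeCode]
      simp
    · rw [hu]; simp; omega
    · rw [hN, hu, List.append_nil]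
  · refine (exec_skipWhile ((enc (G.weight e)).map .val) ?_ rfl rfl).congr rfl
    intro y hy
    obtain ⟨g, -, rfl⟩ := List.mem_map.1 hy
    rfl
  · refine exec_ifEq (by simp) (by simp) (by simp) (by simp [ht]) (fun hk => ?_) fun hk => ?_
    · have hk' : s.reg e₁ = num ((G.src e : ℕ) + 1) := by simpa using hk
      refine ((exec_clear_one keep).seq (exec_push keep StackSym.sep (by simp; omega))).congr ?_
      rw [if_pos hk']
      exact Store.ext_of_reg (fun k => by cases k <;> simp) (by simp) rfl
    · have hk' : ¬ s.reg e₁ = num ((G.src e : ℕ) + 1) := by simpa using hk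
      refine exec_skip.congr ?_
      rw [if_neg hk']
      exact Store.ext_of_reg (fun k => by cases k <;> simp) (by simp) rfl
  · exact Store.ext_of_reg (fun k => by cases k <;> simp [hu]) (by simp) rfl

omit [MaxSemiring S] in
theorem vertexCode_eq (v : Fin G.T) : ∃ l : List V,
    G.vertexCode enc v = l.map .val ++ .sep :: (G.inList v).flatMap (G.edgeCode enc) ∧
      l = if v ∈ G.sources then enc (G.init v) else [] := by
  refine ⟨_, ?_, rfl⟩
  rw [DPDag.vertexCode]
  split_ifs <;> simp

omit [MaxSemiring S] in
theorem head_edgeCode (e : G.edges) (rest : List (Option (InSym V))) :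
    ((((G.edgeCode enc e).map some ++ rest).head?).join).isSome = true := by
  rw [DPDag.edgeCode]
  cases G.indexBits (G.src e) <;> simp

open Classical in
theorem exec_scanBlock (C : Ctx G enc t E b h) (v : Fin G.T) {rest : List (Option (InSym V))}
    (hi : s.inp = (G.vertexCode enc v).map some ++ none :: rest) (hu : s.reg u = [])
    (ht : s.reg tmp = []) :
    scanBlock.Exec E s ((s.set keep (if ∃ e ∈ G.inList v, s.reg e₁ = num ((G.src e : ℕ) + 1)
      then [.sep] else s.reg keep)).setInp rest) := by
  obtain ⟨l, hl, -⟩ := vertexCode_eq (enc := enc) v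
  refine Exec.seq (m := s.setInp (some .sep ::
    (((G.inList v).flatMap (G.edgeCode enc)).map some ++ none :: rest))) ?_
    (exec_next.seq (Exec.seq (m := (s.set keep (if ∃ e ∈ G.inList v,
      s.reg e₁ = num ((G.src e : ℕ) + 1) then [.sep] else s.reg keep)).setInp
        (none :: rest)) ?_ (exec_next.congr rfl)))
  · refine (exec_skipWhile (l.map .val) ?_ ?_ rfl).congr rfl
    · intro y hy
      obtain ⟨g, -, rfl⟩ := List.mem_map.1 hy
      rfl
    · rw [hi, hl]
      simp
  · refine Exec.loop_list (G.inList v) (fun d r => (s.set keep (if ∃ e ∈ d,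
      s.reg e₁ = num ((G.src e : ℕ) + 1) then [.sep] else s.reg keep)).setInp
        ((r.flatMap (G.edgeCode enc)).map some ++ none :: rest)) (fun hs => ?_)
      (fun d e r hd => ⟨?_, ?_⟩) (by simp) ?_ (by simp)
    · have := hs.2
      simp only [Store.setInp_inp, List.length_append, List.length_map] at this
      exact (G.length_inList_le enc v).trans (by omega)
    · simp only [List.flatMap_cons, List.map_append, List.append_assoc, Store.view_sym,
        Store.setInp_inp]
      exact head_edgeCode e _
    · refine (exec_scanEdge C e (rest := (r.flatMap (G.edgeCode enc)).map some ++ none :: rest)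
        (by simp) (by simp [hu]) (by simp [ht])).congr ?_
      refine Store.ext_of_reg (fun k => ?_) (by simp) rfl
      by_cases hk : k = keep
      · subst hk
        by_cases h1 : s.reg e₁ = num ((G.src e : ℕ) + 1)
        · have : ∃ e' ∈ d ++ [e], s.reg e₁ = num ((G.src e' : ℕ) + 1) := ⟨e, by simp, h1⟩
          simp [h1]
        · have : (∃ e' ∈ d ++ [e], s.reg e₁ = num ((G.src e' : ℕ) + 1)) ↔
              ∃ e' ∈ d, s.reg e₁ = num ((G.src e' : ℕ) + 1) := by
            simp [h1, or_and_right, exists_or]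
          simp only [this]
          simp [h1]
      · simp [hk]
    · exact Store.ext_of_reg (fun k => by cases k <;> simp) (by simp) rfl

/-- The rest of the input after the vertex with number `n`. -/
def inputAfter (G : DPDag S) (enc : S → List V) (n : ℕ) : List (Option (InSym V)) :=
  inputTape (((List.finRange G.T).drop n).map (G.vertexCode enc))

/-- After a jump to the vertex `v` the input head is at the beginning of the description of `v`. -/
theorem Ctx.jump_eq (C : Ctx G enc t E b h) (v : Fin G.T)
    (hs : s.reg Reg.addr = num ((v : ℕ) + 1)) :
    inputTape (E.bs.drop (addrVal E.one (s.reg E.addr))) =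
      (G.vertexCode enc v).map some ++ none :: inputAfter G enc (v + 1) := by
  rw [C.one, C.addr, hs, addrVal_num, C.bs, DPDag.instanceCode, List.drop_succ_cons,
    ← List.map_drop, List.drop_eq_getElem_cons (by simp), List.map_cons, inputTape_cons,
    inputAfter]
  simp

omit [MaxSemiring S] in
theorem head_vertexCode (v : Fin G.T) (rest : List (Option (InSym V))) :
    ((((G.vertexCode enc v).map some ++ rest).head?).join).isSome = true := by
  obtain ⟨l, hl, -⟩ := vertexCode_eq (enc := enc) v
  rw [hl]
  cases l <;> simp

open Classical in
/-- The search through the descriptions of the vertices after `v` decides whether the vertex with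
the number `e₁` has an edge to one of them. -/
theorem exec_check (C : Ctx G enc t E b h) (v : Fin G.T) (ha : s.reg addr = num ((v : ℕ) + 1))
    (hu : s.reg u = []) (ht : s.reg tmp = []) (hk : s.reg keep = []) :
    check.Exec E s ((s.set keep (if ∃ w ∈ (List.finRange G.T).drop (v + 1), ∃ e ∈ G.inList w,
      s.reg e₁ = num ((G.src e : ℕ) + 1) then [.sep] else [])).setInp []) := by
  refine exec_jump.seq (Exec.seq (m := s.setInp (none :: inputAfter G enc (v + 1))) ?_
    (exec_next.seq ?_))
  · exact (exec_skipWhile (G.vertexCode enc v) (by simp) (C.jump_eq v ha) rfl).congr rfl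
  · refine Exec.loop_list ((List.finRange G.T).drop (v + 1)) (fun d r => (s.set keep (if ∃ w ∈ d,
      ∃ e ∈ G.inList w, s.reg e₁ = num ((G.src e : ℕ) + 1) then [.sep] else [])).setInp
        (inputTape (r.map (G.vertexCode enc)))) (fun _ => ?_) (fun d w r hd => ⟨?_, ?_⟩)
        (by simp [inputTape]) ?_ (by simp [inputTape])
    · have := C.rounds
      simp
      omega
    · simp only [List.map_cons, inputTape_cons]
      exact head_vertexCode w _
    · refine (exec_scanBlock C w (rest := inputTape (r.map (G.vertexCode enc)))
        (by simp [inputTape_cons]) (by simp [hu]) (by simp [ht])).congr ?_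
      refine Store.ext_of_reg (fun k => ?_) (by simp) rfl
      by_cases hk : k = keep
      · subst hk
        by_cases h1 : ∃ e ∈ G.inList w, s.reg e₁ = num ((G.src e : ℕ) + 1)
        · have : ∃ v' ∈ d ++ [w], ∃ e ∈ G.inList v', s.reg e₁ = num ((G.src e : ℕ) + 1) :=
            ⟨w, by simp, h1⟩
          simp only [Store.setInp_reg, Store.set_reg_self, ne_eq, reduceCtorEq, not_false_eq_true,
            Store.set_reg_ne]
          rw [if_pos this, if_pos h1]
        · have : (∃ v' ∈ d ++ [w], ∃ e ∈ G.inList v', s.reg e₁ = num ((G.src e : ℕ) + 1)) ↔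
              ∃ v' ∈ d, ∃ e ∈ G.inList v', s.reg e₁ = num ((G.src e : ℕ) + 1) := by
            constructor
            · rintro ⟨w', hw', he⟩
              rcases List.mem_append.1 hw' with hw' | hw'
              · exact ⟨w', hw', he⟩
              · rw [List.mem_singleton] at hw'
                subst hw'
                exact absurd he h1
            · rintro ⟨w', hw', he⟩
              exact ⟨w', by simp [hw'], he⟩
          simp only [Store.setInp_reg, Store.set_reg_self, ne_eq, reduceCtorEq, not_false_eq_true,
            Store.set_reg_ne, this]
          rw [if_neg h1]
      · simp [hk]
    · exact Store.ext_of_reg (fun k => by cases k <;> simp [hk]) (by simp [inputAfter]) rfl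

end Dag

end Traceback

/-! ### Evaluating a vertex -/

namespace Traceback

open Prog StackSym Reg

/-- The stacks that are empty between the steps of the program. -/
def isTemp {K₂ : Type} : Reg K₂ → Bool
  | .u | .w | .arg | .res | .tmp | .tab' | .e₁ | .e₂ | .keep | .sub _ => true
  | _ => false

section Dag

variable {S V K₂ Γ₂ : Type} [MaxSemiring S] {G : DPDag S} {enc : S → List V} {t : Fin G.T}
  {E : VEnv V K₂ Γ₂} {b h : ℕ} {s : VStore V K₂ Γ₂}

/-- All stacks for temporary data are empty. -/
def Clean (s : VStore V K₂ Γ₂) : Prop := ∀ k, isTemp k = true → s.reg k = []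

theorem Clean.set (hs : Clean s) {k : Reg K₂} (hk : isTemp k = false)
    (l : List (StackSym V Γ₂)) : Clean (s.set k l) := fun j hj => by
  rw [Store.set_reg_ne, hs j hj]
  rintro rfl
  rw [hk] at hj
  exact Bool.false_ne_true hj

theorem Clean.setInp (hs : Clean s) (i : List (Option (InSym V))) : Clean (s.setInp i) := hs

/-- Two words on a stack, the first symbol of the first one on top, as a subroutine expects its
arguments. -/
def twoWords (a b : List V) : List (StackSym V Γ₂) :=
  a.map val ++ .sep :: (b.map val ++ [.sep])

/-- The programs `pmul` and `ple` compute products and comparisons of the values that occur in the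
evaluation of `G`. -/
structure IsArith (G : DPDag S) (enc : S → List V) (E : VEnv V K₂ Γ₂)
    (pmul ple : VProg V K₂ Γ₂) : Prop where
  mul : ∀ (e : G.edges) (s : VStore V K₂ Γ₂),
    s.reg arg = twoWords (enc (G.value (G.src e))) (enc (G.weight e)) → s.reg res = [] →
      s.reg tmp = [] → (∀ k, s.reg (sub k) = []) →
      pmul.Exec E s ((s.set arg []).set res (word (enc (G.edgeValue e))))
  le : ∀ (e f : G.edges) (s : VStore V K₂ Γ₂),
    s.reg arg = twoWords (enc (G.edgeValue e)) (enc (G.edgeValue f)) → s.reg res = [] →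
      s.reg tmp = [] → (∀ k, s.reg (sub k) = []) →
      ple.Exec E s ((s.set arg []).set res [.bit (decide (G.edgeValue e ≤ G.edgeValue f))])

/-- Makes `w`, a reversed word, the best value and `u` the predecessor. -/
noncomputable def replaceBest : VProg V K₂ Γ₂ :=
  (clear fun k => decide (k = best ∨ k = pred)) ;; move w best ;; move u tmp ;; move tmp pred

/-- Reads the description of an edge and computes its value. -/
noncomputable def evalEdge (pmul : VProg V K₂ Γ₂) : VProg V K₂ Γ₂ :=
  readWhile ofBit u ;; next ;; readWhile ofVal w ;; next ;; push arg .sep ;; move w arg ;;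
    push arg .sep ;; lookup ;; pmul

/-- Compares the value of an edge with the best value so far, of which there is none if `pred` is
empty. -/
noncomputable def updateBest (ple : VProg V K₂ Γ₂) : VProg V K₂ Γ₂ :=
  ite (fun v => (v.top pred).isNone) (move res w ;; replaceBest)
    (push arg .sep ;; copyRev best arg tmp ;; push arg .sep ;; copyRev res arg tmp ;;
      move res w ;; ple ;;
      ite (fun v => decide (v.top res = some (.bit true)))
        (clear fun k => decide (k = u ∨ k = w)) replaceBest ;;
      clear fun k => decide (k = res))

/-- Computes the value and the witness predecessor of the vertex `addr`. -/
noncomputable def evalVertex (pmul ple : VProg V K₂ Γ₂) : VProg V K₂ Γ₂ :=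
  (clear fun k => decide (k = best ∨ k = pred)) ;; jump ;; readWhile ofVal best ;; next ;;
    loop (fun v => v.sym.isSome) (evalEdge pmul ;; updateBest ple)

/-- The best value, for a choice of an edge. -/
def bestReg (enc : S → List V) (o : Option G.edges) : List (StackSym V Γ₂) :=
  o.elim [] fun e => word (enc (G.edgeValue e))

/-- The predecessor, for a choice of an edge. -/
def predReg (o : Option G.edges) : List (StackSym V Γ₂) :=
  o.elim [] fun e => num ((G.src e : ℕ) + 1)

theorem exec_replaceBest (ht : s.reg tmp = []) :
    (replaceBest : VProg V K₂ Γ₂).Exec E s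
      ((((s.set best (s.reg w).reverse).set pred (s.reg u)).set w []).set u []) := by
  refine Exec.of_ok fun hs => ?_
  have h1 := hs.1 w
  have h2 := hs.1 u
  refine ((exec_clear_two best pred).seq ((exec_move (by simp) (by simpa using h1)).seq
    ((exec_move (by simp) (by simpa [ht] using h2)).seq
      (exec_move (by simp) (by simpa [ht] using h2))))).congr ?_
  exact Store.ext_of_reg (fun k => by cases k <;> simp [ht]) (by simp) rfl

/-- The comparison with the best value performs one step of the search for the first edge of maximal
value. -/
theorem exec_updateBest (C : Ctx G enc t E b h) {pmul ple : VProg V K₂ Γ₂}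
    (hp : IsArith G enc E pmul ple) (e : G.edges) (o : Option G.edges)
    (hu : s.reg u = num ((G.src e : ℕ) + 1)) (hr : s.reg res = word (enc (G.edgeValue e)))
    (hw : s.reg w = []) (ha : s.reg arg = []) (ht : s.reg tmp = [])
    (hk : ∀ k, s.reg (sub k) = []) (hb : s.reg best = bestReg enc o)
    (hp' : s.reg pred = predReg o) :
    (updateBest ple).Exec E s ((((s.set u []).set res []).set best
      (bestReg enc (G.better o e))).set pred (predReg (G.better o e))) := by
  have h6 := C.le_height
  have he := C.edgeValue_le e
  cases o with
  | none =>
    refine Exec.ite_pos (by simp [hp', predReg]) (((exec_move (by simp) (by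
      simp [hr, hw, length_word]; omega)).seq (exec_replaceBest (by simp [ht]))).congr ?_)
    exact Store.ext_of_reg (fun k => by
      cases k <;> simp [hu, hr, hw, bestReg, predReg, DPDag.better]) (by simp) rfl
  | some f =>
    have hf := C.edgeValue_le f
    simp only [bestReg, predReg, Option.elim] at hb hp'
    have hne : (num ((G.src f : ℕ) + 1) : List (StackSym V Γ₂)) ≠ [] :=
      fun h => by simpa using num_eq_nil.1 h
    refine Exec.ite_neg (by simpa [hp'] using hne) ?_
    refine Exec.seq (m := s.set arg [.sep])
      ((exec_push arg StackSym.sep (by simp [ha]; omega)).congr (by rw [ha]))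
      (Exec.seq (m := s.set arg ((enc (G.edgeValue f)).map val ++ [.sep])) ?_
      (Exec.seq (m := s.set arg (.sep :: ((enc (G.edgeValue f)).map val ++ [.sep])))
      ((exec_push arg StackSym.sep (by simp; omega)).congr ?_)
      (Exec.seq (m := s.set arg (twoWords (enc (G.edgeValue e)) (enc (G.edgeValue f)))) ?_
      (Exec.seq (m := ((s.set arg (twoWords (enc (G.edgeValue e)) (enc (G.edgeValue f)))).set
        res []).set w (word (enc (G.edgeValue e))).reverse) ?_
      (Exec.seq (hp.le e f _ (by simp) (by simp) (by simp [ht]) (by simp [hk])) ?_)))))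
    · refine (exec_copyRev (by simp) (by simp) (by simp) (by simp [ht])
        (by simp [hb, length_word]; omega)).congr ?_
      exact Store.ext_of_reg (fun k => by cases k <;> simp [hb, word]) (by simp) rfl
    · exact Store.ext_of_reg (fun k => by cases k <;> simp) (by simp) rfl
    · refine (exec_copyRev (by simp) (by simp) (by simp) (by simp [ht])
        (by simp [hr, length_word]; omega)).congr ?_
      exact Store.ext_of_reg (fun k => by cases k <;> simp [hr, word, twoWords]) (by simp) rfl
    · refine (exec_move (by simp) (by simp [hr, hw, length_word]; omega)).congr ?_
      exact Store.ext_of_reg (fun k => by cases k <;> simp [hr, hw]) (by simp) rfl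
    · by_cases hle : G.edgeValue e ≤ G.edgeValue f
      · refine ((Exec.ite_pos (by simp [hle]) (exec_clear_two u w)).seq (exec_clear_one res)).congr
          (Store.ext_of_reg (fun k => ?_) (by simp) rfl)
        cases k <;> simp [DPDag.better, hle, bestReg, predReg, ha, hw, hb, hp']
      · refine ((Exec.ite_neg (by simp [hle]) (exec_replaceBest (by simp [ht]))).seq
          (exec_clear_one res)).congr (Store.ext_of_reg (fun k => ?_) (by simp) rfl)
        cases k <;> simp [DPDag.better, hle, bestReg, predReg, ha, hw, hu]

/-- The entry of the table for a vertex. -/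
def valueEntry (enc : S → List V) (v : Fin G.T) : Entry V Γ₂ :=
  (num ((v : ℕ) + 1), word (enc (G.value v)))

theorem nodup_keys {l : List (Fin G.T)} (hl : l.Nodup) :
    ((l.map (valueEntry enc)).map (Prod.fst : Entry V Γ₂ → _)).Nodup := by
  rw [List.map_map]
  refine hl.map fun a c hac => ?_
  have := num_injective hac
  exact Fin.ext (by omega)

/-- The table holds the values of the vertices in `l`. -/
structure IsTable (G : DPDag S) (enc : S → List V) (l : List (Fin G.T)) (s : VStore V K₂ Γ₂) :
    Prop where
  nodup : l.Nodup
  length_le : l.length ≤ G.width + 1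
  tab : s.reg tab = table (l.map (valueEntry enc))

theorem isEntry_of_mem {l : List (Fin G.T)} {p : Entry V Γ₂}
    (hp : p ∈ l.map (valueEntry enc)) :
    IsEntry p := by
  obtain ⟨v, -, rfl⟩ := List.mem_map.1 hp
  exact ⟨fun _ => isSep_of_mem_num, fun _ => isSep_of_mem_word⟩

theorem Ctx.length_table_le (C : Ctx G enc t E b h) (l : List (Fin G.T)) :
    (table (l.map (valueEntry enc)) :
      List (StackSym V Γ₂)).length ≤ l.length * (2 * b + 2) := by
  induction l with
  | nil => simp [table]
  | cons v l ih =>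
    have h1 := C.bits_le ((v : ℕ) + 1) v.isLt
    have h2 := C.value_le v
    rw [List.map_cons, length_entry_append, length_entry, valueEntry, length_num, length_word,
      List.length_cons, add_mul]
    omega

theorem Ctx.length_table_le_height (C : Ctx G enc t E b h) {l : List (Fin G.T)}
    (hl : l.length ≤ G.width + 1) :
    (table (l.map (valueEntry enc)) :
      List (StackSym V Γ₂)).length + (6 * h + 6) ≤ E.H := by
  have h1 := C.length_table_le (Γ₂ := Γ₂) l
  have h2 := Nat.mul_le_mul_right (2 * b + 2) hl
  have := C.height
  omega

theorem exec_evalEdge (C : Ctx G enc t E b h) {pmul ple : VProg V K₂ Γ₂}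
    (hp : IsArith G enc E pmul ple) (e : G.edges) {rest : List (Option (InSym V))}
    (hi : s.inp = (G.edgeCode enc e).map some ++ rest) (hs : Clean s) {l : List (Fin G.T)}
    (hl : IsTable G enc l s) (he : G.src e ∈ l) :
    (evalEdge pmul).Exec E s (((s.set u (num ((G.src e : ℕ) + 1))).set res
      (word (enc (G.edgeValue e)))).setInp rest) := by
  have h6 := C.le_height
  have hb := C.indexBits_le (G.src e)
  have hw := C.weight_le e
  have hu := hs u rfl
  have hw' := hs w rfl
  have ha := hs arg rfl
  have hN : ((G.indexBits (G.src e)).map StackSym.bit).reverse =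
    (num ((G.src e : ℕ) + 1) : List (StackSym V Γ₂)) := rfl
  have hht := Ctx.length_table_le_height (Γ₂ := Γ₂) C hl.length_le
  refine Exec.seq (m := (s.set u (num ((G.src e : ℕ) + 1))).setInp
    (some .sep :: (((enc (G.weight e)).map .val).map some ++ some .sep :: rest))) ?_
    (exec_next.seq (Exec.seq (m := ((s.set u (num ((G.src e : ℕ) + 1))).set w
      (word (enc (G.weight e)))).setInp (some .sep :: rest)) ?_ (exec_next.seq
    (Exec.seq (m := (((s.set u (num ((G.src e : ℕ) + 1))).set w (word (enc (G.weight e)))).set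
      arg [.sep]).setInp rest) ?_
    (Exec.seq (m := ((s.set u (num ((G.src e : ℕ) + 1))).set arg
      ((enc (G.weight e)).map val ++ [.sep])).setInp rest) ?_
    (Exec.seq (m := ((s.set u (num ((G.src e : ℕ) + 1))).set arg
      (.sep :: ((enc (G.weight e)).map val ++ [.sep]))).setInp rest) ?_
    (Exec.seq (m := ((s.set u (num ((G.src e : ℕ) + 1))).set arg
      (twoWords (enc (G.value (G.src e))) (enc (G.weight e)))).setInp rest) ?_
    ((hp.mul e _ (by simp) (by simp [hs res rfl]) (by simp [hs tmp rfl])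
      (by simp [hs (sub _) rfl])).congr ?_))))))))
  · refine (exec_readWhile (G.indexBits (G.src e)) InSym.bit StackSym.bit (fun _ => rfl)
      (rest := some .sep :: (((enc (G.weight e)).map .val).map some ++ some .sep :: rest)) ?_ rfl
      ?_).congr ?_
    · rw [hi, DPDag.edgeCode]
      simp
    · rw [hu]; simp; omega
    · rw [hN, hu, List.append_nil]
  · refine (exec_readWhile (enc (G.weight e)) InSym.val StackSym.val (fun _ => rfl)
      (rest := some .sep :: rest) (by simp) rfl (by simp [hw']; omega)).congr ?_
    exact Store.ext_of_reg (fun k => by cases k <;> simp [hw', word]) (by simp) rfl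
  · refine (exec_push arg StackSym.sep (by simp [ha]; omega)).congr ?_
    exact Store.ext_of_reg (fun k => by cases k <;> simp [ha]) (by simp) rfl
  · refine (exec_move (by simp) (by simp [length_word]; omega)).congr ?_
    exact Store.ext_of_reg (fun k => by cases k <;> simp [hw', word]) (by simp) rfl
  · refine (exec_push arg StackSym.sep (by simp; omega)).congr ?_
    exact Store.ext_of_reg (fun k => by cases k <;> simp) (by simp) rfl
  · refine (exec_lookup (l := l.map (valueEntry enc))
      (fun p => isEntry_of_mem) (nodup_keys hl.nodup) (by simp [hl.tab]) (by simp [hs tab' rfl])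
      (by simp [hs e₁ rfl]) (by simp [hs e₂ rfl]) (by simp [hs tmp rfl])
      (y := word (enc (G.value (G.src e)))) ?_ (by omega) ?_).congr ?_
    · simp only [Store.setInp_reg, Store.set_reg_self, ne_eq, reduceCtorEq, not_false_eq_true,
        Store.set_reg_ne]
      exact List.mem_map.2 ⟨G.src e, he, rfl⟩
    · intro p hp'
      obtain ⟨v, -, rfl⟩ := List.mem_map.1 hp'
      have := C.value_le v
      have := C.le_h
      simp [length_word, valueEntry]
      omega
    · exact Store.ext_of_reg (fun k => by cases k <;> simp [word, twoWords]) (by simp) rfl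
  · exact Store.ext_of_reg (fun k => by cases k <;> simp [ha]) (by simp) rfl

/-- If the table holds the values of the tails of the edges into `v`, then the program obtains the
value of `v`, and its witness predecessor or, at a source, the empty stack `pred`. -/
theorem exec_evalVertex (C : Ctx G enc t E b h) {pmul ple : VProg V K₂ Γ₂}
    (hp : IsArith G enc E pmul ple) (v : Fin G.T) (ha : s.reg addr = num ((v : ℕ) + 1))
    (hs : Clean s) {l : List (Fin G.T)} (hl : IsTable G enc l s)
    (he : ∀ e ∈ G.inList v, G.src e ∈ l) :
    (evalVertex pmul ple).Exec E s (((s.set best (word (enc (G.value v)))).set pred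
      (predReg (G.firstMax (G.inList v)))).setInp (none :: inputAfter G enc (v + 1))) := by
  have h6 := C.le_height
  obtain ⟨m, hm, hm'⟩ := vertexCode_eq (enc := enc) v
  have hmh : m.length ≤ h := by
    rw [hm']
    split_ifs with hv
    · rw [← G.value_of_mem_sources hv]
      exact (C.value_le v).trans C.le_h
    · exact Nat.zero_le _
  refine (exec_clear_two best pred).seq (exec_jump.seq (Exec.seq
    (m := ((s.set best (word m)).set pred []).setInp (some .sep ::
      (((G.inList v).flatMap (G.edgeCode enc)).map some ++ none :: inputAfter G enc (v + 1))))
    ?_ (exec_next.seq ?_)))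
  · refine (exec_readWhile m InSym.val StackSym.val (fun _ => rfl) (rest := some .sep ::
      (((G.inList v).flatMap (G.edgeCode enc)).map some ++ none :: inputAfter G enc (v + 1)))
      ?_ rfl ?_).congr ?_
    · rw [Store.setInp_inp, C.jump_eq (s := (s.set best []).set pred []) v (by simp [ha]), hm]
      simp
    · simp; omega
    · exact Store.ext_of_reg (fun k => by cases k <;> simp [word]) (by simp) rfl
  · by_cases hv : v ∈ G.sources
    · rw [G.inList_eq_nil_iff.2 hv]
      rw [if_pos hv, ← G.value_of_mem_sources hv] at hm'
      refine Exec.loop_nat 0 (fun _ => _) (fun _ => Nat.zero_le _) (by simp) (by simp) rfl ?_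
      exact Store.ext_of_reg (fun k => by cases k <;> simp [hm', DPDag.firstMax, predReg])
        (by simp) rfl
    · rw [if_neg hv] at hm'
      subst hm'
      obtain ⟨f, hf, hf'⟩ := DPDag.isFirstMax_of_firstMax (G.pairwise_inList v)
        (mt G.inList_eq_nil_iff.1 hv)
      refine Exec.loop_list (G.inList v) (fun d r => ((s.set best (bestReg enc (G.firstMax d))).set
        pred (predReg (G.firstMax d))).setInp ((r.flatMap (G.edgeCode enc)).map some ++
          none :: inputAfter G enc (v + 1))) (fun hs => ?_) (fun d e r hd => ⟨?_, ?_⟩) (by simp)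
          ?_ ?_
      · have := hs.2
        simp only [Store.setInp_inp, List.length_append, List.length_map] at this
        exact (G.length_inList_le enc v).trans (by omega)
      · simp only [List.flatMap_cons, List.map_append, List.append_assoc, Store.view_sym,
          Store.setInp_inp]
        exact head_edgeCode e _
      · have hb : G.firstMax (d ++ [e]) = G.better (G.firstMax d) e := by
          simp [DPDag.firstMax]
        refine (Exec.seq (exec_evalEdge C hp e (rest := (r.flatMap (G.edgeCode enc)).map some ++
          none :: inputAfter G enc (v + 1)) (by simp) (((hs.set rfl _).set rfl _).setInp _)
          (l := l) ⟨hl.nodup, hl.length_le, by simp [hl.tab]⟩ (he e (by simp [← hd])))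
          (exec_updateBest C hp e (G.firstMax d) (by simp) (by simp) (by simp [hs w rfl])
          (by simp [hs arg rfl]) (by simp [hs tmp rfl]) (by simp [hs (sub _) rfl]) (by simp)
          (by simp))).congr ?_
        rw [hb]
        exact Store.ext_of_reg (fun k => by cases k <;> simp [hs u rfl, hs res rfl]) (by simp) rfl
      · exact Store.ext_of_reg (fun k => by
          cases k <;> simp [DPDag.firstMax, bestReg, predReg, word]) (by simp) rfl
      · rw [hf]
        exact Store.ext_of_reg (fun k => by
          cases k <;> simp [bestReg, hf'.value_eq]) (by simp) rfl

end Dag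

end Traceback

/-! ### Sweeping over the vertices -/

namespace DPDag

section Frontier

variable {S : Type} (G : DPDag S)

open Classical in
/-- The vertices `v` with `v < ℓ` that have an edge to a vertex `w` with `ℓ ≤ w`, in decreasing
order.  In terms of the numbers `1, …, T` of the vertices this is the frontier at time `ℓ`. -/
noncomputable def frontList (ℓ : ℕ) : List (Fin G.T) :=
  ((List.finRange G.T).take ℓ).reverse.filter fun v => ∃ e : G.edges, G.src e = v ∧ ℓ ≤ G.tgt e

theorem _root_.List.mem_take_finRange {n ℓ : ℕ} {v : Fin n} :
    v ∈ (List.finRange n).take ℓ ↔ (v : ℕ) < ℓ := by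
  rw [List.mem_take_iff_getElem]
  constructor
  · rintro ⟨i, hi, rfl⟩
    simp only [List.getElem_finRange, Fin.val_cast]
    omega
  · intro h
    exact ⟨v, by simp; omega, by simp⟩

theorem mem_frontList {ℓ : ℕ} {v : Fin G.T} :
    v ∈ G.frontList ℓ ↔ (v : ℕ) < ℓ ∧ ∃ e : G.edges, G.src e = v ∧ ℓ ≤ G.tgt e := by
  rw [frontList, List.mem_filter, List.mem_reverse, List.mem_take_finRange, decide_eq_true_eq]

theorem nodup_frontList (ℓ : ℕ) : (G.frontList ℓ).Nodup :=
  ((List.nodup_reverse.2 ((List.nodup_finRange _).sublist (List.take_sublist _ _)))).filter _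

/-- The size of the table: between the rounds of a sweep it holds at most `G.width` values. -/
theorem length_frontList_le {ℓ : ℕ} (h : ℓ ≤ G.T) : (G.frontList ℓ).length ≤ G.width := by
  classical
  rw [← List.toFinset_card_of_nodup (G.nodup_frontList ℓ)]
  refine le_trans (Finset.card_le_card fun v hv => ?_)
    (Finset.le_sup (f := fun ℓ => (G.front ℓ).card) (Finset.mem_range.2 (Nat.lt_succ_of_le h)))
  obtain ⟨h1, e, h2, h3⟩ := G.mem_frontList.1 (List.mem_toFinset.1 hv)
  exact Finset.mem_filter.2 ⟨Finset.mem_univ _, h1, e, h2, Nat.lt_succ_of_le h3⟩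

open Classical in
/-- In terms of vertices, a round of a sweep adds `v` to the table and prunes the table. -/
theorem frontList_succ (v : Fin G.T) : G.frontList (v + 1) =
    (v :: G.frontList v).filter fun u => ∃ e : G.edges, G.src e = u ∧ (v : ℕ) + 1 ≤ G.tgt e := by
  rw [frontList, List.take_add_one, List.getElem?_eq_getElem (by simp), Option.toList_some,
    List.reverse_append, List.reverse_singleton, List.singleton_append, List.getElem_finRange,
    Fin.cast_mk, Fin.eta, List.filter_cons, List.filter_cons, frontList, List.filter_filter]
  have : ∀ u, decide (∃ e : G.edges, G.src e = u ∧ (v : ℕ) + 1 ≤ G.tgt e) =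
      (decide (∃ e : G.edges, G.src e = u ∧ (v : ℕ) + 1 ≤ G.tgt e) &&
        decide (∃ e : G.edges, G.src e = u ∧ (v : ℕ) ≤ G.tgt e)) := by
    intro u
    rw [Bool.eq_iff_iff, Bool.and_eq_true, decide_eq_true_eq, decide_eq_true_eq]
    exact ⟨fun ⟨e, h1, h2⟩ => ⟨⟨e, h1, h2⟩, e, h1, by omega⟩, fun h => h.1⟩
  simp_rw [← this]

/-- The values needed for the evaluation of `v` are in the table. -/
theorem src_mem_frontList {v : Fin G.T} {e : G.edges} (he : e ∈ G.inList v) :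
    G.src e ∈ G.frontList v := by
  obtain rfl := G.mem_inList.1 he
  exact G.mem_frontList.2 ⟨G.src_lt_tgt e, e, rfl, le_rfl⟩

/-- Whether the value of `u` is still needed after `v` can be read off the later vertices. -/
theorem exists_drop_iff {v u : Fin G.T} :
    (∃ w ∈ (List.finRange G.T).drop (v + 1), ∃ e ∈ G.inList w, u = G.src e) ↔
      ∃ e : G.edges, G.src e = u ∧ (v : ℕ) + 1 ≤ G.tgt e := by
  constructor
  · rintro ⟨w, hw, e, he, rfl⟩
    obtain rfl := G.mem_inList.1 he
    refine ⟨e, rfl, ?_⟩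
    obtain ⟨i, hi, h⟩ := List.mem_drop_iff_getElem.1 hw
    rw [← h]
    simp only [List.getElem_finRange, Fin.val_cast]
    omega
  · rintro ⟨e, rfl, h⟩
    refine ⟨G.tgt e, List.mem_drop_iff_getElem.2 ⟨(G.tgt e : ℕ) - (v + 1), ?_, ?_⟩, e,
      G.mem_inList.2 rfl, rfl⟩
    · simp
      omega
    · refine Fin.ext ?_
      simp only [List.getElem_finRange, Fin.val_cast]
      omega

end Frontier

end DPDag

/-- A loop with an invariant that leaves part of the data open. -/
theorem Prog.Exec.loop_rel {A B K Γ : Type} {E : Env A K Γ} {p : Prog A B K Γ}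
    {c : View A K Γ → Bool} (P : ℕ → Store A B K Γ → Prop) (n : ℕ) (hN : n ≤ E.N)
    {s : Store A B K Γ} (h0 : P 0 s)
    (h1 : ∀ i < n, ∀ s, P i s → c s.view = true ∧ ∃ s', p.Exec E s s' ∧ P (i + 1) s')
    (h2 : ∀ s, P n s → c s.view = false) : ∃ s', (loop c p).Exec E s s' ∧ P n s' := by
  have key : ∀ m i s, i + m = n → P i s → ∃ s', P n s' ∧ (s.Ok E →
      Iter (fun s => c s.view = true) (Run E p) m s s') := by
    intro m
    induction m with
    | zero =>
      intro i s hi hs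
      obtain rfl : i = n := by omega
      exact ⟨s, hs, fun _ => ⟨by simp [h2 s hs], rfl⟩⟩
    | succ m ih =>
      intro i s hi hs
      obtain ⟨hc, s', e, hs'⟩ := h1 i (by omega) s hs
      obtain ⟨s'', h3, h4⟩ := ih (i + 1) s' (by omega) hs'
      exact ⟨s'', h3, fun h => ⟨hc, s', e h, h4 ((e h).ok h)⟩⟩
  obtain ⟨s', h3, h4⟩ := key n 0 s (by omega) h0
  exact ⟨s', fun h => ⟨n, hN, h4 h⟩, h3⟩

namespace Traceback

open Prog StackSym Reg

section Dag

variable {S V K₂ Γ₂ : Type} [MaxSemiring S] {G : DPDag S} {enc : S → List V} {t : Fin G.T}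
  {E : VEnv V K₂ Γ₂} {b h : ℕ} {s : VStore V K₂ Γ₂}

/-- Adds the value `best` of the vertex `addr` to the table. -/
noncomputable def append : VProg V K₂ Γ₂ :=
  push tab .sep ;; copyRev best tab tmp ;; push tab .sep ;; copyRev addr tab tmp

/-- Computes the values of the vertices up to `x`, of which the table holds those that are needed
later, and the witness predecessor `pred` of `x`. -/
noncomputable def sweep (pmul ple : VProg V K₂ Γ₂) : VProg V K₂ Γ₂ :=
  push f₂ .sep ;;
    loop (fun v => (v.top f₂).isSome)
      (increment ;; evalVertex pmul ple ;; append ;;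
        ifEq addr x tmp (clear fun k => decide (k = f₂)) (prune check)) ;;
    clear fun k => decide (k = tab ∨ k = addr ∨ k = best)

theorem exec_append (ht : s.reg tmp = [])
    (hH : (s.reg tab).length + (s.reg best).length + (s.reg addr).length + 2 ≤ E.H) :
    (append : VProg V K₂ Γ₂).Exec E s
      (s.set tab (entry (s.reg addr, s.reg best) ++ s.reg tab)) := by
  refine ((exec_push tab StackSym.sep (by omega)).seq
    ((exec_copyRev (by simp) (by simp) (by simp) (by simp [ht]) (by simp; omega)).seq
    ((exec_push tab StackSym.sep (by simp; omega)).seq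
    (exec_copyRev (by simp) (by simp) (by simp) (by simp [ht]) (by simp; omega))))).congr ?_
  exact Store.ext_of_reg (fun k => by cases k <;> simp [entry]) (by simp) rfl

/-- Pruning after the evaluation of `v` leaves the values of the next frontier in the table. -/
theorem exec_pruneTable (C : Ctx G enc t E b h) (v : Fin G.T)
    (ha : s.reg addr = num ((v : ℕ) + 1)) (hs : Clean s)
    (ht : s.reg tab = table ((v :: G.frontList v).map (valueEntry enc))) :
    ∃ i, (prune check).Exec E s ((s.set tab (table ((G.frontList (v + 1)).map
      (valueEntry enc)))).setInp i) := by
  classical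
  have hlen : (v :: G.frontList v).length ≤ G.width + 1 :=
    Nat.succ_le_succ (G.length_frontList_le v.isLt.le)
  obtain ⟨i, hi⟩ := exec_prune (E := E) (s := s) (check := check)
    (l := (v :: G.frontList v).map (valueEntry enc)) (fun p => isEntry_of_mem) ht
    (hs tab' rfl) (hs e₁ rfl) (hs e₂ rfl) (hs keep rfl)
    ((Nat.le_add_right _ _).trans (Ctx.length_table_le_height C hlen))
    (fun p => decide (∃ w ∈ (List.finRange G.T).drop (v + 1), ∃ e ∈ G.inList w,
      p.1 = num ((G.src e : ℕ) + 1))) fun p _ s' h1 h2 => by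
        refine (exec_check C v ?_ ?_ ?_ ?_).congr ?_
        · rw [h2 _ (by simp), ha]
        · rw [h2 _ (by simp), hs _ rfl]
        · rw [h2 _ (by simp), hs _ rfl]
        · rw [h2 _ (by simp), hs _ rfl]
        · simp only [h1, decide_eq_true_eq]
  refine ⟨i, hi.congr ?_⟩
  rw [List.filter_map, G.frontList_succ v]
  congr 4
  refine List.filter_congr fun u _ => ?_
  rw [Function.comp_apply, Bool.eq_iff_iff, decide_eq_true_eq, decide_eq_true_eq,
    ← G.exists_drop_iff]
  have : ∀ w : Fin G.T, ((valueEntry enc u).1 : List (StackSym V Γ₂)) = num ((w : ℕ) + 1) ↔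
      u = w := by
    refine fun w => ⟨fun hw => ?_, fun hw => hw ▸ rfl⟩
    have := num_injective hw
    exact Fin.ext (by omega)
  simp only [this]

/-- A sweep determines the witness predecessor of `v`; of the other data it only changes the
position of the input head. -/
theorem exec_sweep (C : Ctx G enc t E b h) {pmul ple : VProg V K₂ Γ₂}
    (hp : IsArith G enc E pmul ple) (v : Fin G.T) (hx : s.reg x = num ((v : ℕ) + 1))
    (hs : Clean s) (ha : s.reg addr = []) (ht : s.reg tab = []) (hb : s.reg best = [])
    (hf : s.reg f₂ = []) :
    ∃ i, (sweep pmul ple).Exec E s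
      ((s.set pred (predReg (G.firstMax (G.inList v)))).setInp i) := by
  have h6 := C.le_height
  have hv := v.isLt
  have key : ∃ s', (loop (fun v => (v.top f₂).isSome) (increment ;; evalVertex pmul ple ;;
      append ;; ifEq addr x tmp (clear fun k => decide (k = f₂)) (prune check))).Exec E
        (s.set f₂ [.sep]) s' ∧ ∃ I B R F U, s' = (((((s.set addr (num (v + 1))).set tab U).set best
          B).set pred R).set f₂ F).setInp I ∧ ((v : ℕ) + 1 ≤ v → F = [.sep] ∧ U = table
          ((G.frontList (v + 1)).map (valueEntry enc))) ∧ ((v : ℕ) + 1 = v + 1 → F = [] ∧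
          R = predReg (G.firstMax (G.inList v))) := by
    refine Exec.loop_rel
      (fun i s' => ∃ I B R F U, s' = (((((s.set addr (num i)).set tab U).set best B).set pred
        R).set f₂ F).setInp I ∧ (i ≤ v → F = [.sep] ∧ U = table ((G.frontList i).map
          (valueEntry enc))) ∧ (i = v + 1 → F = [] ∧ R = predReg (G.firstMax (G.inList v))))
      (v + 1) (by have := C.rounds; omega) ⟨s.inp, [], s.reg pred, [.sep], [], ?_, ?_, by simp⟩ ?_
      ?_
    · exact Store.ext_of_reg (fun k => by cases k <;> simp [ha, ht, hb, num]) (by simp) rfl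
    · simp [DPDag.frontList, table]
    · rintro i hi s' ⟨I, B, R, F, U, rfl, hF, -⟩
      obtain ⟨rfl, rfl⟩ := hF (by omega)
      obtain ⟨w, rfl⟩ : ∃ w : Fin G.T, (w : ℕ) = i := ⟨⟨i, by omega⟩, rfl⟩
      have hlen : (w :: G.frontList w).length ≤ G.width + 1 :=
        Nat.succ_le_succ (G.length_frontList_le w.isLt.le)
      have hH := Ctx.length_table_le_height (Γ₂ := Γ₂) C hlen
      rw [List.map_cons, length_entry_append, length_entry] at hH
      refine ⟨by simp, ?_⟩
      set m : VStore V K₂ Γ₂ := (((((s.set addr (num ((w : ℕ) + 1))).set tab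
        (table ((w :: G.frontList w).map (valueEntry enc)))).set best (word (enc (G.value w)))).set
          pred (predReg (G.firstMax (G.inList w)))).set f₂ [.sep]).setInp
            (none :: inputAfter G enc (w + 1)) with hm
      have hclean : ∀ a b c d e (i : List (Option (InSym V))), Clean ((((((s.set addr a).set tab
          b).set best c).set pred d).set f₂ e).setInp i) := fun a b c d e i =>
        (((((hs.set rfl a).set rfl b).set rfl c).set rfl d).set rfl e).setInp i
      have e1 : (increment ;; evalVertex pmul ple ;; append : VProg V K₂ Γ₂).Exec E
          ((((((s.set addr (num (w : ℕ))).set tab (table ((G.frontList w).map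
            (valueEntry enc)))).set best B).set pred R).set f₂ [.sep]).setInp I) m := by
        refine (exec_increment (n := w) (by simp) (by simp [hs tmp rfl]) ?_).seq
          ((exec_evalVertex C hp w (l := G.frontList w) (by simp) ((hclean _ _ _ _ _ _).set rfl _)
          ⟨G.nodup_frontList w, by simp at hlen; omega, by simp⟩
          fun e he => G.src_mem_frontList he).seq
          ((exec_append (by simp [hs tmp rfl]) ?_).congr ?_))
        · have := C.bits_le ((w : ℕ) + 1) w.isLt
          have := C.le_h
          omega
        · simp [valueEntry] at hH ⊢
          omega
        · exact Store.ext_of_reg (fun k => by cases k <;> simp [hm, table, valueEntry])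
            (by simp [hm]) rfl
      have e1' : ∀ s',
          (ifEq addr x tmp (clear fun k => decide (k = f₂)) (prune check)).Exec E m s' →
          (increment ;; evalVertex pmul ple ;; append ;; ifEq addr x tmp
            (clear fun k => decide (k = f₂)) (prune check) : VProg V K₂ Γ₂).Exec E
          ((((((s.set addr (num (w : ℕ))).set tab (table ((G.frontList w).map
            (valueEntry enc)))).set best B).set pred R).set f₂ [.sep]).setInp I) s' := by
        intro s' h4 h5
        obtain ⟨m1, r1, m2, r2, r3⟩ := e1 h5
        exact ⟨m1, r1, m2, r2, m, r3, h4 ((r3.ok (r2.ok (r1.ok h5))))⟩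
      by_cases hwv : w = v
      · subst hwv
        refine ⟨m.set f₂ [], e1' _ (exec_ifEq (by simp) (by simp) (by simp)
          (by simp [hm, hs tmp rfl]) (fun _ => exec_clear_one f₂)
          fun hne => absurd (by simp [hm, hx]) hne),
          _, word (enc (G.value w)), predReg (G.firstMax (G.inList w)), [],
          table ((w :: G.frontList w).map (valueEntry enc)),
          Store.ext_of_reg (fun k => ?_) rfl rfl, fun h => by omega, fun _ => ⟨rfl, rfl⟩⟩
        cases k <;> simp [hm]
      · have hne : (w : ℕ) ≠ v := fun h => hwv (Fin.ext h)
        obtain ⟨j, hj⟩ := exec_pruneTable C w (s := m) (by simp [hm]) (hclean _ _ _ _ _ _)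
          (by simp [hm])
        refine ⟨_, e1' _ (exec_ifEq (by simp) (by simp) (by simp) (by simp [hm, hs tmp rfl])
          (fun heq => ?_) fun _ => hj), j, word (enc (G.value w)),
          predReg (G.firstMax (G.inList w)), [.sep],
          table ((G.frontList (w + 1)).map (valueEntry enc)),
          Store.ext_of_reg (fun k => ?_) rfl rfl, fun _ => ⟨rfl, rfl⟩, fun h => by omega⟩
        · simp only [hm, hx, Store.setInp_reg, Store.set_reg_self, ne_eq, reduceCtorEq,
            not_false_eq_true, Store.set_reg_ne] at heq
          have := num_injective heq
          omega
        cases k <;> simp [hm]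
    · rintro s' ⟨I, B, R, F, U, rfl, -, hF⟩
      simp [(hF rfl).1]
  obtain ⟨s', h1, I, B, R, F, U, h2, -, h3⟩ := key
  refine ⟨I, Exec.seq ((exec_push f₂ StackSym.sep (by simp [hf]; omega)).congr (by rw [hf]))
    (h1.seq ((exec_clear _).congr ?_))⟩
  rw [h2, (h3 rfl).1, (h3 rfl).2]
  exact Store.ext_of_reg (fun k => by cases k <;> simp [ha, ht, hb, hf]) (by simp) rfl

end Dag

end Traceback

/-! ### Following the witness path -/

namespace Traceback

open Prog StackSym Reg

section Dag

variable {S V K₂ Γ₂ : Type} [MaxSemiring S] {G : DPDag S} {enc : S → List V} {t : Fin G.T}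
  {E : VEnv V K₂ Γ₂} {b h : ℕ} {s : VStore V K₂ Γ₂}

def isBit : InSym V → Bool
  | .bit _ => true
  | _ => false

/-- Replaces `x` by its witness predecessor until that is `last`, or until there is none if `last`
is empty. -/
noncomputable def descend (pmul ple : VProg V K₂ Γ₂) : VProg V K₂ Γ₂ :=
  push f₁ .sep ;;
    loop (fun v => (v.top f₁).isSome)
      (sweep pmul ple ;;
        ifEq pred last tmp (clear fun k => decide (k = f₁ ∨ k = pred))
          ((clear fun k => decide (k = x)) ;; move pred tmp ;; move tmp x))

/-- Writes the vertex of the witness path that follows `last`. -/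
noncomputable def outputNext (pmul ple : VProg V K₂ Γ₂) : VProg V K₂ Γ₂ :=
  copy goal x tmp ;; descend pmul ple ;; (clear fun k => decide (k = last)) ;; copy x last tmp ;;
    ifEq x goal tmp (clear fun k => decide (k = f₀)) skip ;; move x tmp ;; emitAll tmp toOut ;;
    emit none

/-- Writes the witness path to the target vertex in the header.  The path itself is not stored: each
of its vertices is found anew from the target. -/
noncomputable def traceback (pmul ple : VProg V K₂ Γ₂) : VProg V K₂ Γ₂ :=
  skipWhile isBit ;; next ;; readWhile ofBit goal ;; push f₀ .sep ;;
    loop (fun v => (v.top f₀).isSome) (outputNext pmul ple)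

/-- The vertices `c 0, …, c k` form the witness path to `t`, in terms of the edges that the program
selects. -/
structure IsRoute (G : DPDag S) (t : Fin G.T) (c : ℕ → Fin G.T) (k : ℕ) : Prop where
  last : c k = t
  zero : G.firstMax (G.inList (c 0)) = none
  succ : ∀ j < k, ∃ e, G.firstMax (G.inList (c (j + 1))) = some e ∧ G.src e = c j
  inj : ∀ i ≤ k, ∀ j ≤ k, c i = c j → i = j

/-- The predecessor of the vertex number `j` on a path, on a stack. -/
def prevReg (c : ℕ → Fin G.T) : ℕ → List (StackSym V Γ₂)
  | 0 => []
  | j + 1 => num ((c j : ℕ) + 1)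

variable {c : ℕ → Fin G.T} {k : ℕ}

/-- What a sweep for the vertex number `j` of the path leaves on the stack `pred`. -/
theorem IsRoute.predReg_eq (hc : IsRoute G t c k) {j : ℕ} (hj : j ≤ k) :
    (predReg (G.firstMax (G.inList (c j))) : List (StackSym V Γ₂)) = prevReg c j := by
  cases j with
  | zero => rw [hc.zero]; rfl
  | succ j =>
    obtain ⟨e, h1, h2⟩ := hc.succ j hj
    rw [h1, prevReg, ← h2]
    rfl

theorem IsRoute.prevReg_inj (hc : IsRoute G t c k) {i j : ℕ} (hi : i ≤ k) (hj : j ≤ k)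
    (h : (prevReg c i : List (StackSym V Γ₂)) = prevReg c j) : i = j := by
  cases i with
  | zero =>
    cases j with
    | zero => rfl
    | succ j => exact absurd (num_eq_nil.1 h.symm) (by simp)
  | succ i =>
    cases j with
    | zero => exact absurd (num_eq_nil.1 h) (by simp)
    | succ j =>
      have := num_injective h
      rw [hc.inj i (by omega) j (by omega) (Fin.ext (by omega))]

theorem IsRoute.lt (hc : IsRoute G t c k) : k < G.T := by
  have := Fintype.card_le_of_injective (fun i : Fin (k + 1) => c i) fun i j h =>
    Fin.ext (hc.inj i (by omega) j (by omega) h)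
  simpa using this

/-- If `last` is the vertex number `i - 1` of the path, then the descent from the target ends at the
vertex number `i`. -/
theorem exec_descend (C : Ctx G enc t E b h) {pmul ple : VProg V K₂ Γ₂}
    (hp : IsArith G enc E pmul ple) (hc : IsRoute G t c k) {i : ℕ} (hi : i ≤ k) (hs : Clean s)
    (hx : s.reg x = num ((t : ℕ) + 1)) (hl : s.reg last = prevReg c i) (ha : s.reg addr = [])
    (ht : s.reg tab = []) (hb : s.reg best = []) (hf : s.reg f₂ = []) (hf' : s.reg f₁ = [])
    (hpr : s.reg pred = []) :
    ∃ I, (descend pmul ple).Exec E s ((s.set x (num ((c i : ℕ) + 1))).setInp I) := by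
  have h6 := C.le_height
  have hbits := fun v => (C.indexBits_le v)
  have key : ∃ s', (loop (fun v => (v.top f₁).isSome) (sweep pmul ple ;;
      ifEq pred last tmp (clear fun k => decide (k = f₁ ∨ k = pred))
        ((clear fun k => decide (k = x)) ;; move pred tmp ;; move tmp x))).Exec E
      (s.set f₁ [.sep]) s' ∧ ∃ I X F, s' = ((s.set x X).set f₁ F).setInp I ∧
        (k - i + 1 ≤ k - i → X = num ((c (k - (k - i + 1)) : ℕ) + 1) ∧ F = [.sep]) ∧
        (k - i + 1 = k - i + 1 → X = num ((c i : ℕ) + 1) ∧ F = []) := by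
    refine Exec.loop_rel (fun m s' => ∃ I X F, s' = ((s.set x X).set f₁ F).setInp I ∧
        (m ≤ k - i → X = num ((c (k - m) : ℕ) + 1) ∧ F = [.sep]) ∧
        (m = k - i + 1 → X = num ((c i : ℕ) + 1) ∧ F = [])) (k - i + 1)
      (by have := C.rounds; have := hc.lt; omega) ⟨s.inp, s.reg x, [.sep], ?_, ?_, by simp⟩ ?_ ?_
    · exact Store.ext_of_reg (fun k => by cases k <;> simp) (by simp) rfl
    · intro _
      simp [hx, hc.last]
    · rintro m hm s' ⟨I, X, F, rfl, hF, -⟩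
      obtain ⟨rfl, rfl⟩ := hF (by omega)
      obtain ⟨j, hj⟩ : ∃ j, k - m = j := ⟨_, rfl⟩
      rw [hj]
      have hjk : j ≤ k := by omega
      obtain ⟨J, e1⟩ := exec_sweep C hp (c j) (s := ((s.set x (num ((c j : ℕ) + 1))).set f₁
        [.sep]).setInp I) (by simp) (((hs.set rfl _).set rfl _).setInp _) (by simp [ha])
        (by simp [ht]) (by simp [hb]) (by simp [hf])
      rw [hc.predReg_eq hjk] at e1
      by_cases hji : j = i
      · subst hji
        refine ⟨by simp, _, e1.seq (exec_ifEq (by simp) (by simp) (by simp) (by simp [hs tmp rfl])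
          (fun _ => exec_clear_two f₁ pred) fun hne => absurd (by simp [hl]) hne), J,
          num ((c j : ℕ) + 1), [], Store.ext_of_reg (fun k => ?_) rfl rfl, fun h => by omega,
          fun _ => ⟨rfl, rfl⟩⟩
        cases k <;> simp [hpr]
      · obtain ⟨l, rfl⟩ : ∃ l, j = l + 1 := ⟨j - 1, by omega⟩
        have hlen : (num ((c l : ℕ) + 1) : List (StackSym V Γ₂)).length ≤ E.H := by
          have := hbits (c l)
          rw [length_num]
          exact this.trans (by omega)
        refine ⟨by simp, _, e1.seq (exec_ifEq (by simp) (by simp) (by simp) (by simp [hs tmp rfl])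
          (fun heq => ?_) fun _ => (exec_clear_one x).seq ((exec_move (by simp) ?_).seq
            (exec_move (by simp) ?_))), J,
          num ((c l : ℕ) + 1), [.sep], Store.ext_of_reg (fun k => ?_) rfl rfl,
          fun h => ⟨?_, rfl⟩, fun h => by omega⟩
        · simp only [hl, Store.setInp_reg, Store.set_reg_self, ne_eq, reduceCtorEq,
            not_false_eq_true, Store.set_reg_ne] at heq
          exact absurd (hc.prevReg_inj hjk hi heq) hji
        · simpa [hs tmp rfl, prevReg] using hlen
        · simpa [hs tmp rfl, prevReg] using hlen
        · cases k <;> simp [hpr, hs tmp rfl, prevReg]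
        · rw [show k - (m + 1) = l by omega]
    · rintro s' ⟨I, X, F, rfl, -, hF⟩
      simp [(hF rfl).2]
  obtain ⟨s', h1, I, X, F, h2, -, h3⟩ := key
  refine ⟨I, Exec.seq ((exec_push f₁ StackSym.sep (by simp [hf']; omega)).congr (by rw [hf']))
    (h1.congr ?_)⟩
  rw [h2, (h3 rfl).1, (h3 rfl).2]
  exact Store.ext_of_reg (fun k => by cases k <;> simp [hf']) (by simp) rfl

theorem filterMap_toOut_num (n : ℕ) :
    ((num n : List (StackSym V Γ₂)).filterMap toOut).reverse = n.bits.map some := by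
  rw [← List.filterMap_reverse]
  simp [num, List.filterMap_map, Function.comp_def, toOut]

/-- The round for the vertex number `i` of the path; the last one is recognized by its equality with
the target. -/
theorem exec_outputNext (C : Ctx G enc t E b h) {pmul ple : VProg V K₂ Γ₂}
    (hp : IsArith G enc E pmul ple) (hc : IsRoute G t c k) {i : ℕ} (hi : i ≤ k) (hs : Clean s)
    (hx : s.reg x = []) (hg : s.reg goal = num ((t : ℕ) + 1)) (hl : s.reg last = prevReg c i)
    (ha : s.reg addr = []) (ht : s.reg tab = []) (hb : s.reg best = []) (hf : s.reg f₂ = [])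
    (hf' : s.reg f₁ = []) (hpr : s.reg pred = []) :
    ∃ I, (outputNext pmul ple).Exec E s ((((s.set last (prevReg c (i + 1))).set f₀
      (if i = k then [] else s.reg f₀)).setInp I).write (G.pathCode [c i])) := by
  have h6 := C.le_height
  have hlen : ∀ v : Fin G.T, (num ((v : ℕ) + 1) : List (StackSym V Γ₂)).length ≤ E.H := by
    intro v
    have := C.indexBits_le v
    rw [length_num]
    exact this.trans (by omega)
  obtain ⟨I, e1⟩ := exec_descend C hp hc hi (s := s.set x (num ((t : ℕ) + 1))) (hs.set rfl _)
    (by simp) (by simp [hl]) (by simp [ha]) (by simp [ht]) (by simp [hb]) (by simp [hf])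
    (by simp [hf']) (by simp [hpr])
  have e2 := e1.seq ((exec_clear_one last).seq (Exec.seq (exec_copy (a := x) (b := last) (t := tmp)
    (by simp) (by simp) (by simp) (by simp [hs tmp rfl]) (by simpa using hlen _))
    (Exec.seq (m := (((s.set x (num ((c i : ℕ) + 1))).set last (num ((c i : ℕ) + 1))).set f₀
      (if i = k then [] else s.reg f₀)).setInp I)
      (q := move x tmp ;; emitAll tmp toOut ;; emit none)
      (exec_ifEq (a := x) (b := goal) (t := tmp) (p := clear fun k => decide (k = f₀)) (q := skip)
      (by simp) (by simp) (by simp) (by simp [hs tmp rfl])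
      (fun heq => (exec_clear_one f₀).congr ?_) fun hne => exec_skip.congr ?_)
    ((exec_move (by simp) (by simpa [hs tmp rfl] using hlen _)).seq
      (exec_emitAll.seq ((exec_emit none).congr rfl))))))
  · refine ⟨I, ((exec_copy (by simp) (by simp) (by simp) (by simp [hs tmp rfl])
      (by simpa [hg, hx] using hlen t)).congr (by simp [hg, hx])).seq (e2.congr ?_)⟩
    refine Store.ext_of_reg (fun k => ?_) (by simp) ?_
    · cases k <;> simp [hx, hs tmp rfl, prevReg]
    · simp [hs tmp rfl, filterMap_toOut_num, DPDag.pathCode, DPDag.indexBits]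
  · simp only [hg, Store.setInp_reg, Store.set_reg_self, ne_eq, reduceCtorEq, not_false_eq_true,
      Store.set_reg_ne] at heq
    have := num_injective heq
    have hik : i = k := hc.inj i hi k le_rfl (Fin.ext (by rw [hc.last]; omega))
    exact Store.ext_of_reg (fun k => by cases k <;> simp [hik]) (by simp) rfl
  · have hik : i ≠ k := by
      rintro rfl
      simp [hg, hc.last] at hne
    exact Store.ext_of_reg (fun k => by cases k <;> simp [hik]) (by simp) rfl

/-- The program writes the witness path. -/
theorem exec_traceback (C : Ctx G enc t E b h) {pmul ple : VProg V K₂ Γ₂}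
    (hp : IsArith G enc E pmul ple) (hc : IsRoute G t c k) :
    ∃ s', (traceback pmul ple).Exec E (Store.start E.bs) s' ∧
      s'.out = G.pathCode ((List.range (k + 1)).map c) := by
  have h6 := C.le_height
  set rest := inputTape ((List.finRange G.T).map (G.vertexCode enc)) with hrest
  set s₀ : VStore V K₂ Γ₂ := ((Store.start E.bs).set goal (num ((t : ℕ) + 1))).setInp
    (none :: rest) with hs₀
  have hreg : ∀ k, (Store.start E.bs : VStore V K₂ Γ₂).reg k = [] := fun _ => rfl
  have hbs : (Store.start E.bs : VStore V K₂ Γ₂).inp = (G.T.bits.map InSym.bit).map some ++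
      some .sep :: (((G.indexBits t).map InSym.bit).map some ++ none :: rest) := by
    simp [Store.start, C.bs, DPDag.instanceCode, inputTape_cons, hrest]
  have hclean : Clean (Store.start E.bs : VStore V K₂ Γ₂) := fun k _ => rfl
  have key : ∃ s', (loop (fun v => (v.top f₀).isSome) (outputNext pmul ple)).Exec E
      (s₀.set f₀ [.sep]) s' ∧ ∃ I F, s' = (((s₀.set last (prevReg c (k + 1))).set f₀
        F).setInp I).write (G.pathCode ((List.range (k + 1)).map c)) ∧
          F = if k + 1 ≤ k then [.sep] else [] := by
    refine Exec.loop_rel (fun i s' => ∃ I F, s' = (((s₀.set last (prevReg c i)).set f₀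
        F).setInp I).write (G.pathCode ((List.range i).map c)) ∧
          F = if i ≤ k then [.sep] else []) (k + 1)
      (by have := C.rounds; have := hc.lt; omega) ⟨none :: rest, [.sep], ?_, by simp⟩ ?_ ?_
    · exact Store.ext_of_reg (fun k => by cases k <;> simp [hs₀, hreg, prevReg]) (by simp [hs₀])
        (by simp [DPDag.pathCode])
    · rintro i hi s' ⟨I, F, rfl, rfl⟩
      obtain ⟨J, e⟩ := exec_outputNext C hp hc (i := i) (s := (((s₀.set last (prevReg c i)).set f₀
        (if i ≤ k then [.sep] else [])).setInp I).write (G.pathCode ((List.range i).map c)))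
        (by omega) ((((hclean.set rfl _).set rfl _).set rfl _)) (by simp [hs₀, hreg])
        (by simp [hs₀]) (by simp) (by simp [hs₀, hreg]) (by simp [hs₀, hreg])
        (by simp [hs₀, hreg]) (by simp [hs₀, hreg]) (by simp [hs₀, hreg]) (by simp [hs₀, hreg])
      refine ⟨by simp [show i ≤ k by omega], _, e, J, _, Store.ext_of_reg (fun k => ?_) rfl ?_, rfl⟩
      · cases k <;> simp [hs₀, hreg]
        split_ifs <;> first | rfl | omega
      · simp [List.range_succ, DPDag.pathCode]
    · rintro s' ⟨I, F, rfl, rfl⟩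
      simp
  obtain ⟨s', e, I, F, rfl, -⟩ := key
  refine ⟨_, Exec.seq (exec_skipWhile _ ?_ hbs rfl) (exec_next.seq (Exec.seq (m := s₀) ?_
    (((exec_push f₀ StackSym.sep ?_).congr (by simp [hs₀, hreg])).seq e))), ?_⟩
  · intro y hy
    obtain ⟨g, -, rfl⟩ := List.mem_map.1 hy
    rfl
  · refine (exec_readWhile (G.indexBits t) InSym.bit StackSym.bit (fun _ => rfl)
      (rest := none :: rest) rfl rfl ?_).congr ?_
    · have := C.indexBits_le t
      simp [hreg]
      omega
    · exact Store.ext_of_reg (fun k => by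
        cases k <;> simp [hs₀, hreg, num, DPDag.indexBits]) (by simp [hs₀]) rfl
  · simp [hs₀, hreg]
    omega
  · simp [hs₀, Store.start]

end Dag

end Traceback

/-! ### Subroutines for products and comparisons -/

theorem Machine.length_out_le {A B : Type} (M : Machine A B) (bs : List (List A)) (n : ℕ) :
    (M.conf bs n).out.length ≤ n := by
  induction n with
  | zero => exact le_rfl
  | succ n ih =>
    rw [Machine.conf, Function.iterate_succ_apply', ← Machine.conf, Machine.step]
    cases M.action bs (M.conf bs n) with
    | none => exact ih.trans n.le_succ
    | some a =>
      have : a.emit.toList.length ≤ 1 := by cases a.emit <;> simp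
      simp only [Machine.perform, List.length_append]
      omega

/-- A time bound is also a bound on the length of the output.  In this way the time for a product
bounds the length of its code. -/
theorem Machine.HaltsWithin.length_le {A B : Type} {M : Machine A B} {bs : List (List A)}
    {o : List B} {t sp : ℕ} (h : M.HaltsWithin bs o t sp) : o.length ≤ t := by
  obtain ⟨n, hn, -, rfl, -⟩ := h
  exact (M.length_out_le bs n).trans hn

namespace Traceback

open Prog Reg
open StackSym hiding sub

/-- A representation of a machine whose input alphabet is that of the codes of values.  The states
and symbols of the machine are represented by the additional symbols of the program. -/
noncomputable def codeOf {V B : Type} (M : Machine V B) {Γ₂ : Type} (i : M.State ⊕ M.Sym → Γ₂)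
    (hi : i.Injective) (em : B → StackSym V Γ₂) : SimCode M (StackSym V Γ₂) where
  st q := .sub (i (.inl q))
  unst
    | .sub g => haveI : Nonempty (M.State ⊕ M.Sym) := ⟨.inl M.start⟩
        (Function.invFun i g).elim id fun _ => M.start
    | _ => M.start
  unst_st q := by
    have : Nonempty (M.State ⊕ M.Sym) := ⟨.inl M.start⟩
    simp [Function.leftInverse_invFun hi _]
  sy x := .sub (i (.inr x))
  unsy
    | .sub g => haveI : Nonempty (M.State ⊕ M.Sym) := ⟨.inl M.start⟩
        (Function.invFun i g).elim (fun _ => M.blank) id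
    | _ => M.blank
  unsy_sy x := by
    have : Nonempty (M.State ⊕ M.Sym) := ⟨.inl M.start⟩
    simp [Function.leftInverse_invFun hi _]
  inp x := x.elim .sep .val
  uninp
    | .val g => some g
    | _ => none
  uninp_inp x := by cases x <;> rfl
  em := em
  one := .bit true
  big := .bit false
  one_ne_big := by simp

variable {A B V K₂ Γ₂ : Type}

/-- Runs a machine on the input on the stack `arg` and leaves its output on the stack `res`. -/
noncomputable def call {B' : Type} {M : Machine V B'} (D : SimCode M (StackSym V Γ₂))
    (ι : SimReg M.Tp → K₂) : TProg A B V K₂ Γ₂ :=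
  move arg tmp ;; move tmp (sub (ι .inR)) ;; D.simulate.lift (fun k => sub (ι k)) ;;
    move (sub (ι .out)) tmp ;; move tmp res

/-- A machine that maps two words to `o` is turned into a subroutine. -/
theorem exec_call {E : TEnv A V K₂ Γ₂} {s : TStore A B V K₂ Γ₂} {B' : Type} {M : Machine V B'}
    (D : SimCode M (StackSym V Γ₂)) {ι : SimReg M.Tp → K₂} (hι : ι.Injective) {x y : List V}
    {o : List B'} {t sp : ℕ} (hM : M.HaltsWithin [x, y] o t sp) (ht : t + 1 ≤ E.H)
    (hl : (inputTape [x, y]).length ≤ E.H) (ha : s.reg arg = (inputTape [x, y]).map D.inp)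
    (hr : s.reg res = []) (ht' : s.reg tmp = []) (hs : ∀ k, s.reg (sub k) = []) :
    (call D ι).Exec E s ((s.set arg []).set res (o.map D.em).reverse) := by
  have ho := hM.length_le
  have hι' : Function.Injective fun k => (sub (ι k) : Reg K₂) := fun a b h => hι (by simpa using h)
  let E' : Env Empty (SimReg M.Tp) (StackSym V Γ₂) :=
    ⟨[], .inR, fun _ => false, E.N, E.H, E.height_le, by simp [inputTape]⟩
  let s₁ : Store Empty Empty (SimReg M.Tp) (StackSym V Γ₂) :=
    ⟨fun k => if k = .inR then (inputTape [x, y]).map D.inp else [], [], []⟩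
  obtain ⟨s₂, h1, h2⟩ := D.exec_simulate (E := E') hM ht hl s₁ fun _ => rfl
  set m := (s.set arg []).set (sub (ι .inR)) ((inputTape [x, y]).map D.inp) with hm
  have hm₁ : m.place (fun k => sub (ι k)) s₁.reg = m := by
    refine Store.ext_of_reg (fun k => ?_) rfl rfl
    by_cases hk : ∃ j, sub (ι j) = k
    · obtain ⟨j, rfl⟩ := hk
      simp only [Store.place]
      rw [hι'.extend_apply]
      by_cases hj : j = .inR
      · subst hj; simp [s₁, hm]
      · have : sub (ι j) ≠ sub (ι SimReg.inR) := fun h => hj (hι' h)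
        simp [s₁, hm, hj, this, hs]
    · simp only [Store.place]
      rw [Function.extend_apply' _ _ _ hk]
  have hm₂ : m.place (fun k => sub (ι k)) s₂.reg =
      (s.set arg []).set (sub (ι .out)) (o.map D.em).reverse := by
    refine Store.ext_of_reg (fun k => ?_) (by simp [Store.place, hm]) (by simp [Store.place, hm])
    by_cases hk : ∃ j, sub (ι j) = k
    · obtain ⟨j, rfl⟩ := hk
      simp only [Store.place]
      rw [hι'.extend_apply, h2]
      by_cases hj : j = .out
      · subst hj; simp
      · have : sub (ι j) ≠ sub (ι SimReg.out) := fun h => hj (hι' h)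
        simp [hj, this, hs]
    · simp only [Store.place]
      have hne : ∀ j, k ≠ sub (ι j) := fun j h => hk ⟨j, h.symm⟩
      rw [Function.extend_apply' _ _ _ hk, hm, Store.set_reg_ne _ _ (hne _),
        Store.set_reg_ne _ _ (hne _)]
  refine Exec.seq (m := (s.set arg []).set tmp ((inputTape [x, y]).map D.inp).reverse)
    ((exec_move (by simp) (by simpa [ha, ht'] using hl)).congr (by rw [ha, ht', List.append_nil]))
    (Exec.seq (m := m) ((exec_move (by simp) (by simpa [hs] using hl)).congr ?_)
    (Exec.seq (m := (s.set arg []).set (sub (ι .out)) (o.map D.em).reverse) ?_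
    (((exec_move (by simp) (by simp [ht']; omega)).seq (exec_move (by simp)
      (by simp [hr, ht']; omega))).congr ?_)))
  · refine Store.ext_of_reg (fun k => ?_) rfl rfl
    by_cases hk : k = sub (ι .inR)
    · subst hk; simp [hm, hs]
    · by_cases hk' : k = tmp
      · subst hk'; simp [hm, ht']
      · simp [hm, hk, hk']
  · intro h
    have := Run.lift (E := E) hι' (E' := E') rfl rfl (h1 ⟨fun k => ?_, Nat.zero_le _⟩) m h.1
    · rwa [hm₁, hm₂] at this
    · simp only [s₁]
      split_ifs
      · simpa using hl
      · exact Nat.zero_le _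
  · refine Store.ext_of_reg (fun k => ?_) (by simp) rfl
    by_cases hk : k = sub (ι .out)
    · subst hk; simp [hs]
    · cases k with
      | sub k =>
        have : k ≠ ι .out := fun h => hk (by rw [h])
        simp [this]
      | _ => simp [hr, ht']

section Arith

variable {S : Type} [MaxSemiring S] {G : DPDag S} {enc : S → List V}

theorem inputTape_eq_twoWords {B' : Type} (M : Machine V B') (i : M.State ⊕ M.Sym → Γ₂)
    (hi : i.Injective) (em : B' → StackSym V Γ₂) (a b : List V) :
    (inputTape [a, b]).map (codeOf M i hi em).inp = twoWords a b := by
  simp [inputTape, twoWords, codeOf, Function.comp_def]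

/-- The machines `Mm` for products and `Ml` for comparisons, called as subroutines, provide the
arithmetic for the evaluation of `G`. -/
theorem isArith_call {E : VEnv V K₂ Γ₂} {Mm : Machine V V} {Ml : Machine V Bool}
    {ιm : SimReg Mm.Tp → K₂} (hιm : ιm.Injective) {ιl : SimReg Ml.Tp → K₂} (hιl : ιl.Injective)
    {im : Mm.State ⊕ Mm.Sym → Γ₂} (him : im.Injective) {il : Ml.State ⊕ Ml.Sym → Γ₂}
    (hil : il.Injective) {h t₁ t₂ : ℕ}
    (hm : ∀ e, Mm.HaltsWithin [enc (G.value (G.src e)), enc (G.weight e)] (enc (G.edgeValue e))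
      t₁ t₁)
    (hl : ∀ e f, Ml.HaltsWithin [enc (G.edgeValue e), enc (G.edgeValue f)]
      [decide (G.edgeValue e ≤ G.edgeValue f)] t₂ t₂)
    (h₁ : ∀ v, (enc (G.value v)).length ≤ h) (h₂ : ∀ e, (enc (G.weight e)).length ≤ h)
    (h₃ : ∀ e, (enc (G.edgeValue e)).length ≤ h) (ht₁ : t₁ + 1 ≤ E.H) (ht₂ : t₂ + 1 ≤ E.H)
    (hH : 2 * h + 2 ≤ E.H) :
    IsArith G enc E (call (codeOf Mm im him .val) ιm) (call (codeOf Ml il hil .bit) ιl) := by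
  refine ⟨fun e s ha hr ht hs => ?_, fun e f s ha hr ht hs => ?_⟩
  · refine exec_call _ hιm (hm e) ht₁ ?_ ?_ hr ht hs
    · have := h₁ (G.src e)
      have := h₂ e
      simp [inputTape]
      omega
    · rw [ha, inputTape_eq_twoWords]
  · refine exec_call _ hιl (hl e f) ht₂ ?_ ?_ hr ht hs
    · have := h₃ e
      have := h₃ f
      simp [inputTape]
      omega
    · rw [ha, inputTape_eq_twoWords]

end Arith

end Traceback

/-! ### Polynomial bounds -/

/-- On positive numbers `f` is bounded by a monomial. -/
def PolyBounded (f : ℕ → ℕ) : Prop := ∃ C d : ℕ, ∀ n, 1 ≤ n → f n ≤ C * n ^ d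

namespace PolyBounded

theorem const (k : ℕ) : PolyBounded fun _ => k := ⟨k, 0, fun n _ => by simp⟩

theorem id : PolyBounded fun n => n := ⟨1, 1, fun n _ => by simp⟩

theorem add {f g : ℕ → ℕ} (hf : PolyBounded f) (hg : PolyBounded g) :
    PolyBounded fun n => f n + g n := by
  obtain ⟨C, d, hf⟩ := hf
  obtain ⟨C', d', hg⟩ := hg
  refine ⟨C + C', d + d', fun n hn => ?_⟩
  calc f n + g n ≤ C * n ^ d + C' * n ^ d' := add_le_add (hf n hn) (hg n hn)
    _ ≤ C * n ^ (d + d') + C' * n ^ (d + d') := by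
      gcongr <;> omega
    _ = _ := by ring

theorem mul {f g : ℕ → ℕ} (hf : PolyBounded f) (hg : PolyBounded g) :
    PolyBounded fun n => f n * g n := by
  obtain ⟨C, d, hf⟩ := hf
  obtain ⟨C', d', hg⟩ := hg
  refine ⟨C * C', d + d', fun n hn => ?_⟩
  calc f n * g n ≤ (C * n ^ d) * (C' * n ^ d') := Nat.mul_le_mul (hf n hn) (hg n hn)
    _ = _ := by ring

theorem pow {f : ℕ → ℕ} (hf : PolyBounded f) (k : ℕ) : PolyBounded fun n => f n ^ k := by
  induction k with
  | zero => simpa using const 1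
  | succ k ih => simpa only [pow_succ] using ih.mul hf

end PolyBounded

namespace DPDag

section Bounds

variable {S : Type} (G : DPDag S)

theorem one_le_T : 1 ≤ G.T := by
  obtain ⟨v, -⟩ := G.sources_nonempty
  exact Nat.one_le_of_lt v.isLt

theorem logT_le : G.logT ≤ G.T := Nat.log_lt_self 2 (Nat.ne_of_gt G.one_le_T)

theorem width_le : G.width ≤ G.T :=
  Finset.sup_le fun ℓ _ => (Finset.card_le_univ _).trans (by simp)

theorem length_bits_le {n : ℕ} (hn : n ≤ G.T) : n.bits.length ≤ G.logT := by
  rw [Nat.size_eq_bits_len, Nat.size_le, logT]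
  exact hn.trans_lt (Nat.lt_pow_succ_log_self (by norm_num) _)

theorem length_inList (v : Fin G.T) : (G.inList v).length = G.inDegree v := Finset.length_sort _

variable [MaxSemiring S] {V : Type} {enc : S → List V}

/-- The length of the input tape. -/
theorem length_inputTape_le {t : Fin G.T} {D a : ℕ} (hD : ∀ v, G.inDegree v ≤ D)
    (h1 : ∀ e, (enc (G.weight e)).length ≤ a) (h2 : ∀ v, (enc (G.value v)).length ≤ a) :
    (inputTape (G.instanceCode enc t)).length ≤
      2 * G.logT + 2 + G.T * (a + 2 + D * (G.logT + a + 2)) := by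
  have he : ∀ e : G.edges, (G.edgeCode enc e).length ≤ G.logT + a + 2 := fun e => by
    have h3 : (G.indexBits (G.src e)).length ≤ G.logT := G.length_bits_le (G.src e).isLt
    have h4 := h1 e
    simp [edgeCode]
    omega
  have hv : ∀ v : Fin G.T, (G.vertexCode enc v).length + 1 ≤ a + 2 + D * (G.logT + a + 2) := by
    intro v
    obtain ⟨l, hl, hl'⟩ := Traceback.vertexCode_eq (enc := enc) v
    have h3 : l.length ≤ a := by
      rw [hl']
      split_ifs with hs
      · rw [← G.value_of_mem_sources hs]
        exact h2 v
      · exact Nat.zero_le _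
    have h4 : ((G.inList v).flatMap (G.edgeCode enc)).length ≤ D * (G.logT + a + 2) := by
      rw [List.length_flatMap]
      refine (List.sum_le_card_nsmul _ (G.logT + a + 2) ?_).trans ?_
      · intro n hn
        obtain ⟨e, -, rfl⟩ := List.mem_map.1 hn
        exact he e
      · rw [List.length_map, G.length_inList, smul_eq_mul]
        exact Nat.mul_le_mul_right _ (hD v)
    rw [hl]
    simp only [List.length_append, List.length_map, List.length_cons]
    omega
  have h5 : (inputTape ((List.finRange G.T).map (G.vertexCode enc))).length ≤
      G.T * (a + 2 + D * (G.logT + a + 2)) := by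
    rw [inputTape, List.length_flatMap, List.map_map]
    refine (List.sum_le_card_nsmul _ (a + 2 + D * (G.logT + a + 2)) ?_).trans ?_
    · simpa using hv
    · simp
  have h6 := G.length_bits_le le_rfl
  have h7 : (G.indexBits t).length ≤ G.logT := G.length_bits_le t.isLt
  rw [instanceCode, inputTape_cons]
  simp only [List.length_append, List.length_map, List.length_cons, List.length_nil]
  omega

end Bounds

end DPDag

/-! ### The complexity of the traceback -/

namespace Traceback

section Route

variable {S : Type} [MaxSemiring S] {G : DPDag S}

/-- The canonical witness path consists of the edges that the program selects. -/
theorem isRoute_of_isCanonicalPath {t : Fin G.T} {P : List (Fin G.T)}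
    (h : G.IsCanonicalPath t P) : ∃ c k, IsRoute G t c k ∧ (List.range (k + 1)).map c = P := by
  have hne : P ≠ [] := by
    rintro rfl
    simp [DPDag.IsCanonicalPath] at h
  have hlen : 1 ≤ P.length := List.length_pos_iff.2 hne
  have hget : ∀ j (hj : j < P.length), P.getD j t = P[j] := fun j hj => by
    simp [List.getD_eq_getElem?_getD, hj]
  refine ⟨fun j => P.getD j t, P.length - 1, ⟨?_, ?_, fun j hj => ?_, fun i hi j hj hij => ?_⟩, ?_⟩
  · have := h.1
    rw [List.getLast?_eq_getElem?] at this
    simp [List.getD_eq_getElem?_getD, this]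
  · obtain ⟨v, hv, hP⟩ := h.2.1
    rw [List.head?_eq_getElem?] at hP
    simp [List.getD_eq_getElem?_getD, hP, G.inList_eq_nil_iff.2 hv, DPDag.firstMax]
  · have hw := List.isChain_iff_getElem.1 h.2.2 j (by omega)
    obtain ⟨e, h1, h2⟩ := DPDag.isFirstMax_of_firstMax (G.pairwise_inList P[j + 1])
      (mt G.inList_eq_nil_iff.1 hw.notMem_sources)
    refine ⟨e, ?_, ?_⟩
    · rw [hget (j + 1) (by omega), h1]
    · rw [hget j (by omega)]
      exact h2.isWitnessPred.unique hw
  · rw [hget i (by omega), hget j (by omega)] at hij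
    have hn : P.Nodup := h.pairwise.imp fun h => h.ne
    exact hn.getElem_inj_iff.1 hij
  · refine List.ext_getElem (by simp; omega) fun j h1 h2 => ?_
    simp [List.getD_eq_getElem?_getD, h2]

/-- The traceback program runs within the bounds of its context. -/
theorem haltsWithin_traceback {V K₂ Γ₂ : Type} [Finite V] [Finite K₂] [Finite Γ₂]
    {enc : S → List V} {t : Fin G.T} {E : VEnv V K₂ Γ₂} {b h : ℕ} (C : Ctx G enc t E b h)
    {pmul ple : VProg V K₂ Γ₂} (hp : IsArith G enc E pmul ple) {P : List (Fin G.T)}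
    (hP : G.IsCanonicalPath t P) :
    ((traceback pmul ple).frag.machine Reg.addr StackSym.isOne).HaltsWithin
      (G.instanceCode enc t) (G.pathCode P) (4 * (traceback pmul ple).cost E.N + 1)
      (Nat.card (Reg K₂) * (E.H + 1)) := by
  obtain ⟨c, k, hc, rfl⟩ := isRoute_of_isCanonicalPath hP
  obtain ⟨s', h1, h2⟩ := exec_traceback C hp hc
  have := (h1 ⟨fun _ => Nat.zero_le _, E.tape_le⟩).haltsWithin
  rwa [h2, C.addr, C.one, C.bs] at this

end Route

end Traceback

theorem Machine.HaltsWithin.mono {A B : Type} {M : Machine A B} {bs : List (List A)} {o : List B}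
    {t t' sp sp' : ℕ} (h : M.HaltsWithin bs o t sp) (ht : t ≤ t') (hsp : sp ≤ sp') :
    M.HaltsWithin bs o t' sp' := by
  obtain ⟨n, hn, h1, h2, h3⟩ := h
  exact ⟨n, hn.trans ht, h1, h2, h3.trans (by exact_mod_cast hsp)⟩

theorem mainTheorem1 {S Γ : Type} [MaxSemiring S] [Finite Γ]
    (enc : Computability.Encoding S Γ)
    (h_mul : PolyComputable enc.encode fun a b => enc.encode (a * b))
    (h_le : PolyComputable enc.encode fun a b => [decide (a ≤ b)]) :
    ∃ M : Machine (InSym Γ) (Option Bool),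
      ∀ Δmax c : ℕ, ∃ C d : ℕ,
        ∀ (G : DPDag S), (∀ v, G.inDegree v ≤ Δmax) → G.FitsInWords enc.encode c →
          ∀ t ∈ G.sinks, ∃ P : List (Fin G.T),
            G.IsCanonicalPath t P ∧
            (∀ P', G.IsCanonicalPath t P' → P' = P) ∧
            G.IsSourcePath P t (G.value t) ∧
            (∀ Q s, G.IsSourcePath Q t s → s ≤ G.value t) ∧
            M.HaltsWithin (G.instanceCode enc.encode t) (G.pathCode P)
              (C * G.T ^ d) (C * (G.width * G.logT + G.logT ^ d)) := by
  obtain ⟨Mm, Cm, dm, hm⟩ := h_mul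
  obtain ⟨Ml, Cl, dl, hl⟩ := h_le
  have := Mm.finite_state
  have := Mm.finite_sym
  have := Mm.finite_tp
  have := Ml.finite_state
  have := Ml.finite_sym
  have := Ml.finite_tp
  let K₂ := SimReg Mm.Tp ⊕ SimReg Ml.Tp
  let Γ₂ := (Mm.State ⊕ Mm.Sym) ⊕ (Ml.State ⊕ Ml.Sym)
  have hKm : Function.Injective (Sum.inl : SimReg Mm.Tp → K₂) := Sum.inl_injective
  have hKl : Function.Injective (Sum.inr : SimReg Ml.Tp → K₂) := Sum.inr_injective
  have hΓm : Function.Injective (Sum.inl : Mm.State ⊕ Mm.Sym → Γ₂) := Sum.inl_injective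
  have hΓl : Function.Injective (Sum.inr : Ml.State ⊕ Ml.Sym → Γ₂) := Sum.inr_injective
  set pmul : Traceback.VProg Γ K₂ Γ₂ :=
    Traceback.call (Traceback.codeOf Mm Sum.inl hΓm .val) Sum.inl with hpmul
  set ple : Traceback.VProg Γ K₂ Γ₂ :=
    Traceback.call (Traceback.codeOf Ml Sum.inr hΓl .bit) Sum.inr with hple
  refine ⟨(Traceback.traceback pmul ple).frag.machine Reg.addr StackSym.isOne, fun Δmax c => ?_⟩
  obtain ⟨Cp, dp, hcost⟩ := Prog.exists_cost_le (Traceback.traceback pmul ple)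
  -- In terms of the number `L` of digits of `T`, the bound `b` holds for indices, weights and DP
  -- values, and `t₁`, `t₂` for the times of a product and of a comparison of two products.
  let b : ℕ → ℕ := fun L => (c + 1) * L
  let t₁ : ℕ → ℕ := fun L => Cm * (2 * b L + 1) ^ dm
  let t₂ : ℕ → ℕ := fun L => Cl * (2 * (b L + t₁ L) + 1) ^ dl
  let h : ℕ → ℕ := fun L => b L + t₁ L + t₂ L
  have hb : PolyBounded b := (PolyBounded.const _).mul .id
  have ht₁ : PolyBounded t₁ :=
    (PolyBounded.const _).mul ((((PolyBounded.const _).mul hb).add (.const _)).pow _)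
  have ht₂ : PolyBounded t₂ :=
    (PolyBounded.const _).mul ((((PolyBounded.const _).mul (hb.add ht₁)).add (.const _)).pow _)
  have hh : PolyBounded fun L => 2 * b L + 2 + (6 * h L + 6) + 1 :=
    ((((PolyBounded.const _).mul hb).add (.const _)).add
      (((PolyBounded.const _).mul ((hb.add ht₁).add ht₂)).add (.const _))).add (.const _)
  obtain ⟨Cg, dg, hg⟩ := hh
  -- A bound, in terms of `T`, on the number of rounds of each loop of the program.
  let F : ℕ → ℕ := fun n => n * (2 * b n + 2) + Cg * n ^ dg + n + 1 +
    (2 * n + 2 + n * (b n + 2 + Δmax * (n + b n + 2))) + 1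
  have hF : PolyBounded F :=
    ((((((PolyBounded.id.mul (((PolyBounded.const _).mul hb).add (.const _))).add
      ((PolyBounded.const _).mul (PolyBounded.id.pow _))).add .id).add (.const _)).add
      ((((PolyBounded.const _).mul .id).add (.const _)).add (PolyBounded.id.mul
      ((hb.add (.const _)).add ((PolyBounded.const _).mul ((PolyBounded.id.add hb).add
        (.const _))))))).add (.const _))
  obtain ⟨Ct, dt, htime⟩ : PolyBounded fun n => 4 * (Cp * F n ^ dp) + 1 :=
    ((PolyBounded.const _).mul ((PolyBounded.const _).mul (hF.pow _))).add (.const _)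
  refine ⟨Ct + Nat.card (Reg K₂) * (2 * c + 4 + Cg), dt + dg, fun G hΔ hfit t _ => ?_⟩
  obtain ⟨P, hP, huniq, hsource⟩ := G.exists_canonicalPath t
  refine ⟨P, hP, huniq, hsource, fun Q s hQ => hQ.le_value, ?_⟩
  have hT := G.one_le_T
  have hL : 1 ≤ G.logT := Nat.succ_pos _
  have hLT := G.logT_le
  have hcL : c * G.logT ≤ b G.logT := Nat.mul_le_mul_right _ c.le_succ
  have hLb : G.logT ≤ b G.logT := Nat.le_mul_of_pos_left _ c.succ_pos
  have hbT : b G.logT ≤ b G.T := Nat.mul_le_mul_left _ hLT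
  have hw e := (hfit.1 e).trans hcL
  have hv v := (hfit.2 v).trans hcL
  have hmul (e : G.edges) : Mm.HaltsWithin [enc.encode (G.value (G.src e)),
      enc.encode (G.weight e)] (enc.encode (G.edgeValue e)) (t₁ G.logT) (t₁ G.logT) := by
    have : Cm * ((enc.encode (G.value (G.src e))).length +
        (enc.encode (G.weight e)).length + 1) ^ dm ≤ t₁ G.logT := by
      have := hw e
      have := hv (G.src e)
      exact Nat.mul_le_mul_left _ (Nat.pow_le_pow_left (by omega) _)
    exact (hm _ _).mono this this
  have he e := (hmul e).length_le
  have hle (e f : G.edges) : Ml.HaltsWithin [enc.encode (G.edgeValue e),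
      enc.encode (G.edgeValue f)] [decide (G.edgeValue e ≤ G.edgeValue f)] (t₂ G.logT)
        (t₂ G.logT) := by
    have : Cl * ((enc.encode (G.edgeValue e)).length + (enc.encode (G.edgeValue f)).length + 1) ^ dl
        ≤ t₂ G.logT := by
      have := he e
      have := he f
      exact Nat.mul_le_mul_left _ (Nat.pow_le_pow_left (by omega) _)
    exact (hl _ _).mono this this
  -- The table has at most `ω + 1` entries, during the evaluation of a vertex, and each entry
  -- consists of an index, a value and two separators.
  set H := (G.width + 1) * (2 * b G.logT + 2) + (6 * h G.logT + 6) with hH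
  have hhH : 6 * (b G.logT + t₁ G.logT + t₂ G.logT) + 6 ≤ H := Nat.le_add_left _ _
  let E : Traceback.VEnv Γ K₂ Γ₂ := ⟨G.instanceCode enc.encode t, .addr, StackSym.isOne,
    H + G.T + 1 + (inputTape (G.instanceCode enc.encode t)).length, H, by omega, by omega⟩
  have hC : Traceback.Ctx G enc.encode t E (b G.logT) (h G.logT) :=
    { bs := rfl
      addr := rfl
      one := rfl
      bits_le := fun n hn => (G.length_bits_le hn).trans hLb
      weight_le := fun e => (hw e).trans (by simp only [h]; omega)
      value_le := hv
      edgeValue_le := fun e => (he e).trans (by simp only [h]; omega)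
      le_h := by simp only [h]; omega
      height := le_rfl
      rounds := by simp only [E]; omega }
  have hA : Traceback.IsArith G enc.encode E pmul ple :=
    Traceback.isArith_call hKm hKl hΓm hΓl (h := b G.logT + t₁ G.logT) hmul hle
      (fun v => (hv v).trans (by omega)) (fun e => (hw e).trans (by omega))
      (fun e => (he e).trans (by omega)) (by simp only [E]; omega) (by simp only [E]; omega)
      (by simp only [E]; omega)
  have hH1 : H + 1 ≤ G.width * (2 * b G.logT + 2) + Cg * G.logT ^ dg := by
    refine le_trans (le_of_eq ?_) (Nat.add_le_add_left (hg G.logT hL) _)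
    rw [hH]
    ring
  refine (Traceback.haltsWithin_traceback hC hA hP).mono ?_ ?_
  · have hN : E.N + 1 ≤ F G.T := by
      have h1 := G.length_inputTape_le (enc := enc.encode) (t := t) hΔ hw hv
      have h2 : G.T * (b G.logT + 2 + Δmax * (G.logT + b G.logT + 2)) ≤
        G.T * (b G.T + 2 + Δmax * (G.T + b G.T + 2)) := by gcongr
      have h3 : G.width * (2 * b G.logT + 2) ≤ G.T * (2 * b G.T + 2) := by
        gcongr
        exact G.width_le
      have h4 : Cg * G.logT ^ dg ≤ Cg * G.T ^ dg := by gcongr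
      simp only [E, F]
      omega
    calc 4 * (Traceback.traceback pmul ple).cost E.N + 1
        ≤ 4 * (Cp * F G.T ^ dp) + 1 := by
          gcongr
          exact (hcost _).trans (by gcongr)
      _ ≤ Ct * G.T ^ dt := htime _ hT
      _ ≤ _ := by
        gcongr <;> omega
  · have h1 : G.width * (2 * b G.logT + 2) ≤ (2 * c + 4) * (G.width * G.logT) := by
      have : 2 * b G.logT + 2 ≤ (2 * c + 4) * G.logT := by
        simp only [b]
        nlinarith
      calc G.width * (2 * b G.logT + 2) ≤ G.width * ((2 * c + 4) * G.logT) := by gcongr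
        _ = _ := by ring
    have h2 : G.logT ^ dg ≤ G.logT ^ (dt + dg) := Nat.pow_le_pow_right hL (by omega)
    calc Nat.card (Reg K₂) * (E.H + 1)
        ≤ Nat.card (Reg K₂) * ((2 * c + 4) * (G.width * G.logT) + Cg * G.logT ^ (dt + dg)) := by
          refine Nat.mul_le_mul_left _ (hH1.trans (add_le_add h1 ?_))
          gcongr
      _ ≤ Nat.card (Reg K₂) * ((2 * c + 4 + Cg) * (G.width * G.logT + G.logT ^ (dt + dg))) := by
          refine Nat.mul_le_mul_left _ ?_
          rw [add_mul _ Cg]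
          gcongr
          · exact Nat.le_add_right _ _
          · exact Nat.le_add_left _ _
      _ = Nat.card (Reg K₂) * (2 * c + 4 + Cg) * (G.width * G.logT + G.logT ^ (dt + dg)) := by ring
      _ ≤ _ := Nat.mul_le_mul_right _ (Nat.le_add_left _ _)
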